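/- **Setting.** Let $W_i=(X_i,Y_i)$, $i\ge 1$, be i.i.d. random vectors with values in $\mathbb R^{d_1}\times\mathbb R^{d_2}$, and put $d=d_1+d_2$. Assume that $X_i$ has a Lebesgue density $f_X$ and that, given $X_i=x'$, $Y_i$ has a conditional Lebesgue density $f(x',\cdot)$. Fix a point $w=(x,y)\in\mathbb R^d$, an integer $p\ge1$ and reals $\beta\in(0,1)$, $a>1$. Let $K:\mathbb R\to\mathbb R$ be a $C^1$ kernel of order $p$ whose support $\operatorname{supp}K$ is a compact interval with $0$ in its interior: $\int K=1$, $\int t^\ell K(t)\,dt=0$ for $1\le \ell\le p-1$, and $\int t^pK(t)\,dt\ne0$. Put $J(t)=K(t)+tK'(t)$ and, for $u$ in $\mathbb R^{d}$ or $\mathbb R^{d_1}$, let $\mathcal U_n(u)=\{u-z/\log n:\ \text{all } z_j\in\operatorname{supp}K\}$. **Procedure.** Let $\tilde f_X=\tilde f_{X,n}$ be a (jointly measurable) random function on $\mathbb R^{d_1}$, the estimator of $f_X$. For $h\in(0,\infty)^d$ let $$\hat f_h(w)=\frac1n\sum_{i=1}^n\frac1{\tilde f_X(X_i)}\prod_{j=1}^d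 h_j^{-1}K\Big(\frac{w_j-W_{ij}}{h_j}\Big),\qquad Z_{hj}=\frac{\partial}{\partial h_j}\hat f_h(w),\qquad \lambda_{hj}=C_\lambda\sqrt{\frac{(\log n)^a}{n\,h_j^2\prod_k h_k}},$$ with $C_\lambda=4\|J\|_2\|K\|_2^{d-1}$. The bandwidth $\hat h$ is the output of the following algorithm. Start with $h=(1/\log n,\dots,1/\log n)$ and $\mathcal A=\{1,\dots,d\}$. While $\mathcal A\neq\emptyset$ and $\prod_k h_k\ge \frac{\log n}n$, test all $j\in\mathcal A$ simultaneously at the current $h$: if $|Z_{hj}|\ge\lambda_{hj}$, replace $h_j$ by $\beta h_j$; otherwise remove $j$ from $\mathcal A$. **Assumptions.** There is a set $\mathcal R\subset\{1,\dots,d\}$, with cardinality $r$, such that for all large $n$: 1. $\delta:=\inf_{\mathcal U_n(x)}f_X>0$; 2. on $\mathcal U_n(w)$ the value of $f$ depends only on the coordinates in $\mathcal R$; 3. $f$ is of class $C^p$ on $\mathcal U_n(w)$, and $\partial_j^pf(w)\ne0$ for all $j\in\mathcal R$; 4. for some constant $\kappa$ independent of $n$, almost surely $\tilde f_X\ge n^{-\kappa}$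 on $\mathcal U_n(x)$; 5. for some constant $M_X>0$ independent of $n$, $$\mathbb P\Big(\sup_{u\in\mathcal U_n(x)}\Big|\frac{f_X(u)-\tilde f_X(u)}{\tilde f_X(u)}\Big|>M_X\frac{(\log n)^{d/2}}{n^{1/2}}\Big)\le \exp(-(\log n)^{5/4}).$$ **Conclusion.** For every real $q\ge1$, the $L^q$ risk is finite for all large $n$, and, as $n\to\infty$, $$\Big(\mathbb E\big|\hat f_{\hat h}(w)-f(w)\big|^q\Big)^{1/q}\le C\,(\log n)^{\frac{p}{2p+r}(d-r+a)}\,n^{-\frac p{2p+r}}+o(n^{-1}),$$ where $$C=2r\,C_\tau^{\frac p{2p+r}}\int_{\mathbb R}\Big|\frac{t^p}{p!}K(t)\Big|dt\ \max_{k\in\mathcal R}\ \sup_{\mathcal U_n(w)}|\partial_k^pf|+4\|K\|_2^d\Big(\sup_{\mathcal U_n(w)}|f|\Big)^{1/2}\delta^{-1/2}\,C_T^{-\frac r{2(2p+1)}}\,C_\tau^{-\frac r{2(2p+r)}},$$ $$C_\tau=\Big(\frac{4(p-1)!\,C_\lambda}{\min_{j\in\mathcal R}|\partial_j^pf(w)|\int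 t^pK(t)\,dt}\Big)^2,\qquad C_T=\Big(\frac{\min_{j\in\mathcal R}|\partial_j^pf(w)|}{24\max_{j\in\mathcal R}|\partial_j^pf(w)|}\Big)^2 .$$ If $r=0$, then $C=4\|K\|_2^d\big(\sup_{\mathcal U_n(w)}|f|\big)^{1/2}\delta^{-1/2}$. The procedure does not use $\mathcal R$ or $r$. -/

import Mathlib

open MeasureTheory ProbabilityTheory Filter Topology

noncomputable section

namespace CDRodeo

/-! ### Kernels and neighbourhoods -/

/-- `K` is a `C^1`, compactly supported kernel of order `p`, and its support is an interval
containing `0` in its interior (so that the sets `nbhd K h u` below are neighbourhoods of `u`,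
which shrink when the bandwidth `h` does). -/
structure IsKernelOfOrder (K : ℝ → ℝ) (p : ℕ) : Prop where
  contDiff : ContDiff ℝ 1 K
  hasCompactSupport : HasCompactSupport K
  convex_tsupport : Convex ℝ (tsupport K)
  tsupport_mem_nhds : tsupport K ∈ 𝓝 (0 : ℝ)
  integral_eq_one : ∫ t, K t = 1
  moment_eq_zero : ∀ l : ℕ, 1 ≤ l → l < p → ∫ t, t ^ l * K t = 0
  moment_ne_zero : ∫ t, t ^ p * K t ≠ 0

/-- The function `J : t ↦ K t + t K'(t)`. -/
def J (K : ℝ → ℝ) (t : ℝ) : ℝ := K t + t * deriv K t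

/-- The norm of `L^2(ℝ)`. -/
def l2norm (g : ℝ → ℝ) : ℝ := Real.sqrt (∫ t, g t ^ 2)

/-- `𝒰_h(u) = {u' : u'_j = u_j - h_j z_j for all j, with z_j ∈ supp K}`. -/
def nbhd {ι : Type*} (K : ℝ → ℝ) (h u : ι → ℝ) : Set (ι → ℝ) :=
  {u' | ∃ z : ι → ℝ, (∀ j, z j ∈ tsupport K) ∧ ∀ j, u' j = u j - h j * z j}

/-- The initial bandwidth `(1 / log n, …, 1 / log n)`. -/
def initBandwidth (ι : Type*) (n : ℕ) : ι → ℝ := fun _ => 1 / Real.log n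

/-- `𝒰_n(u)`, the neighbourhood for the initial bandwidth. -/
def nbhdN {ι : Type*} (K : ℝ → ℝ) (n : ℕ) (u : ι → ℝ) : Set (ι → ℝ) :=
  nbhd K (initBandwidth ι n) u

/-- The supremum norm of `g` over the set `U`. -/
def supNorm {ι : Type*} (g : (ι → ℝ) → ℝ) (U : Set (ι → ℝ)) : ℝ :=
  sSup ((fun u => |g u|) '' U)

/-- The `p`-th partial derivative `∂_j^p f (u)` in the direction of the `j`-th coordinate. -/
def partialD {ι : Type*} [DecidableEq ι] (p : ℕ) (j : ι) (f : (ι → ℝ) → ℝ) (u : ι → ℝ) : ℝ :=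
  iteratedDeriv p (fun t => f (Function.update u j t)) (u j)

/-! ### Conditional density

A point `(x, y)` of `ℝ^{d₁} × ℝ^{d₂}` is a function on `Fin d₁ ⊕ Fin d₂`. -/

/-- The first `d₁` coordinates. -/
def fstPart {d₁ d₂ : ℕ} (u : Fin d₁ ⊕ Fin d₂ → ℝ) : Fin d₁ → ℝ := fun k => u (Sum.inl k)

/-- The last `d₂` coordinates. -/
def sndPart {d₁ d₂ : ℕ} (u : Fin d₁ ⊕ Fin d₂ → ℝ) : Fin d₂ → ℝ := fun k => u (Sum.inr k)

/-- `X` has Lebesgue density `fX`, and the conditional distribution of `Y` given `X = x` has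
Lebesgue density `f (x, ·)`, where `W = (X, Y)`. -/
structure HasCondDensity {Ω : Type*} [MeasurableSpace Ω] {d₁ d₂ : ℕ} (μ : Measure Ω)
    [IsFiniteMeasure μ] (W : Ω → Fin d₁ ⊕ Fin d₂ → ℝ) (fX : (Fin d₁ → ℝ) → ℝ)
    (f : (Fin d₁ ⊕ Fin d₂ → ℝ) → ℝ) : Prop where
  map_fst : μ.map (fun ω => fstPart (W ω)) = volume.withDensity (fun x => ENNReal.ofReal (fX x))
  cond : ∀ᵐ x ∂(μ.map (fun ω => fstPart (W ω))),
    condDistrib (fun ω => sndPart (W ω)) (fun ω => fstPart (W ω)) μ x =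
      volume.withDensity (fun y => ENNReal.ofReal (f (Sum.elim x y)))

/-! ### The kernel estimator and the algorithm

Here `g` is the estimator of the density of `X`, `W 0, …, W (n - 1)` is the sample. -/

/-- The estimator `f̂_h(w)`. -/
def kernelEst {d₁ d₂ : ℕ} (K : ℝ → ℝ) (n : ℕ) (g : (Fin d₁ → ℝ) → ℝ)
    (W : ℕ → Fin d₁ ⊕ Fin d₂ → ℝ) (w : Fin d₁ ⊕ Fin d₂ → ℝ) (h : Fin d₁ ⊕ Fin d₂ → ℝ) : ℝ :=
  1 / (n : ℝ) * ∑ i ∈ Finset.range n,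
    1 / g (fstPart (W i)) * ∏ j, (h j)⁻¹ * K ((w j - W i j) / h j)

/-- The statistic `Z_{hj}`, the partial derivative of `f̂_h(w)` with respect to `h_j`
(see `hasDerivAt_kernelEst`). -/
def statZ {d₁ d₂ : ℕ} (K : ℝ → ℝ) (n : ℕ) (g : (Fin d₁ → ℝ) → ℝ)
    (W : ℕ → Fin d₁ ⊕ Fin d₂ → ℝ) (w : Fin d₁ ⊕ Fin d₂ → ℝ) (h : Fin d₁ ⊕ Fin d₂ → ℝ)
    (j : Fin d₁ ⊕ Fin d₂) : ℝ :=
  -1 / ((n : ℝ) * h j ^ 2) * ∑ i ∈ Finset.range n,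
    1 / g (fstPart (W i)) * J K ((w j - W i j) / h j) *
      ∏ k ∈ Finset.univ.erase j, (h k)⁻¹ * K ((w k - W i k) / h k)

theorem hasDerivAt_kernelEst {d₁ d₂ : ℕ} {K : ℝ → ℝ} (hK : Differentiable ℝ K) (n : ℕ)
    (g : (Fin d₁ → ℝ) → ℝ) (W : ℕ → Fin d₁ ⊕ Fin d₂ → ℝ) (w h : Fin d₁ ⊕ Fin d₂ → ℝ)
    (j : Fin d₁ ⊕ Fin d₂) (hj : h j ≠ 0) :
    HasDerivAt (fun s => kernelEst K n g W w (Function.update h j s)) (statZ K n g W w h j)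
      (h j) := by
  have key : ∀ c : ℝ, HasDerivAt (fun s : ℝ => s⁻¹ * K (c / s))
      (-(1 / h j ^ 2) * J K (c / h j)) (h j) := by
    intro c
    have h1 : HasDerivAt (fun s : ℝ => s⁻¹) (-(h j ^ 2)⁻¹) (h j) := hasDerivAt_inv hj
    have h2 : HasDerivAt (fun s : ℝ => c / s) (c * (-(h j ^ 2)⁻¹)) (h j) := by
      simpa [div_eq_mul_inv] using h1.const_mul c
    have h3 := ((hK (c / h j)).hasDerivAt).comp (h j) h2
    have h4 := h1.mul h3
    refine h4.congr_deriv ?_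
    simp only [J, Function.comp]
    field_simp
    ring
  have hsplit : ∀ s, kernelEst K n g W w (Function.update h j s) =
      1 / (n : ℝ) * ∑ i ∈ Finset.range n, 1 / g (fstPart (W i)) *
        ((s⁻¹ * K ((w j - W i j) / s)) *
          ∏ k ∈ Finset.univ.erase j, (h k)⁻¹ * K ((w k - W i k) / h k)) := by
    intro s
    unfold kernelEst
    congr 1
    refine Finset.sum_congr rfl fun i _ => ?_
    rw [← Finset.mul_prod_erase Finset.univ _ (Finset.mem_univ j)]
    simp only [Function.update_self]
    congr 2
    refine Finset.prod_congr rfl fun k hk => ?_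
    rw [Function.update_of_ne (Finset.ne_of_mem_erase hk)]
  rw [funext hsplit]
  have := (HasDerivAt.fun_sum (u := Finset.range n) fun i _ =>
    (((key (w j - W i j)).mul_const
      (∏ k ∈ Finset.univ.erase j, (h k)⁻¹ * K ((w k - W i k) / h k))).const_mul
        (1 / g (fstPart (W i))))).const_mul (1 / (n : ℝ))
  refine this.congr_deriv ?_
  unfold statZ
  rw [Finset.mul_sum, Finset.mul_sum]
  refine Finset.sum_congr rfl fun i _ => ?_
  rw [show (-1 : ℝ) / (n * h j ^ 2) = 1 / (n : ℝ) * (-(1 / h j ^ 2)) by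
    rw [div_mul_eq_div_div]; ring]
  ring

/-- The constant `C_λ = 4 ‖J‖₂ ‖K‖₂^{d-1}`. -/
def constLambda (K : ℝ → ℝ) (d : ℕ) : ℝ := 4 * l2norm (J K) * l2norm K ^ (d - 1)

/-- The threshold `λ_{hj}`. -/
def threshold {d₁ d₂ : ℕ} (K : ℝ → ℝ) (a : ℝ) (n : ℕ) (h : Fin d₁ ⊕ Fin d₂ → ℝ)
    (j : Fin d₁ ⊕ Fin d₂) : ℝ :=
  constLambda K (d₁ + d₂) *
    Real.sqrt (Real.log n ^ a / ((n : ℝ) * h j ^ 2 * ∏ k, h k))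

/-- One iteration of the loop on a state `s = (h, 𝒜)` (current bandwidth, set of active
components): every active component is tested at the current bandwidth `h`; those that pass the
test are shrunk by the factor `β`, those that fail are deactivated. -/
def step {ι : Type*} [DecidableEq ι] (Z lam : (ι → ℝ) → ι → ℝ) (β : ℝ)
    (s : (ι → ℝ) × Finset ι) : (ι → ℝ) × Finset ι :=
  (fun j => if j ∈ s.2 ∧ lam s.1 j ≤ |Z s.1 j| then β * s.1 j else s.1 j,
    s.2.filter fun j => lam s.1 j ≤ |Z s.1 j|)

/-- The state after `t` iterations, if the loop condition is ignored. -/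
def stateAt {ι : Type*} [DecidableEq ι] [Fintype ι] (Z lam : (ι → ℝ) → ι → ℝ) (β : ℝ) (n t : ℕ) :
    (ι → ℝ) × Finset ι :=
  (step Z lam β)^[t] (initBandwidth ι n, Finset.univ)

/-- The loop condition `𝒜 ≠ ∅` and `∏ h_k ≥ log n / n`. -/
def loopCond {ι : Type*} [Fintype ι] (n : ℕ) (s : (ι → ℝ) × Finset ι) : Prop :=
  s.2.Nonempty ∧ Real.log n / n ≤ ∏ k, s.1 k

/-- The output of the loop: the bandwidth at the first time at which the loop condition fails. -/
def loopOutput {ι : Type*} [DecidableEq ι] [Fintype ι] (Z lam : (ι → ℝ) → ι → ℝ) (β : ℝ)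
    (n : ℕ) : ι → ℝ :=
  (stateAt Z lam β n (sInf {t : ℕ | ¬ loopCond n (stateAt Z lam β n t)})).1

/-- The bandwidth `ĥ` selected by the algorithm. -/
def selectedBandwidth {d₁ d₂ : ℕ} (K : ℝ → ℝ) (a β : ℝ) (n : ℕ) (g : (Fin d₁ → ℝ) → ℝ)
    (W : ℕ → Fin d₁ ⊕ Fin d₂ → ℝ) (w : Fin d₁ ⊕ Fin d₂ → ℝ) : Fin d₁ ⊕ Fin d₂ → ℝ :=
  loopOutput (statZ K n g W w) (threshold K a n) β n

/-- The estimator `f̂_ĥ(w)`. -/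
def cdRodeo {d₁ d₂ : ℕ} (K : ℝ → ℝ) (a β : ℝ) (n : ℕ) (g : (Fin d₁ → ℝ) → ℝ)
    (W : ℕ → Fin d₁ ⊕ Fin d₂ → ℝ) (w : Fin d₁ ⊕ Fin d₂ → ℝ) : ℝ :=
  kernelEst K n g W w (selectedBandwidth K a β n g W w)

/-! ### The constants of the bound -/

/-- The constant `C_τ`. -/
def constTau {d₁ d₂ : ℕ} (K : ℝ → ℝ) (p : ℕ) (f : (Fin d₁ ⊕ Fin d₂ → ℝ) → ℝ)
    (R : Finset (Fin d₁ ⊕ Fin d₂)) (w : Fin d₁ ⊕ Fin d₂ → ℝ) : ℝ :=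
  (4 * ((p - 1).factorial : ℝ) * constLambda K (d₁ + d₂) /
    ((⨅ j : R, |partialD p j.1 f w|) * ∫ t, t ^ p * K t)) ^ 2

/-- The constant `C_T`. -/
def constT {d₁ d₂ : ℕ} (p : ℕ) (f : (Fin d₁ ⊕ Fin d₂ → ℝ) → ℝ)
    (R : Finset (Fin d₁ ⊕ Fin d₂)) (w : Fin d₁ ⊕ Fin d₂ → ℝ) : ℝ :=
  ((⨅ j : R, |partialD p j.1 f w|) / (24 * ⨆ j : R, |partialD p j.1 f w|)) ^ 2

/-- `δ = inf_{𝒰_n(x)} f_X`. -/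
def infDensity {d₁ : ℕ} (K : ℝ → ℝ) (n : ℕ) (fX : (Fin d₁ → ℝ) → ℝ) (x : Fin d₁ → ℝ) : ℝ :=
  sInf (fX '' nbhdN K n x)

/-- The constant `C` of the risk bound; it depends on `n` only through the suprema over `𝒰_n(w)`
and the infimum over `𝒰_n(x)`. If `R` is empty, the factors with `C_τ` and `C_T` are
`0` in the first term (because of `r = 0`) and `1` in the second one. -/
def constC {d₁ d₂ : ℕ} (K : ℝ → ℝ) (p : ℕ) (n : ℕ) (fX : (Fin d₁ → ℝ) → ℝ)
    (f : (Fin d₁ ⊕ Fin d₂ → ℝ) → ℝ) (R : Finset (Fin d₁ ⊕ Fin d₂))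
    (w : Fin d₁ ⊕ Fin d₂ → ℝ) : ℝ :=
  2 * (R.card : ℝ) * constTau K p f R w ^ ((p : ℝ) / (2 * p + R.card)) *
      (∫ t, |t ^ p / (p.factorial : ℝ) * K t|) *
      (⨆ k : R, supNorm (partialD p k.1 f) (nbhdN K n w)) +
    4 * l2norm K ^ (d₁ + d₂) * supNorm f (nbhdN K n w) ^ (1 / 2 : ℝ) *
      infDensity K n fX (fstPart w) ^ (-(1 / 2) : ℝ) *
      constT p f R w ^ (-(R.card : ℝ) / (2 * (2 * p + 1))) *
      constTau K p f R w ^ (-(R.card : ℝ) / (2 * (2 * p + R.card)))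

end CDRodeo

end

open CDRodeo

/-! The selected bandwidth is analysed on an event of probability `1 - O(n^{-D})`, with `D` as large
as needed, on which the algorithm behaves as if there were no noise; the complement is handled by a
crude polynomial bound on the error.

*Means.* With the weights `1 / f_X(X_i)`, the mean of `f̂_h(w)` is a smoothed value of `f` at `w`,
and the mean of `h_j Z_{hj}` is the same integral with `K` replaced by `J` in the `j`-th coordinate
(`HasCondDensity.integral_weight`). Since `J` is the derivative of `t ↦ t K(t)`, its moments of
order `l` are `-l` times those of `K`. Hence the mean of `h_j Z_{hj}` vanishes if `f` does not
depend on the `j`-th coordinate (`kernelMean_kernelsJ_of_notMem`), and is of exact order `h_j ^ p`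
otherwise (`abs_kernelMean_kernelsJ_bounds`). The bias is a sum of terms of order `h_j ^ p` over
the relevant coordinates (`abs_kernelMean_sub_le`), with leading constants `|∂_j^p f(w)| |∫ t^p K| /
p!`.

*Deviations.* The algorithm only visits bandwidths `β ^ k / log n` whose product is at least
of order `log n / n`, and these are polynomially many. A Bernstein bound and a union bound show that
all deviations are below `ε √((log n)^a / (n ∏ h))`, for any fixed `ε > 0`, with a probability
`1 - O(n^{-D})` (`eventually_exists_bad_set`): the extra logarithmic factor, with `a > 1`, is what
makes both `ε` and `D` arbitrary. Estimating `f_X` costs a smaller order.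

*The loop.* On that event every test is correct: irrelevant components fail at once, and relevant
ones pass or fail according to whether `h_j ^ (2 p)` exceeds `(log n)^a / (n ∏ h)`, up to constants.
The active components always share the smallest bandwidth, so each test also compares that
bandwidth with the product over `R`. This gives `h_j ^ (2 p + r) ≤ C_τ x` for relevant `j` and a
lower bound of order `x ^ r` for `(∏_{k ∈ R} h_k) ^ (2 p + r)`, where
`x = (log n)^{a + d - r} / n` (`loopOutput_bounds`); bias and deviation are then both of order
`x ^ (p / (2 p + r))` (`abs_cdRodeo_sub_le`), which is the claimed rate (`rate_rpow_eq`).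

*The constant.* The bias is asymptotically at most half the first summand of `C`, and the deviation
carries an arbitrarily small factor, so it fits in the other half (`exists_gap`). If `R` is empty,
there is no bias, and the deviation fits in the second summand, provided that `f(w) ≠ 0`. If
`R` is empty and `f(w) = 0`, then `f` vanishes near `w`, almost surely no observation falls there,
and the estimator is `0` (`eventually_ae_cdRodeo_eq_zero`). -/

namespace CDRodeo

/-! ### Taylor expansion and kernel moments in one variable -/

/-- Taylor's formula with the `p`-th derivative only assumed to be within `η` of a constant. -/
theorem abs_taylor_sub_le {g : ℝ → ℝ} {p : ℕ} (hp : 1 ≤ p) {x₀ ρ D η : ℝ}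
    (hg : ∀ t, |t - x₀| < ρ → ContDiffAt ℝ p g t)
    (hD : ∀ t, |t - x₀| < ρ → |iteratedDeriv p g t - D| ≤ η) {x : ℝ} (hx : |x - x₀| < ρ) :
    |g x - ∑ k ∈ Finset.range p, iteratedDeriv k g x₀ / (k.factorial : ℝ) * (x - x₀) ^ k -
      D * (x - x₀) ^ p / (p.factorial : ℝ)| ≤ η * |x - x₀| ^ p / (p.factorial : ℝ) := by
  obtain ⟨n, rfl⟩ : ∃ n, p = n + 1 := ⟨p - 1, by omega⟩
  rcases eq_or_ne x₀ x with rfl | hne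
  · rw [Finset.sum_range_succ']
    simp
  have hsub : ∀ t ∈ Set.uIcc x₀ x, |t - x₀| < ρ := fun t ht => by
    have := Set.abs_sub_left_of_mem_uIcc ht
    exact lt_of_le_of_lt this hx
  have hcd : ContDiffOn ℝ (n + 1) g (Set.uIcc x₀ x) := fun t ht => by
    have := (hg t (hsub t ht)).contDiffWithinAt (s := Set.uIcc x₀ x)
    exact_mod_cast this
  obtain ⟨x', hx', h⟩ := taylor_mean_remainder_lagrange_iteratedDeriv hne hcd
  have hx'm : x' ∈ Set.uIcc x₀ x := Set.Ioo_subset_Icc_self hx'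
  have hT : taylorWithinEval g n (Set.uIcc x₀ x) x₀ x =
      ∑ k ∈ Finset.range (n + 1), iteratedDeriv k g x₀ / (k.factorial : ℝ) * (x - x₀) ^ k := by
    rw [taylor_within_apply]
    refine Finset.sum_congr rfl fun k hk => ?_
    rw [iteratedDerivWithin_eq_iteratedDeriv (uniqueDiffOn_uIcc hne) ?_ Set.left_mem_uIcc]
    · rw [smul_eq_mul]; ring
    · refine (hg x₀ (hsub x₀ Set.left_mem_uIcc)).of_le ?_
      have : k ≤ n + 1 := (Finset.mem_range.1 hk).le
      exact_mod_cast this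
  rw [← hT, h]
  have h2 := hD x' (hsub x' hx'm)
  have : iteratedDeriv (n + 1) g x' * (x - x₀) ^ (n + 1) / ((n + 1).factorial : ℝ) -
      D * (x - x₀) ^ (n + 1) / ((n + 1).factorial : ℝ) =
      (iteratedDeriv (n + 1) g x' - D) * (x - x₀) ^ (n + 1) / ((n + 1).factorial : ℝ) := by ring
  rw [this, abs_div, abs_mul, abs_pow, Nat.abs_cast]
  gcongr

/-- A kernel `G` whose moments of orders `1, …, p - 1` vanish only sees the value and the `p`-th
derivative of a `C^p` function. -/
theorem abs_integral_mul_sub_le {G g : ℝ → ℝ} {p : ℕ} (hp : 1 ≤ p) (hG : Continuous G)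
    (hGc : HasCompactSupport G) (hmom : ∀ l : ℕ, 1 ≤ l → l < p → ∫ t, t ^ l * G t = 0)
    (hgm : Measurable g) {x₀ ρ D η h : ℝ} (hh : 0 ≤ h)
    (hg : ∀ t, |t - x₀| < ρ → ContDiffAt ℝ p g t)
    (hD : ∀ t, |t - x₀| < ρ → |iteratedDeriv p g t - D| ≤ η)
    (hsupp : ∀ t, G t ≠ 0 → |h * t| < ρ) :
    |(∫ t, G t * g (x₀ - h * t)) -
      (g x₀ * (∫ t, G t) + D * (-h) ^ p / (p.factorial : ℝ) * ∫ t, t ^ p * G t)| ≤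
      η * h ^ p / (p.factorial : ℝ) * ∫ t, |t ^ p * G t| := by
  have hint : ∀ l : ℕ, Integrable (fun t => t ^ l * G t) := fun l =>
    ((continuous_pow l).mul hG).integrable_of_hasCompactSupport hGc.mul_left
  set c : ℕ → ℝ := fun k => iteratedDeriv k g x₀ / (k.factorial : ℝ) with hc
  set r : ℝ → ℝ := fun t => G t * (g (x₀ - h * t) -
    ∑ k ∈ Finset.range p, c k * (-(h * t)) ^ k - D * (-(h * t)) ^ p / (p.factorial : ℝ)) with hr
  have hrle : ∀ t, |r t| ≤ η * h ^ p / (p.factorial : ℝ) * |t ^ p * G t| := by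
    intro t
    by_cases h0 : G t = 0
    · simp [hr, h0]
    · have hlt := hsupp t h0
      have := abs_taylor_sub_le hp hg hD (x := x₀ - h * t) (by simpa using hlt)
      rw [show x₀ - h * t - x₀ = -(h * t) by ring] at this
      rw [hr]
      simp only [abs_mul]
      calc |G t| * _ ≤ |G t| * (η * |-(h * t)| ^ p / (p.factorial : ℝ)) := by gcongr
        _ = _ := by
          rw [abs_neg, abs_mul, abs_of_nonneg hh, mul_pow, abs_pow]; ring
  have hrint : Integrable r := by
    refine Integrable.mono' ((hint p).abs.const_mul (η * h ^ p / (p.factorial : ℝ))) ?_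
      (Eventually.of_forall hrle)
    have := hG.measurable
    exact Measurable.aestronglyMeasurable (by fun_prop)
  have hdec : ∀ t, G t * g (x₀ - h * t) = r t +
      (∑ k ∈ Finset.range p, c k * (-h) ^ k * (t ^ k * G t) +
        D * (-h) ^ p / (p.factorial : ℝ) * (t ^ p * G t)) := by
    intro t
    have h1 : ∀ k, c k * (-(h * t)) ^ k = c k * (-h) ^ k * t ^ k := fun k => by
      rw [show -(h * t) = -h * t by ring, mul_pow]; ring
    have h2 : D * (-(h * t)) ^ p = D * (-h) ^ p * t ^ p := by
      rw [show -(h * t) = -h * t by ring, mul_pow]; ring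
    simp only [hr, h1, h2]
    have : ∑ k ∈ Finset.range p, c k * (-h) ^ k * (t ^ k * G t) =
        G t * ∑ k ∈ Finset.range p, c k * (-h) ^ k * t ^ k := by
      rw [Finset.mul_sum]; exact Finset.sum_congr rfl fun k _ => by ring
    rw [this]; ring
  have hsum : ∑ k ∈ Finset.range p, c k * (-h) ^ k * (∫ t, t ^ k * G t) = g x₀ * ∫ t, G t := by
    obtain ⟨n, rfl⟩ : ∃ n, p = n + 1 := ⟨p - 1, by omega⟩
    rw [Finset.sum_range_succ', Finset.sum_eq_zero]
    · simp [hc]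
    · intro k hk
      rw [hmom (k + 1) (by omega) (by have := Finset.mem_range.1 hk; omega), mul_zero]
  have hI : ∫ t, G t * g (x₀ - h * t) = (∫ t, r t) +
      (g x₀ * (∫ t, G t) + D * (-h) ^ p / (p.factorial : ℝ) * ∫ t, t ^ p * G t) := by
    simp_rw [hdec]
    have hi1 : Integrable fun t => ∑ k ∈ Finset.range p, c k * (-h) ^ k * (t ^ k * G t) :=
      integrable_finsetSum _ fun k _ => (hint k).const_mul _
    have hi2 : Integrable fun t => D * (-h) ^ p / (p.factorial : ℝ) * (t ^ p * G t) :=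
      (hint p).const_mul _
    have e := integral_add hrint (hi1.add hi2)
    simp only [Pi.add_apply] at e
    rw [e, integral_add hi1 hi2,
      integral_finsetSum _ fun k _ => (hint k).const_mul _]
    simp_rw [integral_const_mul]
    rw [hsum]
  rw [hI, add_sub_cancel_right, ← integral_const_mul]
  refine (abs_integral_le_integral_abs).trans ?_
  exact integral_mono hrint.abs ((hint p).abs.const_mul _) hrle

namespace IsKernelOfOrder

variable {K : ℝ → ℝ} {p : ℕ}

theorem zero_mem (hK : IsKernelOfOrder K p) : (0 : ℝ) ∈ tsupport K :=
  mem_of_mem_nhds hK.tsupport_mem_nhds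

theorem continuous (hK : IsKernelOfOrder K p) : Continuous K := hK.contDiff.continuous

theorem continuous_J (hK : IsKernelOfOrder K p) : Continuous (J K) :=
  hK.continuous.add (continuous_id.mul (hK.contDiff.continuous_deriv le_rfl))

theorem J_eq_zero {t : ℝ} (ht : t ∉ tsupport K) : J K t = 0 := by
  have h1 : K t = 0 := image_eq_zero_of_notMem_tsupport ht
  have h2 : deriv K t = 0 := by
    by_contra h
    exact ht (support_deriv_subset h)
  simp [J, h1, h2]

theorem hasCompactSupport_J (hK : IsKernelOfOrder K p) : HasCompactSupport (J K) :=
  HasCompactSupport.intro hK.hasCompactSupport fun _ ht => J_eq_zero ht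

/-- Since `J` is the derivative of `t ↦ t K t`, its moments are multiples of those of `K`. -/
theorem integral_pow_mul_J (hK : IsKernelOfOrder K p) (l : ℕ) :
    ∫ t, t ^ l * J K t = -(l : ℝ) * ∫ t, t ^ l * K t := by
  have hd : Differentiable ℝ K := hK.contDiff.differentiable one_ne_zero
  have hder : ∀ t, HasDerivAt (fun t => t ^ (l + 1) * K t)
      (t ^ l * J K t + l * (t ^ l * K t)) t := by
    intro t
    have := (hasDerivAt_pow (l + 1) t).mul (hd t).hasDerivAt
    refine this.congr_deriv ?_
    simp only [J, Nat.add_sub_cancel]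
    push_cast
    ring
  have hi1 : Integrable fun t => t ^ l * J K t :=
    ((continuous_pow l).mul hK.continuous_J).integrable_of_hasCompactSupport
      hK.hasCompactSupport_J.mul_left
  have hi2 : ∀ l : ℕ, Integrable fun t => t ^ l * K t := fun l =>
    ((continuous_pow l).mul hK.continuous).integrable_of_hasCompactSupport
      hK.hasCompactSupport.mul_left
  have := integral_eq_zero_of_hasDerivAt_of_integrable hder (hi1.add ((hi2 l).const_mul _))
    (hi2 (l + 1))
  rw [integral_add hi1 ((hi2 l).const_mul _), integral_const_mul] at this
  linarith

theorem integral_J (hK : IsKernelOfOrder K p) : ∫ t, J K t = 0 := by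
  simpa using hK.integral_pow_mul_J 0

theorem l2norm_pos {g : ℝ → ℝ} (hg : Continuous g) (hgc : HasCompactSupport g)
    {t : ℝ} (ht : g t ≠ 0) : 0 < l2norm g := by
  refine Real.sqrt_pos.2 ?_
  refine (hg.pow 2).integral_pos_of_hasCompactSupport_nonneg_nonzero (μ := volume) ?_
    (fun t => sq_nonneg _) (x := t) (pow_ne_zero 2 ht)
  exact hgc.comp_left (g := fun x : ℝ => x ^ 2) (by simp)

theorem constLambda_pos (hK : IsKernelOfOrder K p) (hp : 1 ≤ p) (d : ℕ) :
    0 < constLambda K d := by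
  obtain ⟨t, ht⟩ : ∃ t, K t ≠ 0 := by
    by_contra! h
    exact hK.moment_ne_zero (by simp [h])
  obtain ⟨s, hs⟩ : ∃ s, J K s ≠ 0 := by
    by_contra! h
    have h1 := hK.integral_pow_mul_J p
    simp only [h, mul_zero, integral_zero] at h1
    have : (p : ℝ) ≠ 0 := by positivity
    have h2 := hK.moment_ne_zero
    exact mul_ne_zero (neg_ne_zero.2 this) h2 h1.symm
  have h1 := l2norm_pos hK.continuous hK.hasCompactSupport ht
  have h2 := l2norm_pos hK.continuous_J hK.hasCompactSupport_J hs
  unfold constLambda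
  positivity

end IsKernelOfOrder

theorem continuousAt_partialD {ι : Type*} [Fintype ι] [DecidableEq ι] {p : ℕ} {j : ι}
    {f : (ι → ℝ) → ℝ} {w : ι → ℝ} (hf : ContDiffAt ℝ p f w) :
    ContinuousAt (partialD p j f) w := by
  induction p generalizing f with
  | zero =>
    have : partialD 0 j f = f := by
      funext u; simp [partialD]
    rw [this]; exact hf.continuousAt
  | succ p ih =>
    set g : (ι → ℝ) → ℝ := fun v => fderiv ℝ f v (Pi.single j 1) with hgdef
    have hg : ContDiffAt ℝ p g w :=
      (hf.fderiv_right (m := p) (by norm_cast)).clm_apply contDiffAt_const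
    refine (ih hg).congr ?_
    have hdiff : ∀ᶠ u in 𝓝 w, DifferentiableAt ℝ f u := by
      have h1 : ContDiffAt ℝ 1 f w := hf.of_le (by norm_cast; omega)
      filter_upwards [h1.eventually (by simp)] with u hu using hu.differentiableAt one_ne_zero
    filter_upwards [hdiff.eventually_nhds] with u hu
    unfold partialD
    rw [iteratedDeriv_succ']
    refine (Filter.EventuallyEq.iteratedDeriv_eq p ?_)
    have hcont : Tendsto (fun t : ℝ => Function.update u j t) (𝓝 (u j)) (𝓝 u) := by
      have : Continuous fun t : ℝ => Function.update u j t :=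
        continuous_const.update j continuous_id
      simpa using this.tendsto (u j)
    filter_upwards [hcont.eventually hu] with t ht
    exact ((ht.hasFDerivAt.comp_hasDerivAt t (hasDerivAt_update u j t)).deriv).symm

/-! ### Integrating out one coordinate of a product kernel -/

theorem measurable_update_uncurry {ι : Type*} [DecidableEq ι] (j : ι) :
    Measurable fun q : (ι → ℝ) × ℝ => Function.update q.1 j q.2 := by
  refine measurable_pi_lambda _ fun k => ?_
  by_cases hk : k = j
  · subst hk; simpa using measurable_snd
  · simp only [Function.update_of_ne hk]
    exact (measurable_pi_apply k).comp measurable_fst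

theorem ae_mem_pi_restrict {ι : Type*} [Fintype ι] {S : Set ℝ} (hS : MeasurableSet S) :
    ∀ᵐ z ∂(Measure.pi fun _ : ι => (volume : Measure ℝ).restrict S), ∀ k, z k ∈ S := by
  rw [← Measure.restrict_pi_pi]
  filter_upwards [ae_restrict_mem (MeasurableSet.univ_pi fun _ : ι => hS)] with z hz k
    using hz k (Set.mem_univ k)

section Box

variable {ι : Type*} [Fintype ι] [DecidableEq ι]

/-- Resampling one coordinate of a product of finite measures only multiplies it by the mass of
one factor. -/
theorem map_update_prod_pi (ν : Measure ℝ) [IsFiniteMeasure ν] (hν : ν ≠ 0) (j : ι) :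
    Measure.map (fun q : (ι → ℝ) × ℝ => Function.update q.1 j q.2)
      ((Measure.pi fun _ : ι => ν).prod ν) = ν Set.univ • Measure.pi fun _ : ι => ν := by
  have hc : ν Set.univ ≠ 0 := by simpa using hν
  have hc' : ν Set.univ ≠ ⊤ := measure_ne_top _ _
  have hmeas := measurable_update_uncurry j
  have key : Measure.pi (fun _ : ι => ν) = (ν Set.univ)⁻¹ •
      Measure.map (fun q : (ι → ℝ) × ℝ => Function.update q.1 j q.2)
        ((Measure.pi fun _ : ι => ν).prod ν) := by
    refine Measure.pi_eq fun s hs => ?_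
    have hpre : (fun q : (ι → ℝ) × ℝ => Function.update q.1 j q.2) ⁻¹' (Set.univ.pi s) =
        (Set.univ.pi (Function.update s j Set.univ)) ×ˢ s j := by
      ext q
      simp only [Set.mem_preimage, Set.mem_pi, Set.mem_univ, true_implies, Set.mem_prod]
      constructor
      · intro h
        refine ⟨fun k => ?_, by simpa using h j⟩
        by_cases hk : k = j
        · subst hk; simp
        · simpa [Function.update_of_ne hk] using h k
      · rintro ⟨h1, h2⟩ k
        by_cases hk : k = j
        · subst hk; simpa using h2
        · simpa [Function.update_of_ne hk] using h1 k
    rw [Measure.smul_apply, Measure.map_apply hmeas (MeasurableSet.univ_pi hs), hpre,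
      Measure.prod_prod, Measure.pi_pi, ← Finset.mul_prod_erase Finset.univ _ (Finset.mem_univ j),
      ← Finset.mul_prod_erase Finset.univ (fun i => ν (s i)) (Finset.mem_univ j)]
    simp only [Function.update_self, smul_eq_mul]
    have : ∏ x ∈ Finset.univ.erase j, ν (Function.update s j Set.univ x) =
        ∏ x ∈ Finset.univ.erase j, ν (s x) :=
      Finset.prod_congr rfl fun k hk => by rw [Function.update_of_ne (Finset.ne_of_mem_erase hk)]
    rw [this, mul_assoc, ← mul_assoc, ENNReal.inv_mul_cancel hc hc', one_mul, mul_comm]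
  conv_rhs => rw [key]
  rw [smul_smul, ENNReal.mul_inv_cancel hc hc', one_smul]

theorem integrable_update_of_integrable {ν : Measure ℝ} [IsFiniteMeasure ν] (hν : ν ≠ 0) (j : ι)
    {F : (ι → ℝ) → ℝ} (hF : Integrable F (Measure.pi fun _ : ι => ν)) :
    Integrable (fun q : (ι → ℝ) × ℝ => F (Function.update q.1 j q.2))
      ((Measure.pi fun _ : ι => ν).prod ν) := by
  have h := map_update_prod_pi ν hν j
  have hF' : Integrable F (Measure.map (fun q : (ι → ℝ) × ℝ => Function.update q.1 j q.2)
      ((Measure.pi fun _ : ι => ν).prod ν)) := by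
    rw [h]; exact hF.smul_measure (measure_ne_top _ _)
  exact hF'.comp_measurable (measurable_update_uncurry j)

theorem integral_integral_update {ν : Measure ℝ} [IsFiniteMeasure ν] (hν : ν ≠ 0) (j : ι)
    {F : (ι → ℝ) → ℝ} (hF : Integrable F (Measure.pi fun _ : ι => ν)) :
    ∫ z, ∫ t, F (Function.update z j t) ∂ν ∂(Measure.pi fun _ : ι => ν) =
      ν.real Set.univ * ∫ z, F z ∂(Measure.pi fun _ : ι => ν) := by
  have h := map_update_prod_pi ν hν j
  have hF' : AEStronglyMeasurable F
      (Measure.map (fun q : (ι → ℝ) × ℝ => Function.update q.1 j q.2)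
      ((Measure.pi fun _ : ι => ν).prod ν)) := by
    rw [h]; exact (hF.smul_measure (measure_ne_top _ _)).aestronglyMeasurable
  have h1 := integral_map (measurable_update_uncurry j).aemeasurable hF'
  rw [h, integral_smul_measure, smul_eq_mul] at h1
  have h2 := integral_prod _ (integrable_update_of_integrable hν j hF)
  rw [← h2, ← h1]
  rfl

theorem integrable_prod_mul {ι : Type*} [Fintype ι] {S : Set ℝ} (hS : IsCompact S) {G : ι → ℝ → ℝ}
    (hG : ∀ k, Continuous (G k)) {H : (ι → ℝ) → ℝ} (hH : Measurable H) {B : ℝ}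
    (hB : ∀ z, (∀ k, z k ∈ S) → |H z| ≤ B) :
    Integrable (fun z => (∏ k, G k (z k)) * H z)
      (Measure.pi fun _ : ι => (volume : Measure ℝ).restrict S) := by
  have hf : IsFiniteMeasure ((volume : Measure ℝ).restrict S) :=
    ⟨by rw [Measure.restrict_apply_univ]; exact hS.measure_lt_top⟩
  have h1 : Integrable (fun z : ι → ℝ => ∏ k, G k (z k))
      (Measure.pi fun _ : ι => (volume : Measure ℝ).restrict S) :=
    Integrable.fintype_prod (f := G) fun k => (hG k).continuousOn.integrableOn_compact hS
  refine h1.mul_bdd (c := B) hH.aestronglyMeasurable ?_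
  filter_upwards [ae_mem_pi_restrict hS.measurableSet] with z hz using hB z hz

/-- If integrating out the `j`-th coordinate against `G j` always gives `c` up to an error `e`,
the integral against the product kernel is `c` times the product of the other integrals, up to a
multiple of `e`. -/
theorem abs_integral_prod_mul_sub_le {S : Set ℝ} (hS : IsCompact S)
    (hS0 : volume S ≠ 0) (j : ι) {G : ι → ℝ → ℝ} (hG : ∀ k, Continuous (G k))
    {H : (ι → ℝ) → ℝ} (hH : Measurable H) {B : ℝ} (hB : ∀ z, (∀ k, z k ∈ S) → |H z| ≤ B)
    {c e : ℝ} (hin : ∀ z, (∀ k, z k ∈ S) →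
      |(∫ t in S, G j t * H (Function.update z j t)) - c| ≤ e) :
    |(∫ z, (∏ k, G k (z k)) * H z ∂(Measure.pi fun _ : ι => (volume : Measure ℝ).restrict S)) -
      c * ∏ k ∈ Finset.univ.erase j, ∫ t in S, G k t| ≤
      e * ∏ k ∈ Finset.univ.erase j, ∫ t in S, |G k t| := by
  set ν : Measure ℝ := (volume : Measure ℝ).restrict S with hν
  have hf : IsFiniteMeasure ν :=
    ⟨by rw [Measure.restrict_apply_univ]; exact hS.measure_lt_top⟩
  have hν0 : ν ≠ 0 := by
    rw [← Measure.measure_univ_ne_zero, Measure.restrict_apply_univ]; exact hS0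
  have hV : 0 < ν.real Set.univ := by
    have : NeZero ν := ⟨hν0⟩
    exact measureReal_univ_pos
  set π : Measure (ι → ℝ) := Measure.pi fun _ : ι => ν with hπ
  have hprod : ∀ G : ι → ℝ → ℝ, (∀ k, Continuous (G k)) →
      Integrable (fun z : ι → ℝ => ∏ k ∈ Finset.univ.erase j, G k (z k)) π ∧
      ∫ z, ∏ k ∈ Finset.univ.erase j, G k (z k) ∂π =
        ν.real Set.univ * ∏ k ∈ Finset.univ.erase j, ∫ t, G k t ∂ν := by
    intro G hG
    have e1 : ∀ z : ι → ℝ, ∏ k ∈ Finset.univ.erase j, G k (z k) =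
        ∏ k, (Function.update G j fun _ => 1) k (z k) := by
      intro z
      rw [← Finset.mul_prod_erase Finset.univ _ (Finset.mem_univ j)]
      simp only [Function.update_self, one_mul]
      exact Finset.prod_congr rfl fun k hk => by
        rw [Function.update_of_ne (Finset.ne_of_mem_erase hk)]
    simp_rw [e1]
    constructor
    · refine Integrable.fintype_prod (f := Function.update G j fun _ => 1) fun k => ?_
      by_cases hk : k = j
      · subst hk; simp
      · rw [Function.update_of_ne hk]; exact (hG k).continuousOn.integrableOn_compact hS
    · rw [hπ, integral_fintype_prod_eq_prod,
        ← Finset.mul_prod_erase Finset.univ _ (Finset.mem_univ j)]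
      congr 1
      · simp
      · exact Finset.prod_congr rfl fun k hk => by
          rw [Function.update_of_ne (Finset.ne_of_mem_erase hk)]
  have hFint := integrable_prod_mul (ι := ι) hS hG hH hB
  have hI := integral_integral_update hν0 j hFint
  have hIint := (integrable_update_of_integrable hν0 j hFint).integral_prod_left
  have e2 : ∀ z : ι → ℝ, ∫ t, (∏ k, G k (Function.update z j t k)) * H (Function.update z j t) ∂ν =
      (∏ k ∈ Finset.univ.erase j, G k (z k)) * ∫ t, G j t * H (Function.update z j t) ∂ν := by
    intro z
    rw [← integral_const_mul]
    congr 1; funext t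
    rw [← Finset.mul_prod_erase Finset.univ _ (Finset.mem_univ j)]
    simp only [Function.update_self]
    have : ∏ k ∈ Finset.univ.erase j, G k (Function.update z j t k) =
        ∏ k ∈ Finset.univ.erase j, G k (z k) :=
      Finset.prod_congr rfl fun k hk => by rw [Function.update_of_ne (Finset.ne_of_mem_erase hk)]
    rw [this]; ring
  simp_rw [e2] at hI hIint
  obtain ⟨hp1, hp2⟩ := hprod G hG
  obtain ⟨ha1, ha2⟩ := hprod (fun k t => |G k t|) fun k => (hG k).abs
  have hdiff : ν.real Set.univ * ((∫ z, (∏ k, G k (z k)) * H z ∂π) -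
      c * ∏ k ∈ Finset.univ.erase j, ∫ t, G k t ∂ν) =
      ∫ z, (∏ k ∈ Finset.univ.erase j, G k (z k)) *
        ((∫ t, G j t * H (Function.update z j t) ∂ν) - c) ∂π := by
    simp_rw [mul_sub]
    rw [integral_sub hIint (hp1.mul_const c), hI, integral_mul_const, hp2]
    ring
  have hle : |ν.real Set.univ * ((∫ z, (∏ k, G k (z k)) * H z ∂π) -
      c * ∏ k ∈ Finset.univ.erase j, ∫ t, G k t ∂ν)| ≤
      ν.real Set.univ * (e * ∏ k ∈ Finset.univ.erase j, ∫ t, |G k t| ∂ν) := by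
    rw [hdiff, ← Real.norm_eq_abs]
    refine (norm_integral_le_of_norm_le (ha1.mul_const e) ?_).trans (le_of_eq ?_)
    · filter_upwards [ae_mem_pi_restrict (ι := ι) hS.measurableSet] with z hz
      rw [Real.norm_eq_abs, abs_mul, Finset.abs_prod]
      exact mul_le_mul_of_nonneg_left (hin z hz) (Finset.prod_nonneg fun _ _ => abs_nonneg _)
    · rw [integral_mul_const, ha2]; ring
  rw [abs_mul, abs_of_pos hV] at hle
  exact le_of_mul_le_mul_left hle hV

end Box

/-! ### The bias -/

section Bias

variable {ι : Type*} [Fintype ι] [DecidableEq ι]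

/-- The mean of a product-kernel estimator of `f` at `w` with kernel `G k` and bandwidth `h k` in
the `k`-th coordinate, written as an integral over the box on which the kernels live. -/
noncomputable def kernelMean (K : ℝ → ℝ) (G : ι → ℝ → ℝ) (f : (ι → ℝ) → ℝ) (w h : ι → ℝ) : ℝ :=
  ∫ z, (∏ k, G k (z k)) * f (fun k => w k - h k * z k)
    ∂(Measure.pi fun _ : ι => (volume : Measure ℝ).restrict (tsupport K))

/-- The kernels of the statistic `Z_{hj}`: `J` in the `j`-th coordinate and `K` elsewhere. -/
noncomputable def kernelsJ (K : ℝ → ℝ) (j : ι) : ι → ℝ → ℝ := Function.update (fun _ => K) j (J K)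

/-- Local regularity of `f` at the scale of bandwidths at most `τ`: on the sup-norm ball of radius
`ρ` around `w`, `f` is `C^p` and bounded by `B`, its pure derivatives of order `p` in the
directions of `R` vary by at most `η`, and bandwidths at most `τ` only see points of this ball,
where `f` depends only on the coordinates in `R`. -/
structure IsRegularNear (K : ℝ → ℝ) (p : ℕ) (f : (ι → ℝ) → ℝ) (w : ι → ℝ) (R : Finset ι)
    (τ ρ B η : ℝ) : Prop where
  contDiffAt : ∀ u : ι → ℝ, (∀ k, |u k - w k| < ρ) → ContDiffAt ℝ p f u
  partialD : ∀ u : ι → ℝ, (∀ k, |u k - w k| < ρ) → ∀ j ∈ R,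
    |partialD p j f u - partialD p j f w| ≤ η
  bound : ∀ u : ι → ℝ, (∀ k, |u k - w k| < ρ) → |f u| ≤ B
  small : ∀ t ∈ tsupport K, |τ * t| < ρ
  sparse : ∀ u ∈ nbhd K (fun _ => τ) w, ∀ v ∈ nbhd K (fun _ => τ) w,
    (∀ j ∈ R, u j = v j) → f u = f v

variable {K : ℝ → ℝ} {p : ℕ} {f : (ι → ℝ) → ℝ} {w : ι → ℝ} {R : Finset ι} {τ ρ B η : ℝ}

theorem IsKernelOfOrder.scale_mem (hK : IsKernelOfOrder K p) (hτ : 0 < τ) {s t : ℝ} (hs : 0 ≤ s)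
    (hsτ : s ≤ τ) (ht : t ∈ tsupport K) : s / τ * t ∈ tsupport K := by
  have := hK.convex_tsupport hK.zero_mem ht (a := 1 - s / τ) (b := s / τ)
    (sub_nonneg.2 ((div_le_one hτ).2 hsτ)) (by positivity) (by ring)
  simpa using this

theorem IsKernelOfOrder.mem_nbhd {ι : Type*} {w : ι → ℝ} (hK : IsKernelOfOrder K p) (hτ : 0 < τ)
    {h z : ι → ℝ}
    (hh : ∀ k, 0 ≤ h k) (hhτ : ∀ k, h k ≤ τ) (hz : ∀ k, z k ∈ tsupport K) :
    (fun k => w k - h k * z k) ∈ nbhd K (fun _ => τ) w :=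
  ⟨fun k => h k / τ * z k, fun k => hK.scale_mem hτ (hh k) (hhτ k) (hz k), fun k => by
    have := hτ.ne'
    field_simp⟩

theorem IsRegularNear.dist_lt (hreg : IsRegularNear K p f w R τ ρ B η)
    {s t : ℝ} (hs : 0 ≤ s) (hsτ : s ≤ τ) (ht : t ∈ tsupport K) : |s * t| < ρ := by
  refine lt_of_le_of_lt ?_ (hreg.small t ht)
  rw [abs_mul, abs_mul, abs_of_nonneg hs, abs_of_nonneg (hs.trans hsτ)]
  gcongr

theorem IsRegularNear.dist_lt' (hreg : IsRegularNear K p f w R τ ρ B η)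
    {h z : ι → ℝ} (hh : ∀ k, 0 ≤ h k) (hhτ : ∀ k, h k ≤ τ) (hz : ∀ k, z k ∈ tsupport K) (k : ι) :
    |(w k - h k * z k) - w k| < ρ := by
  have := hreg.dist_lt (hh k) (hhτ k) (hz k)
  rwa [sub_sub_cancel_left, abs_neg]

theorem IsKernelOfOrder.volume_ne_zero (hK : IsKernelOfOrder K p) : volume (tsupport K) ≠ 0 :=
  (Measure.measure_pos_of_mem_nhds volume hK.tsupport_mem_nhds).ne'

theorem setIntegral_tsupport {G : ℝ → ℝ} (hG : ∀ t ∉ tsupport K, G t = 0) :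
    ∫ t in tsupport K, G t = ∫ t, G t :=
  setIntegral_eq_integral_of_forall_compl_eq_zero hG

/-- Expansion of the kernel integral in one relevant coordinate. -/
theorem IsRegularNear.abs_integral_coord_sub_le (hreg : IsRegularNear K p f w R τ ρ B η)
    (hp : 1 ≤ p) (hf : Measurable f) {j : ι} (hj : j ∈ R) {G : ℝ → ℝ}
    (hG : Continuous G) (hGc : HasCompactSupport G) (hGK : ∀ t ∉ tsupport K, G t = 0)
    (hmom : ∀ l : ℕ, 1 ≤ l → l < p → ∫ t, t ^ l * G t = 0)
    {h z : ι → ℝ} (hh : ∀ k, 0 ≤ h k) (hhτ : ∀ k, h k ≤ τ) (hz : ∀ k, z k ∈ tsupport K) :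
    |(∫ t in tsupport K, G t * f (fun k => w k - h k * Function.update z j t k)) -
      (f (fun k => w k - Function.update h j 0 k * z k) * (∫ t, G t) +
        CDRodeo.partialD p j f w * (-h j) ^ p / (p.factorial : ℝ) * ∫ t, t ^ p * G t)| ≤
      η * h j ^ p / (p.factorial : ℝ) * ∫ t, |t ^ p * G t| := by
  set u : ι → ℝ := fun k => w k - h k * z k with hu
  have hupd : ∀ t, (fun k => w k - h k * Function.update z j t k) =
      Function.update u j (w j - h j * t) := by
    intro t; funext k
    by_cases hk : k = j
    · subst hk; simp
    · simp [Function.update_of_ne hk, hu]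
  have hupd0 : (fun k => w k - Function.update h j 0 k * z k) = Function.update u j (w j) := by
    funext k
    by_cases hk : k = j
    · subst hk; simp
    · simp [Function.update_of_ne hk, hu]
  have hball : ∀ s, |s - w j| < ρ → ∀ k, |Function.update u j s k - w k| < ρ := by
    intro s hs k
    by_cases hk : k = j
    · subst hk; simpa using hs
    · rw [Function.update_of_ne hk]; exact hreg.dist_lt' hh hhτ hz k
  have hcd : ContDiff ℝ p fun s : ℝ => Function.update u j s := contDiff_update _ u j
  have key := abs_integral_mul_sub_le (G := G) (g := fun s => f (Function.update u j s)) hp hG hGc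
    hmom (hf.comp (measurable_update u)) (x₀ := w j) (ρ := ρ) (D := CDRodeo.partialD p j f w)
    (η := η) (hh j)
    (fun s hs => (hreg.contDiffAt _ (hball s hs)).comp s hcd.contDiffAt)
    (fun s hs => by
      have := hreg.partialD _ (hball s hs) j hj
      simpa [CDRodeo.partialD, Function.update_idem] using this)
    (fun t ht => hreg.dist_lt (hh j) (hhτ j) (by by_contra hc; exact ht (hGK t hc)))
  simp_rw [hupd, hupd0]
  rw [setIntegral_tsupport fun t ht => by rw [hGK t ht, zero_mul]]
  exact key

theorem kernelsJ_continuous {ι : Type*} [DecidableEq ι] (hK : IsKernelOfOrder K p) (j k : ι) :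
    Continuous (kernelsJ K j k) := by
  by_cases hk : k = j
  · subst hk; simpa [kernelsJ] using hK.continuous_J
  · simpa [kernelsJ, Function.update_of_ne hk] using hK.continuous

theorem IsRegularNear.bound_kernel (hreg : IsRegularNear K p f w R τ ρ B η)
    {h z : ι → ℝ} (hh : ∀ k, 0 ≤ h k) (hhτ : ∀ k, h k ≤ τ) (hz : ∀ k, z k ∈ tsupport K) :
    |f (fun k => w k - h k * z k)| ≤ B :=
  hreg.bound _ (hreg.dist_lt' hh hhτ hz)

theorem measurable_affine_comp {ι : Type*} {f : (ι → ℝ) → ℝ} (hf : Measurable f) (w h : ι → ℝ) :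
    Measurable fun z : ι → ℝ => f (fun k => w k - h k * z k) :=
  hf.comp (measurable_pi_lambda _ fun k => ((measurable_pi_apply k).const_mul _).const_sub _)

/-- In an irrelevant coordinate, the statistic `Z_{hj}` is centred. -/
theorem kernelMean_kernelsJ_of_notMem (hK : IsKernelOfOrder K p)
    (hreg : IsRegularNear K p f w R τ ρ B η) (hτ : 0 < τ) (hf : Measurable f)
    {j : ι} (hj : j ∉ R) {h : ι → ℝ} (hh : ∀ k, 0 ≤ h k) (hhτ : ∀ k, h k ≤ τ) :
    kernelMean K (kernelsJ K j) f w h = 0 := by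
  have := abs_integral_prod_mul_sub_le hK.hasCompactSupport hK.volume_ne_zero j
    (G := kernelsJ K j) (kernelsJ_continuous hK j)
    (H := fun z => f (fun k => w k - h k * z k)) (measurable_affine_comp hf w h)
    (fun z hz => hreg.bound_kernel hh hhτ hz) (c := 0) (e := 0) ?_
  · simpa [kernelMean] using this
  · intro z hz
    have hconst : ∀ t ∈ tsupport K, kernelsJ K j j t *
        f (fun k => w k - h k * Function.update z j t k) =
        J K t * f (fun k => w k - h k * z k) := by
      intro t ht
      have hz' : ∀ k, Function.update z j t k ∈ tsupport K := by
        intro k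
        by_cases hk : k = j
        · subst hk; simpa using ht
        · simpa [Function.update_of_ne hk] using hz k
      rw [hreg.sparse _ (hK.mem_nbhd hτ hh hhτ hz') _ (hK.mem_nbhd hτ hh hhτ hz)]
      · simp [kernelsJ]
      · intro k hk
        have : k ≠ j := fun h => hj (h ▸ hk)
        simp [Function.update_of_ne this]
    rw [setIntegral_congr_fun hK.hasCompactSupport.measurableSet hconst, integral_mul_const,
      setIntegral_tsupport fun t ht => IsKernelOfOrder.J_eq_zero ht, hK.integral_J]
    simp

theorem prod_erase_integral_K (hK : IsKernelOfOrder K p) (j : ι) :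
    ∏ _k ∈ Finset.univ.erase j, ∫ t in tsupport K, K t = 1 := by
  rw [setIntegral_tsupport fun t ht => image_eq_zero_of_notMem_tsupport ht, hK.integral_eq_one]
  simp

/-- In a relevant coordinate, the mean of `h_j Z_{hj}` is, up to sign, a multiple of `h_j ^ p`, as
the moments of `J` of orders below `p` vanish. -/
theorem abs_kernelMean_kernelsJ_sub_le (hK : IsKernelOfOrder K p)
    (hreg : IsRegularNear K p f w R τ ρ B η) (hp : 1 ≤ p) (hf : Measurable f)
    {j : ι} (hj : j ∈ R) {h : ι → ℝ} (hh : ∀ k, 0 ≤ h k) (hhτ : ∀ k, h k ≤ τ) :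
    |kernelMean K (kernelsJ K j) f w h -
      partialD p j f w * (-h j) ^ p / (p.factorial : ℝ) * ∫ t, t ^ p * J K t| ≤
      η * h j ^ p / (p.factorial : ℝ) * (∫ t, |t ^ p * J K t|) *
        ∏ _k ∈ Finset.univ.erase j, ∫ t in tsupport K, |K t| := by
  have := abs_integral_prod_mul_sub_le hK.hasCompactSupport hK.volume_ne_zero j
    (G := kernelsJ K j) (kernelsJ_continuous hK j)
    (H := fun z => f (fun k => w k - h k * z k)) (measurable_affine_comp hf w h)
    (fun z hz => hreg.bound_kernel hh hhτ hz)
    (c := partialD p j f w * (-h j) ^ p / (p.factorial : ℝ) * ∫ t, t ^ p * J K t)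
    (e := η * h j ^ p / (p.factorial : ℝ) * ∫ t, |t ^ p * J K t|) ?_
  · have e1 : ∏ k ∈ Finset.univ.erase j, ∫ t in tsupport K, kernelsJ K j k t = 1 := by
      rw [← prod_erase_integral_K hK j]
      exact Finset.prod_congr rfl fun k hk => by
        simp [kernelsJ, Function.update_of_ne (Finset.ne_of_mem_erase hk)]
    have e2 : ∏ k ∈ Finset.univ.erase j, ∫ t in tsupport K, |kernelsJ K j k t| =
        ∏ _k ∈ Finset.univ.erase j, ∫ t in tsupport K, |K t| :=
      Finset.prod_congr rfl fun k hk => by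
        simp [kernelsJ, Function.update_of_ne (Finset.ne_of_mem_erase hk)]
    rw [e1, e2, mul_one] at this
    exact this
  · intro z hz
    have := hreg.abs_integral_coord_sub_le hp hf hj (G := J K) hK.continuous_J
      hK.hasCompactSupport_J (fun t ht => IsKernelOfOrder.J_eq_zero ht)
      (fun l h1 h2 => by rw [hK.integral_pow_mul_J, hK.moment_eq_zero l h1 h2, mul_zero])
      hh hhτ hz
    rw [hK.integral_J, mul_zero, zero_add] at this
    simpa [kernelsJ] using this

/-- The bias of the kernel estimator, with the coordinates of `A ⊆ R` smoothed out one at a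
time. -/
theorem abs_kernelMean_sub_le_of_subset (hK : IsKernelOfOrder K p)
    (hreg : IsRegularNear K p f w R τ ρ B η) (hp : 1 ≤ p) (hf : Measurable f)
    (A : Finset ι) (hA : A ⊆ R) {h : ι → ℝ} (hh : ∀ k, 0 ≤ h k) (hhτ : ∀ k, h k ≤ τ) :
    |kernelMean K (fun _ => K) f w (fun k => if k ∈ A then h k else 0) - f w| ≤
      ∑ j ∈ A, (|partialD p j f w| * h j ^ p / (p.factorial : ℝ) * |∫ t, t ^ p * K t| +
        η * h j ^ p / (p.factorial : ℝ) * (∫ t, |t ^ p * K t|) *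
          ∏ _k ∈ Finset.univ.erase j, ∫ t in tsupport K, |K t|) := by
  have hKint : ∫ t in tsupport K, K t = 1 := by
    rw [setIntegral_tsupport fun t ht => image_eq_zero_of_notMem_tsupport ht, hK.integral_eq_one]
  have hfin : IsFiniteMeasure ((volume : Measure ℝ).restrict (tsupport K)) :=
    ⟨by rw [Measure.restrict_apply_univ]; exact hK.hasCompactSupport.measure_lt_top⟩
  induction A using Finset.induction_on with
  | empty =>
    simp only [Finset.notMem_empty, if_false, zero_mul, sub_zero, Finset.sum_empty, kernelMean]
    rw [integral_mul_const, integral_fintype_prod_eq_prod (fun _ => K)]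
    simp [hKint]
  | insert j A hjA ih =>
    have hj : j ∈ R := hA (Finset.mem_insert_self j A)
    have ih := ih fun k hk => hA (Finset.mem_insert_of_mem hk)
    rw [Finset.sum_insert hjA]
    set h₁ : ι → ℝ := fun k => if k ∈ insert j A then h k else 0 with hh₁
    set h₀ : ι → ℝ := fun k => if k ∈ A then h k else 0 with hh₀
    have h1n : ∀ k, 0 ≤ h₁ k := fun k => by
      simp only [hh₁]; split_ifs <;> simp [hh k]
    have h1τ : ∀ k, h₁ k ≤ τ := fun k => by
      simp only [hh₁]; split_ifs
      exacts [hhτ k, (hh k).trans (hhτ k)]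
    have h0n : ∀ k, 0 ≤ h₀ k := fun k => by
      simp only [hh₀]; split_ifs <;> simp [hh k]
    have h0τ : ∀ k, h₀ k ≤ τ := fun k => by
      simp only [hh₀]; split_ifs
      exacts [hhτ k, (hh k).trans (hhτ k)]
    -- passing from `h₀` to `h₁` smooths out the `j`-th coordinate only
    have h01 : Function.update h₁ j 0 = h₀ := by
      funext k
      by_cases hk : k = j
      · subst hk; simp [hh₀, hjA]
      · simp [hh₁, hh₀, hk]
    have h1j : h₁ j = h j := by simp [hh₁]
    have h0j : h₀ j = 0 := by simp [hh₀, hjA]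
    have hstep := abs_integral_prod_mul_sub_le hK.hasCompactSupport hK.volume_ne_zero j
      (G := fun _ => K) (fun _ => hK.continuous)
      (H := fun z => f (fun k => w k - h₁ k * z k) - f (fun k => w k - h₀ k * z k))
      ((measurable_affine_comp hf w h₁).sub (measurable_affine_comp hf w h₀))
      (B := B + B)
      (fun z hz => (abs_sub _ _).trans
        (add_le_add (hreg.bound_kernel h1n h1τ hz) (hreg.bound_kernel h0n h0τ hz)))
      (c := partialD p j f w * (-h j) ^ p / (p.factorial : ℝ) * ∫ t, t ^ p * K t)
      (e := η * h j ^ p / (p.factorial : ℝ) * ∫ t, |t ^ p * K t|) ?_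
    · rw [prod_erase_integral_K hK j, mul_one] at hstep
      have i1 := integrable_prod_mul hK.hasCompactSupport (G := fun _ : ι => K)
        (fun _ => hK.continuous)
        (measurable_affine_comp hf w h₁) (fun z hz => hreg.bound_kernel h1n h1τ hz)
      have i0 := integrable_prod_mul hK.hasCompactSupport (G := fun _ : ι => K)
        (fun _ => hK.continuous)
        (measurable_affine_comp hf w h₀) (fun z hz => hreg.bound_kernel h0n h0τ hz)
      simp_rw [mul_sub] at hstep
      rw [integral_sub i1 i0] at hstep
      change |kernelMean K (fun _ => K) f w h₁ - kernelMean K (fun _ => K) f w h₀ - _| ≤ _ at hstep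
      have habs : |partialD p j f w * (-h j) ^ p / (p.factorial : ℝ) * ∫ t, t ^ p * K t| =
          |partialD p j f w| * h j ^ p / (p.factorial : ℝ) * |∫ t, t ^ p * K t| := by
        rw [abs_mul, abs_div, abs_mul, abs_pow, abs_neg, abs_of_nonneg (hh j), Nat.abs_cast]
      rw [← habs]
      have hh1 := abs_le.1 hstep
      have hh2 := abs_le.1 ih
      have hh3 := abs_le.1 (le_refl
        |partialD p j f w * (-h j) ^ p / (p.factorial : ℝ) * ∫ t, t ^ p * K t|)
      rw [abs_le]
      constructor <;> linarith
    · intro z hz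
      have hmain := hreg.abs_integral_coord_sub_le hp hf hj (G := K) hK.continuous
        hK.hasCompactSupport (fun t ht => image_eq_zero_of_notMem_tsupport ht)
        hK.moment_eq_zero h1n h1τ hz
      rw [hK.integral_eq_one, mul_one, h01, h1j] at hmain
      have hc : ∀ t, f (fun k => w k - h₀ k * Function.update z j t k) =
          f (fun k => w k - h₀ k * z k) := by
        intro t
        congr 1; funext k
        by_cases hk : k = j
        · subst hk; simp [h0j]
        · simp [Function.update_of_ne hk]
      have i1 : Integrable (fun t => K t * f (fun k => w k - h₁ k * Function.update z j t k))
          (volume.restrict (tsupport K)) := by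
        refine Integrable.mul_bdd (c := B)
          (hK.continuous.continuousOn.integrableOn_compact hK.hasCompactSupport)
          (((measurable_affine_comp hf w h₁).comp
            (measurable_update z)).aestronglyMeasurable) ?_
        filter_upwards [ae_restrict_mem hK.hasCompactSupport.measurableSet] with t ht
        refine hreg.bound_kernel h1n h1τ fun k => ?_
        by_cases hk : k = j
        · subst hk; simpa using ht
        · simpa [Function.update_of_ne hk] using hz k
      have i0 : Integrable (fun t => K t * f (fun k => w k - h₀ k * z k))
          (volume.restrict (tsupport K)) :=
        Integrable.mul_const
          (hK.continuous.continuousOn.integrableOn_compact hK.hasCompactSupport) _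
      simp_rw [hc, mul_sub]
      rw [integral_sub i1 i0, integral_mul_const, hKint, one_mul]
      rwa [sub_sub]

/-- The bias of the kernel estimator. Irrelevant coordinates do not contribute: since `f` does not
depend on them near `w`, their bandwidths may be replaced by `0`. -/
theorem abs_kernelMean_sub_le (hK : IsKernelOfOrder K p)
    (hreg : IsRegularNear K p f w R τ ρ B η) (hp : 1 ≤ p) (hτ : 0 < τ) (hf : Measurable f)
    {h : ι → ℝ} (hh : ∀ k, 0 ≤ h k) (hhτ : ∀ k, h k ≤ τ) :
    |kernelMean K (fun _ => K) f w h - f w| ≤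
      ∑ j ∈ R, (|partialD p j f w| * h j ^ p / (p.factorial : ℝ) * |∫ t, t ^ p * K t| +
        η * h j ^ p / (p.factorial : ℝ) * (∫ t, |t ^ p * K t|) *
          ∏ _k ∈ Finset.univ.erase j, ∫ t in tsupport K, |K t|) := by
  have heq : kernelMean K (fun _ => K) f w h =
      kernelMean K (fun _ => K) f w (fun k => if k ∈ R then h k else 0) := by
    unfold kernelMean
    refine integral_congr_ae ?_
    filter_upwards [ae_mem_pi_restrict (ι := ι) hK.hasCompactSupport.measurableSet] with z hz
    congr 1
    refine hreg.sparse _ (hK.mem_nbhd hτ hh hhτ hz) _ (hK.mem_nbhd hτ (fun k => ?_)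
      (fun k => ?_) hz) fun j hj => by simp [hj]
    · split_ifs <;> simp [hh k]
    · split_ifs
      exacts [hhτ k, (hh k).trans (hhτ k)]
  rw [heq]
  exact abs_kernelMean_sub_le_of_subset hK hreg hp hf R subset_rfl hh hhτ

end Bias

/-! ### The law of the sample and means of weighted kernels -/

section Law

variable {Ω : Type*} [MeasurableSpace Ω] {d₁ d₂ : ℕ}

theorem measurable_fstPart : Measurable (fstPart (d₁ := d₁) (d₂ := d₂)) :=
  measurable_pi_lambda _ fun k => measurable_pi_apply (Sum.inl k)

theorem measurable_sndPart : Measurable (sndPart (d₁ := d₁) (d₂ := d₂)) :=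
  measurable_pi_lambda _ fun k => measurable_pi_apply (Sum.inr k)

theorem sumElim_fstPart_sndPart (u : Fin d₁ ⊕ Fin d₂ → ℝ) :
    Sum.elim (fstPart u) (sndPart u) = u := by
  funext k; cases k <;> rfl

theorem measurable_sumElim :
    Measurable fun q : (Fin d₁ → ℝ) × (Fin d₂ → ℝ) => Sum.elim q.1 q.2 := by
  refine measurable_pi_lambda _ fun k => ?_
  cases k with
  | inl k => exact (measurable_pi_apply k).comp measurable_fst
  | inr k => exact (measurable_pi_apply k).comp measurable_snd

theorem HasCondDensity.lintegral_comp {μ : Measure Ω} [IsProbabilityMeasure μ]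
    {W : Ω → Fin d₁ ⊕ Fin d₂ → ℝ} {fX : (Fin d₁ → ℝ) → ℝ} {f : (Fin d₁ ⊕ Fin d₂ → ℝ) → ℝ}
    (hdens : HasCondDensity μ W fX f) (hW : Measurable W) (hfX : Measurable fX)
    (hf : Measurable f) {F : (Fin d₁ ⊕ Fin d₂ → ℝ) → ENNReal} (hF : Measurable F) :
    ∫⁻ ω, F (W ω) ∂μ =
      ∫⁻ u, ENNReal.ofReal (fX (fstPart u)) * (ENNReal.ofReal (f u) * F u) := by
  have hX : Measurable fun ω => fstPart (W ω) := measurable_fstPart.comp hW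
  have hY : Measurable fun ω => sndPart (W ω) := measurable_sndPart.comp hW
  have hF' : Measurable fun q : (Fin d₁ → ℝ) × (Fin d₂ → ℝ) => F (Sum.elim q.1 q.2) :=
    hF.comp measurable_sumElim
  have hf' : Measurable fun q : (Fin d₁ → ℝ) × (Fin d₂ → ℝ) =>
      ENNReal.ofReal (f (Sum.elim q.1 q.2)) := (hf.comp measurable_sumElim).ennreal_ofReal
  have h1 : ∫⁻ ω, F (W ω) ∂μ = ∫⁻ q, F (Sum.elim q.1 q.2)
      ∂(μ.map fun ω => (fstPart (W ω), sndPart (W ω))) := by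
    rw [lintegral_map hF' (hX.prodMk hY)]
    simp only [sumElim_fstPart_sndPart]
  rw [h1, ← compProd_map_condDistrib hY.aemeasurable, Measure.lintegral_compProd hF']
  have h2 : ∫⁻ x, ∫⁻ y, F (Sum.elim x y) ∂(condDistrib (fun ω => sndPart (W ω))
      (fun ω => fstPart (W ω)) μ x) ∂(μ.map fun ω => fstPart (W ω)) =
      ∫⁻ x, (∫⁻ y, ENNReal.ofReal (f (Sum.elim x y)) * F (Sum.elim x y))
        ∂(μ.map fun ω => fstPart (W ω)) := by
    refine lintegral_congr_ae ?_
    filter_upwards [hdens.cond] with x hx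
    have m1 : Measurable fun y => ENNReal.ofReal (f (Sum.elim x y)) :=
      hf'.comp measurable_prodMk_left
    have m2 : Measurable fun y => F (Sum.elim x y) := hF'.comp measurable_prodMk_left
    rw [hx, lintegral_withDensity_eq_lintegral_mul _ m1 m2]
    rfl
  have hin : Measurable fun x => ∫⁻ y, ENNReal.ofReal (f (Sum.elim x y)) * F (Sum.elim x y) :=
    (hf'.mul hF').lintegral_prod_right'
  rw [h2, hdens.map_fst, lintegral_withDensity_eq_lintegral_mul _ hfX.ennreal_ofReal hin]
  have h3 := (volume_measurePreserving_sumPiEquivProdPi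
    (fun _ : Fin d₁ ⊕ Fin d₂ => ℝ)).lintegral_comp_emb (MeasurableEquiv.measurableEmbedding _)
    (fun q => ENNReal.ofReal (fX q.1) * (ENNReal.ofReal (f (Sum.elim q.1 q.2)) *
      F (Sum.elim q.1 q.2)))
  have h4 : ∀ u : Fin d₁ ⊕ Fin d₂ → ℝ,
      MeasurableEquiv.sumPiEquivProdPi (fun _ : Fin d₁ ⊕ Fin d₂ => ℝ) u =
        (fstPart u, sndPart u) := fun u => rfl
  simp only [h4, sumElim_fstPart_sndPart] at h3
  rw [h3]
  have h5 : (volume : Measure ((Fin d₁ → ℝ) × (Fin d₂ → ℝ))) =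
    (volume : Measure (Fin d₁ → ℝ)).prod (volume : Measure (Fin d₂ → ℝ)) := rfl
  have h6 : Measurable fun q : (Fin d₁ → ℝ) × (Fin d₂ → ℝ) => ENNReal.ofReal (fX q.1) *
      (ENNReal.ofReal (f (Sum.elim q.1 q.2)) * F (Sum.elim q.1 q.2)) :=
    (hfX.comp measurable_fst).ennreal_ofReal.mul (hf'.mul hF')
  rw [h5, lintegral_prod _ h6.aemeasurable]
  refine lintegral_congr fun x => ?_
  have h7 : Measurable fun y => ENNReal.ofReal (f (Sum.elim x y)) * F (Sum.elim x y) :=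
    (hf'.mul hF').comp measurable_prodMk_left
  exact (lintegral_const_mul _ h7).symm

theorem HasCondDensity.map_eq {μ : Measure Ω} [IsProbabilityMeasure μ]
    {W : Ω → Fin d₁ ⊕ Fin d₂ → ℝ} {fX : (Fin d₁ → ℝ) → ℝ} {f : (Fin d₁ ⊕ Fin d₂ → ℝ) → ℝ}
    (hdens : HasCondDensity μ W fX f) (hW : Measurable W) (hfX : Measurable fX)
    (hfX0 : ∀ u, 0 ≤ fX u) (hf : Measurable f) :
    μ.map W = volume.withDensity fun u => ENNReal.ofReal (fX (fstPart u) * f u) := by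
  ext s hs
  rw [← lintegral_indicator_one hs, lintegral_map (measurable_one.indicator hs) hW,
    hdens.lintegral_comp hW hfX hf (measurable_one.indicator hs), withDensity_apply _ hs,
    ← lintegral_indicator hs]
  refine lintegral_congr fun u => ?_
  by_cases hu : u ∈ s
  · simp [hu, ENNReal.ofReal_mul (hfX0 _)]
  · simp [hu]

theorem HasCondDensity.integral_comp {μ : Measure Ω} [IsProbabilityMeasure μ]
    {W : Ω → Fin d₁ ⊕ Fin d₂ → ℝ} {fX : (Fin d₁ → ℝ) → ℝ} {f : (Fin d₁ ⊕ Fin d₂ → ℝ) → ℝ}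
    (hdens : HasCondDensity μ W fX f) (hW : Measurable W) (hfX : Measurable fX)
    (hfX0 : ∀ u, 0 ≤ fX u) (hf : Measurable f) (hf0 : ∀ u, 0 ≤ f u)
    {F : (Fin d₁ ⊕ Fin d₂ → ℝ) → ℝ} (hF : Measurable F) :
    ∫ ω, F (W ω) ∂μ = ∫ u, fX (fstPart u) * f u * F u := by
  have hm : Measurable fun u : Fin d₁ ⊕ Fin d₂ → ℝ => fX (fstPart u) * f u :=
    (hfX.comp measurable_fstPart).mul hf
  rw [← integral_map hW.aemeasurable hF.aestronglyMeasurable, hdens.map_eq hW hfX hfX0 hf,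
    integral_withDensity_eq_integral_toReal_smul hm.ennreal_ofReal (by simp)]
  refine integral_congr_ae (Eventually.of_forall fun u => ?_)
  simp only [smul_eq_mul]
  rw [ENNReal.toReal_ofReal (mul_nonneg (hfX0 _) (hf0 _))]

end Law

/-- The weight `∏ₖ hₖ⁻¹ Gₖ((wₖ - uₖ) / hₖ)` of a product-kernel estimator at the point `u`. -/
noncomputable def kernelWeight {ι : Type*} [Fintype ι] (G : ι → ℝ → ℝ) (w h u : ι → ℝ) : ℝ :=
  ∏ k, (h k)⁻¹ * G k ((w k - u k) / h k)

theorem measurable_kernelWeight {ι : Type*} [Fintype ι] {G : ι → ℝ → ℝ}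
    (hG : ∀ k, Measurable (G k)) (w h : ι → ℝ) : Measurable (kernelWeight G w h) := by
  unfold kernelWeight
  refine Finset.measurable_fun_prod _ fun k _ => ?_
  have := hG k
  fun_prop

theorem abs_kernelWeight {ι : Type*} [Fintype ι] (G : ι → ℝ → ℝ) (w : ι → ℝ) {h : ι → ℝ}
    (hh : ∀ k, 0 < h k) (u : ι → ℝ) :
    |kernelWeight G w h u| = kernelWeight (fun k t => |G k t|) w h u := by
  unfold kernelWeight
  rw [Finset.abs_prod]
  refine Finset.prod_congr rfl fun k _ => ?_
  rw [abs_mul, abs_of_pos (inv_pos.2 (hh k))]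

theorem abs_kernelWeight_le {ι : Type*} [Fintype ι] {G : ι → ℝ → ℝ} {c : ℝ}
    (hG : ∀ k t, |G k t| ≤ c) (w : ι → ℝ) {h : ι → ℝ} (hh : ∀ k, 0 < h k) (u : ι → ℝ) :
    |kernelWeight G w h u| ≤ c ^ Fintype.card ι / ∏ k, h k := by
  unfold kernelWeight
  rw [Finset.prod_mul_distrib, abs_mul, Finset.abs_prod, Finset.abs_prod, div_eq_inv_mul,
    ← Finset.prod_inv_distrib]
  have h1 : ∏ k, |(h k)⁻¹| = ∏ k, (h k)⁻¹ :=
    Finset.prod_congr rfl fun k _ => abs_of_pos (inv_pos.2 (hh k))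
  rw [h1]
  refine mul_le_mul_of_nonneg_left ?_ (Finset.prod_nonneg fun k _ => (inv_pos.2 (hh k)).le)
  calc ∏ k, |G k ((w k - u k) / h k)| ≤ ∏ _k : ι, c :=
        Finset.prod_le_prod (fun _ _ => abs_nonneg _) fun k _ => hG k _
    _ = _ := by simp

theorem mem_nbhd_of_kernelWeight_ne_zero {ι : Type*} [Fintype ι] {K : ℝ → ℝ} {p : ℕ}
    (hK : IsKernelOfOrder K p) {G : ι → ℝ → ℝ} (hG : ∀ k, ∀ t ∉ tsupport K, G k t = 0)
    {τ : ℝ} (hτ : 0 < τ) {w h u : ι → ℝ} (hh : ∀ k, 0 < h k) (hhτ : ∀ k, h k ≤ τ)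
    (hu : kernelWeight G w h u ≠ 0) : u ∈ nbhd K (fun _ => τ) w := by
  have hz : ∀ k, (w k - u k) / h k ∈ tsupport K := by
    intro k
    by_contra hc
    refine hu (Finset.prod_eq_zero (Finset.mem_univ k) ?_)
    rw [hG k _ hc, mul_zero]
  have := hK.mem_nbhd (w := w) hτ (fun k => (hh k).le) hhτ hz
  convert this using 1
  funext k
  have := (hh k).ne'
  field_simp
  ring

theorem fstPart_mem_nbhd {d₁ d₂ : ℕ} {K : ℝ → ℝ} {τ : ℝ} {w u : Fin d₁ ⊕ Fin d₂ → ℝ}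
    (hu : u ∈ nbhd K (fun _ => τ) w) : fstPart u ∈ nbhd K (fun _ => τ) (fstPart w) := by
  obtain ⟨z, hz, h⟩ := hu
  exact ⟨fun k => z (Sum.inl k), fun k => hz _, fun k => h _⟩

theorem integral_comp_diagonal {ι : Type*} [Fintype ι] [DecidableEq ι] {h : ι → ℝ}
    (hh : ∀ k, 0 < h k) {F : (ι → ℝ) → ℝ} (hF : Measurable F) :
    ∫ u, F u = (∏ k, h k) * ∫ z : ι → ℝ, F fun k => h k * z k := by
  have hpos : 0 < ∏ k, h k := Finset.prod_pos fun k _ => hh k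
  have hdet : (Matrix.diagonal h).det ≠ 0 := by rw [Matrix.det_diagonal]; exact hpos.ne'
  have hvol := Real.smul_map_diagonal_volume_pi hdet
  rw [Matrix.det_diagonal, abs_of_pos hpos] at hvol
  have happ : ∀ z, Matrix.toLin' (Matrix.diagonal h) z = fun k => h k * z k := by
    intro z; funext k
    simp [Matrix.mulVec_diagonal]
  have hmeas : Measurable (Matrix.toLin' (Matrix.diagonal h)) :=
    (LinearMap.continuous_of_finiteDimensional _).measurable
  conv_lhs => rw [← hvol]
  rw [integral_smul_measure, integral_map hmeas.aemeasurable hF.aestronglyMeasurable,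
    ENNReal.toReal_ofReal hpos.le, smul_eq_mul]
  simp_rw [happ]

/-- Change of variables `u = w - h z` in the mean of a kernel weight. -/
theorem integral_kernelWeight_mul {ι : Type*} [Fintype ι] [DecidableEq ι] {K : ℝ → ℝ}
    {G : ι → ℝ → ℝ} (hG : ∀ k, Measurable (G k)) (hGK : ∀ k, ∀ t ∉ tsupport K, G k t = 0)
    {f : (ι → ℝ) → ℝ} (hf : Measurable f) (w : ι → ℝ) {h : ι → ℝ} (hh : ∀ k, 0 < h k) :
    ∫ u, kernelWeight G w h u * f u = kernelMean K G f w h := by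
  have hpos : 0 < ∏ k, h k := Finset.prod_pos fun k _ => hh k
  have hF : Measurable fun u => kernelWeight G w h u * f u :=
    (measurable_kernelWeight hG w h).mul hf
  rw [← integral_sub_left_eq_self _ volume w, integral_comp_diagonal hh
    (F := fun u => kernelWeight G w h (w - u) * f (w - u))
    (hF.comp (measurable_const.sub measurable_id)),
    ← integral_const_mul]
  unfold kernelMean
  rw [← Measure.restrict_pi_pi, setIntegral_eq_integral_of_forall_compl_eq_zero]
  · refine integral_congr_ae (Eventually.of_forall fun z => ?_)
    have e1 : kernelWeight G w h (w - fun k => h k * z k) =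
        (∏ k, h k)⁻¹ * ∏ k, G k (z k) := by
      unfold kernelWeight
      rw [← Finset.prod_inv_distrib, ← Finset.prod_mul_distrib]
      refine Finset.prod_congr rfl fun k _ => ?_
      have := (hh k).ne'
      simp [mul_div_cancel_left₀, this]
    have e2 : (w - fun k => h k * z k) = fun k => w k - h k * z k := rfl
    beta_reduce
    rw [e1, e2]
    field_simp
  · intro z hz
    obtain ⟨k, hk⟩ : ∃ k, z k ∉ tsupport K := by
      by_contra! hc
      exact hz fun k _ => hc k
    rw [Finset.prod_eq_zero (Finset.mem_univ k) (hGK k _ hk), zero_mul]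

/-- Weighting by `1 / f_X` turns the expectation of a kernel weight into a smoothed value of the
conditional density. -/
theorem HasCondDensity.integral_weight {Ω : Type*} [MeasurableSpace Ω] {d₁ d₂ : ℕ}
    {μ : Measure Ω} [IsProbabilityMeasure μ]
    {W : Ω → Fin d₁ ⊕ Fin d₂ → ℝ} {fX : (Fin d₁ → ℝ) → ℝ} {f : (Fin d₁ ⊕ Fin d₂ → ℝ) → ℝ}
    (hdens : HasCondDensity μ W fX f) (hW : Measurable W) (hfX : Measurable fX)
    (hfX0 : ∀ u, 0 ≤ fX u) (hf : Measurable f) (hf0 : ∀ u, 0 ≤ f u)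
    {K : ℝ → ℝ} {p : ℕ} (hK : IsKernelOfOrder K p)
    {G : Fin d₁ ⊕ Fin d₂ → ℝ → ℝ} (hG : ∀ k, Measurable (G k))
    (hGK : ∀ k, ∀ t ∉ tsupport K, G k t = 0) {w h : Fin d₁ ⊕ Fin d₂ → ℝ} {τ : ℝ} (hτ : 0 < τ)
    (hpos : ∀ x ∈ nbhd K (fun _ => τ) (fstPart w), 0 < fX x)
    (hh : ∀ k, 0 < h k) (hhτ : ∀ k, h k ≤ τ) :
    ∫ ω, 1 / fX (fstPart (W ω)) * kernelWeight G w h (W ω) ∂μ = kernelMean K G f w h := by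
  rw [← integral_kernelWeight_mul hG hGK hf w hh,
    hdens.integral_comp hW hfX hfX0 hf hf0 (F := fun u => 1 / fX (fstPart u) * kernelWeight G w h u)
      ((measurable_const.div (hfX.comp measurable_fstPart)).mul (measurable_kernelWeight hG w h))]
  refine integral_congr_ae (Eventually.of_forall fun u => ?_)
  by_cases hu : kernelWeight G w h u = 0
  · simp [hu]
  · have := (hpos _ (fstPart_mem_nbhd
      (mem_nbhd_of_kernelWeight_ne_zero hK hGK hτ hh hhτ hu))).ne'
    simp only
    field_simp

/-- If `f` vanishes near `w`, no observation falls near `w`. -/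
theorem HasCondDensity.ae_notMem {Ω : Type*} [MeasurableSpace Ω] {d₁ d₂ : ℕ}
    {μ : Measure Ω} [IsProbabilityMeasure μ]
    {W : Ω → Fin d₁ ⊕ Fin d₂ → ℝ} {fX : (Fin d₁ → ℝ) → ℝ} {f : (Fin d₁ ⊕ Fin d₂ → ℝ) → ℝ}
    (hdens : HasCondDensity μ W fX f) (hW : Measurable W) (hfX : Measurable fX)
    (hfX0 : ∀ u, 0 ≤ fX u) (hf : Measurable f) {U : Set (Fin d₁ ⊕ Fin d₂ → ℝ)}
    (hU : ∀ u ∈ U, f u = 0) : ∀ᵐ ω ∂μ, W ω ∉ U := by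
  have hs : MeasurableSet (f ⁻¹' {0}) := hf (measurableSet_singleton 0)
  have h0 : μ.map W (f ⁻¹' {0}) = 0 := by
    rw [hdens.map_eq hW hfX hfX0 hf, withDensity_apply _ hs,
      setLIntegral_congr_fun (g := fun _ => 0) hs]
    · simp
    · intro u hu
      have hu' : f u = 0 := hu
      simp [hu']
  rw [Measure.map_apply hW hs] at h0
  have : ∀ᵐ ω ∂μ, ω ∉ W ⁻¹' (f ⁻¹' {0}) := measure_eq_zero_iff_ae_notMem.1 h0
  filter_upwards [this] with ω hω hc using hω (hU _ hc)

/-! ### Concentration of weighted kernel estimators -/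

/-- The estimator with the kernel `G k` in the `k`-th coordinate. -/
noncomputable def kernelEstWith {d₁ d₂ : ℕ} (G : Fin d₁ ⊕ Fin d₂ → ℝ → ℝ) (n : ℕ)
    (g : (Fin d₁ → ℝ) → ℝ) (W : ℕ → Fin d₁ ⊕ Fin d₂ → ℝ) (w h : Fin d₁ ⊕ Fin d₂ → ℝ) : ℝ :=
  1 / (n : ℝ) * ∑ i ∈ Finset.range n, 1 / g (fstPart (W i)) * kernelWeight G w h (W i)

theorem kernelEst_eq {d₁ d₂ : ℕ} (K : ℝ → ℝ) (n : ℕ) (g : (Fin d₁ → ℝ) → ℝ)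
    (W : ℕ → Fin d₁ ⊕ Fin d₂ → ℝ) (w h : Fin d₁ ⊕ Fin d₂ → ℝ) :
    kernelEst K n g W w h = kernelEstWith (fun _ => K) n g W w h := rfl

theorem statZ_eq {d₁ d₂ : ℕ} (K : ℝ → ℝ) (n : ℕ) (g : (Fin d₁ → ℝ) → ℝ)
    (W : ℕ → Fin d₁ ⊕ Fin d₂ → ℝ) (w h : Fin d₁ ⊕ Fin d₂ → ℝ) (j : Fin d₁ ⊕ Fin d₂)
    (hj : h j ≠ 0) :
    statZ K n g W w h j = -(1 / h j) * kernelEstWith (kernelsJ K j) n g W w h := by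
  unfold statZ kernelEstWith
  rw [Finset.mul_sum, ← mul_assoc, Finset.mul_sum]
  refine Finset.sum_congr rfl fun i _ => ?_
  have : kernelWeight (kernelsJ K j) w h (W i) = (h j)⁻¹ * J K ((w j - W i j) / h j) *
      ∏ k ∈ Finset.univ.erase j, (h k)⁻¹ * K ((w k - W i k) / h k) := by
    unfold kernelWeight
    rw [← Finset.mul_prod_erase Finset.univ _ (Finset.mem_univ j)]
    congr 1
    · simp [kernelsJ]
    · exact Finset.prod_congr rfl fun k hk => by
        simp [kernelsJ, Function.update_of_ne (Finset.ne_of_mem_erase hk)]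
  rw [this, show (-1 : ℝ) / (n * h j ^ 2) = -(1 / h j) * (1 / (n : ℝ)) * (h j)⁻¹ by
    rcases eq_or_ne (n : ℝ) 0 with h0 | h0
    · simp [h0]
    · field_simp]
  ring

/-- A Bernstein-type bound, from `exp x ≤ 1 + x + x ^ 2` for `|x| ≤ 1`. -/
theorem measure_sum_ge_le {Ω : Type*} [MeasurableSpace Ω] {μ : Measure Ω} [IsProbabilityMeasure μ]
    {ξ : ℕ → Ω → ℝ} (hind : iIndepFun ξ μ) (hmeas : ∀ i, Measurable (ξ i)) {b m v s : ℝ}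
    (hb : ∀ i ω, |ξ i ω| ≤ b) (hm : ∀ i, ∫ ω, ξ i ω ∂μ = m) (hv : ∀ i, ∫ ω, ξ i ω ^ 2 ∂μ ≤ v)
    (hs : 0 ≤ s) (hsb : s * b ≤ 1) (n : ℕ) (t : ℝ) :
    μ.real {ω | n * m + t ≤ ∑ i ∈ Finset.range n, ξ i ω} ≤
      Real.exp (-(s * t) + n * (s ^ 2 * v)) := by
  have hint : ∀ i, Integrable (ξ i) μ := fun i =>
    Integrable.of_bound (hmeas i).aestronglyMeasurable b (Eventually.of_forall (hb i))
  have hint2 : ∀ i, Integrable (fun ω => ξ i ω ^ 2) μ := fun i =>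
    Integrable.of_bound ((hmeas i).pow_const 2).aestronglyMeasurable (b ^ 2)
      (Eventually.of_forall fun ω => by
        rw [Real.norm_eq_abs, abs_pow]
        exact pow_le_pow_left₀ (abs_nonneg _) (hb i ω) 2)
  have hexp : ∀ i ω, Real.exp (s * ξ i ω) ≤ 1 + s * ξ i ω + s ^ 2 * ξ i ω ^ 2 := by
    intro i ω
    have h1 : |s * ξ i ω| ≤ 1 := by
      rw [abs_mul, abs_of_nonneg hs]
      exact (mul_le_mul_of_nonneg_left (hb i ω) hs).trans hsb
    have := (abs_le.1 (Real.abs_exp_sub_one_sub_id_le h1)).2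
    nlinarith
  have hmgf : ∀ i, mgf (ξ i) μ s ≤ Real.exp (s * m + s ^ 2 * v) := by
    intro i
    have hi : Integrable (fun ω => 1 + s * ξ i ω + s ^ 2 * ξ i ω ^ 2) μ :=
      ((integrable_const _).add ((hint i).const_mul s)).add ((hint2 i).const_mul (s ^ 2))
    have h1 : mgf (ξ i) μ s ≤ ∫ ω, 1 + s * ξ i ω + s ^ 2 * ξ i ω ^ 2 ∂μ :=
      integral_mono_of_nonneg (Eventually.of_forall fun _ => (Real.exp_pos _).le) hi
        (Eventually.of_forall (hexp i))
    have e := integral_add ((integrable_const (1 : ℝ)).add ((hint i).const_mul s))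
      ((hint2 i).const_mul (s ^ 2))
    simp only [Pi.add_apply] at e
    rw [e, integral_add (integrable_const _) ((hint i).const_mul s),
      integral_const_mul, integral_const_mul, hm i] at h1
    simp only [integral_const, probReal_univ, smul_eq_mul, mul_one] at h1
    have h2 := mul_le_mul_of_nonneg_left (hv i) (sq_nonneg s)
    have h3 := Real.add_one_le_exp (s * m + s ^ 2 * v)
    linarith
  have hchern := measure_ge_le_exp_mul_mgf (μ := μ) (X := ∑ i ∈ Finset.range n, ξ i)
    (n * m + t) hs (by
      refine Integrable.of_bound (C := Real.exp (s * (n * b))) ?_ ?_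
      · simp only [Finset.sum_apply]
        exact ((Finset.measurable_fun_sum _ fun i _ =>
          hmeas i).const_mul s).exp.aestronglyMeasurable
      · refine Eventually.of_forall fun ω => ?_
        rw [Real.norm_eq_abs, abs_of_pos (Real.exp_pos _), Real.exp_le_exp, Finset.sum_apply]
        refine mul_le_mul_of_nonneg_left ?_ hs
        calc ∑ i ∈ Finset.range n, ξ i ω ≤ ∑ _i ∈ Finset.range n, b :=
              Finset.sum_le_sum fun i _ => (le_abs_self _).trans (hb i ω)
          _ = n * b := by simp)
  simp only [Finset.sum_apply] at hchern
  refine hchern.trans ?_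
  rw [hind.mgf_sum hmeas]
  calc Real.exp (-s * (n * m + t)) * ∏ i ∈ Finset.range n, mgf (ξ i) μ s
      ≤ Real.exp (-s * (n * m + t)) * ∏ _i ∈ Finset.range n, Real.exp (s * m + s ^ 2 * v) := by
        gcongr with i _
        · exact fun _ _ => mgf_nonneg
        · exact hmgf i
    _ = _ := by
        rw [Finset.prod_const, Finset.card_range, ← Real.exp_nat_mul, ← Real.exp_add]
        congr 1; ring

theorem measure_abs_mean_sub_ge_le {Ω : Type*} [MeasurableSpace Ω] {μ : Measure Ω}
    [IsProbabilityMeasure μ] {ξ : ℕ → Ω → ℝ} (hind : iIndepFun ξ μ)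
    (hmeas : ∀ i, Measurable (ξ i)) {b m v s : ℝ}
    (hb : ∀ i ω, |ξ i ω| ≤ b) (hm : ∀ i, ∫ ω, ξ i ω ∂μ = m) (hv : ∀ i, ∫ ω, ξ i ω ^ 2 ∂μ ≤ v)
    (hs : 0 ≤ s) (hsb : s * b ≤ 1) {n : ℕ} (hn : 0 < n) (t : ℝ) :
    μ {ω | t ≤ |1 / (n : ℝ) * ∑ i ∈ Finset.range n, ξ i ω - m|} ≤
      ENNReal.ofReal (2 * Real.exp (-(s * (n * t)) + n * (s ^ 2 * v))) := by
  have hn' : (0 : ℝ) < n := by exact_mod_cast hn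
  have h1 := measure_sum_ge_le hind hmeas hb hm hv hs hsb n (n * t)
  have hind' : iIndepFun (fun i ω => -ξ i ω) μ :=
    hind.comp (fun _ x => -x) fun _ => measurable_neg
  have h2 := measure_sum_ge_le hind' (fun i => (hmeas i).neg) (b := b) (m := -m) (v := v)
    (fun i ω => by rw [abs_neg]; exact hb i ω) (fun i => by rw [integral_neg, hm i])
    (fun i => by simpa using hv i) hs hsb n (n * t)
  have hsub : {ω | t ≤ |1 / (n : ℝ) * ∑ i ∈ Finset.range n, ξ i ω - m|} ⊆
      {ω | n * m + n * t ≤ ∑ i ∈ Finset.range n, ξ i ω} ∪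
      {ω | n * -m + n * t ≤ ∑ i ∈ Finset.range n, -ξ i ω} := by
    intro ω hω
    have hω' : t ≤ |1 / (n : ℝ) * ∑ i ∈ Finset.range n, ξ i ω - m| := hω
    rcases le_abs.1 hω' with h | h
    · left
      have := mul_le_mul_of_nonneg_left h hn'.le
      rw [mul_sub, ← mul_assoc, mul_one_div_cancel hn'.ne', one_mul] at this
      rw [Set.mem_ofPred_eq]
      linarith
    · right
      have := mul_le_mul_of_nonneg_left h hn'.le
      rw [mul_neg, mul_sub, ← mul_assoc, mul_one_div_cancel hn'.ne', one_mul] at this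
      rw [Set.mem_ofPred_eq]
      rw [Finset.sum_neg_distrib]
      linarith
  refine (measure_mono hsub).trans ((measure_union_le _ _).trans ?_)
  rw [two_mul, ENNReal.ofReal_add (Real.exp_pos _).le (Real.exp_pos _).le]
  refine add_le_add ?_ ?_
  · rw [← ofReal_measureReal]; exact ENNReal.ofReal_le_ofReal h1
  · rw [← ofReal_measureReal]; exact ENNReal.ofReal_le_ofReal h2

/-- The mass of the box on which product kernels live. -/
noncomputable def boxVolume (ι : Type*) [Fintype ι] (K : ℝ → ℝ) : ℝ :=
  (Measure.pi fun _ : ι => (volume : Measure ℝ).restrict (tsupport K)).real Set.univ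

theorem abs_kernelMean_le {ι : Type*} [Fintype ι] [DecidableEq ι] {K : ℝ → ℝ} {p : ℕ}
    (hK : IsKernelOfOrder K p) {f : (ι → ℝ) → ℝ} {w : ι → ℝ} {R : Finset ι} {τ ρ B η : ℝ}
    (hreg : IsRegularNear K p f w R τ ρ B η) {G : ι → ℝ → ℝ} {c : ℝ} (hG : ∀ k t, |G k t| ≤ c)
    {h : ι → ℝ} (hh : ∀ k, 0 ≤ h k) (hhτ : ∀ k, h k ≤ τ) :
    |kernelMean K G f w h| ≤ c ^ Fintype.card ι * B * boxVolume ι K := by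
  have hfin : IsFiniteMeasure ((volume : Measure ℝ).restrict (tsupport K)) :=
    ⟨by rw [Measure.restrict_apply_univ]; exact hK.hasCompactSupport.measure_lt_top⟩
  unfold kernelMean boxVolume
  rw [← Real.norm_eq_abs]
  refine norm_integral_le_of_norm_le_const ?_
  filter_upwards [ae_mem_pi_restrict (ι := ι) hK.hasCompactSupport.measurableSet] with z hz
  rw [Real.norm_eq_abs, abs_mul, Finset.abs_prod]
  have h1 : ∏ k, |G k (z k)| ≤ c ^ Fintype.card ι := by
    calc ∏ k, |G k (z k)| ≤ ∏ _k : ι, c :=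
          Finset.prod_le_prod (fun _ _ => abs_nonneg _) fun k _ => hG k _
      _ = _ := by simp
  exact mul_le_mul h1 (hreg.bound_kernel hh hhτ hz) (abs_nonneg _)
    ((Finset.prod_nonneg fun _ _ => abs_nonneg _).trans h1)

section Deviation

variable {Ω : Type*} [MeasurableSpace Ω] {d₁ d₂ : ℕ} {μ : Measure Ω} [IsProbabilityMeasure μ]
    {W : ℕ → Ω → Fin d₁ ⊕ Fin d₂ → ℝ} {fX : (Fin d₁ → ℝ) → ℝ} {f : (Fin d₁ ⊕ Fin d₂ → ℝ) → ℝ}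
    {K : ℝ → ℝ} {p : ℕ} {w : Fin d₁ ⊕ Fin d₂ → ℝ} {R : Finset (Fin d₁ ⊕ Fin d₂)} {τ ρ B η : ℝ}

/-- Deviation of the oracle estimator (weighted by the true density of `X`) from its mean, when
the product `P` of the bandwidths satisfies `n P ≥ θ ℓ`. The logarithmic factor `ℓ ^ a` with
`a > 1` in the allowed deviation makes the probability smaller than any power of `exp (-ℓ)`. -/
theorem measure_kernelEstWith_sub_ge_le (hW : ∀ i, Measurable (W i)) (hindep : iIndepFun W μ)
    (hfX_meas : Measurable fX) (hfX_nonneg : ∀ u, 0 ≤ fX u)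
    (hf_meas : Measurable f) (hf_nonneg : ∀ u, 0 ≤ f u)
    (hdens : ∀ i, HasCondDensity μ (W i) fX f)
    (hK : IsKernelOfOrder K p) (hreg : IsRegularNear K p f w R τ ρ B η) (hτ : 0 < τ)
    {δ : ℝ} (hδ : 0 < δ) (hfδ : ∀ x ∈ nbhd K (fun _ => τ) (fstPart w), δ ≤ fX x)
    {G : Fin d₁ ⊕ Fin d₂ → ℝ → ℝ} (hG : ∀ k, Measurable (G k)) {c : ℝ} (hc : 0 < c)
    (hGc : ∀ k t, |G k t| ≤ c) (hGK : ∀ k, ∀ t ∉ tsupport K, G k t = 0)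
    {h : Fin d₁ ⊕ Fin d₂ → ℝ} (hh : ∀ k, 0 < h k) (hhτ : ∀ k, h k ≤ τ)
    {n : ℕ} (hn : 0 < n) {θ ℓ a ε : ℝ} (hθ : 0 < θ) (hℓ : 0 < ℓ)
    (hP : θ * (ℓ / n) ≤ ∏ k, h k) :
    μ {ω | ε * Real.sqrt (ℓ ^ a / (n * ∏ k, h k)) ≤
        |kernelEstWith G n fX (fun i => W i ω) w h - kernelMean K G f w h|} ≤
      ENNReal.ofReal (2 * Real.exp
        (-(Real.sqrt θ / (c ^ (d₁ + d₂) / δ) * ε * ℓ ^ ((a + 1) / 2)) +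
          θ * (c ^ (d₁ + d₂) * B * boxVolume (Fin d₁ ⊕ Fin d₂) K) / (c ^ (d₁ + d₂) / δ) * ℓ)) := by
  have hn' : (0 : ℝ) < n := by exact_mod_cast hn
  set P := ∏ k, h k with hPdef
  have hP0 : 0 < P := Finset.prod_pos fun k _ => hh k
  set b₀ := c ^ (d₁ + d₂) / δ with hb₀
  have hb₀pos : 0 < b₀ := by positivity
  set mb := c ^ (d₁ + d₂) * B * boxVolume (Fin d₁ ⊕ Fin d₂) K with hmb
  have hcard : Fintype.card (Fin d₁ ⊕ Fin d₂) = d₁ + d₂ := by simp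
  set φ : (Fin d₁ ⊕ Fin d₂ → ℝ) → ℝ := fun u => 1 / fX (fstPart u) * kernelWeight G w h u with hφ
  have hφm : Measurable φ :=
    (measurable_const.div (hfX_meas.comp measurable_fstPart)).mul (measurable_kernelWeight hG w h)
  have hpos : ∀ x ∈ nbhd K (fun _ => τ) (fstPart w), 0 < fX x := fun x hx => hδ.trans_le (hfδ x hx)
  have hφb : ∀ u, |φ u| ≤ b₀ / P := by
    intro u
    by_cases hu : kernelWeight G w h u = 0
    · simp only [hφ, hu, mul_zero, abs_zero]; positivity
    · have h1 := hfδ _ (fstPart_mem_nbhd (mem_nbhd_of_kernelWeight_ne_zero hK hGK hτ hh hhτ hu))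
      have h2 := abs_kernelWeight_le hGc w hh u
      rw [hcard] at h2
      rw [hφ]
      simp only
      rw [abs_mul, abs_of_nonneg (by positivity [hfX_nonneg (fstPart u)])]
      calc 1 / fX (fstPart u) * |kernelWeight G w h u| ≤ 1 / δ * (c ^ (d₁ + d₂) / P) := by
            gcongr
        _ = b₀ / P := by rw [hb₀]; ring
  have hmean : ∀ i, ∫ ω, φ (W i ω) ∂μ = kernelMean K G f w h := fun i =>
    (hdens i).integral_weight (hW i) hfX_meas hfX_nonneg hf_meas hf_nonneg hK hG hGK hτ hpos hh hhτ
  have habs : ∀ i, ∫ ω, |φ (W i ω)| ∂μ ≤ mb := by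
    intro i
    have h1 := (hdens i).integral_weight (hW i) hfX_meas hfX_nonneg hf_meas hf_nonneg hK
      (G := fun k t => |G k t|) (fun k => (hG k).abs)
      (fun k t ht => by rw [hGK k t ht, abs_zero]) hτ hpos hh hhτ
    have h2 : ∀ ω, |φ (W i ω)| = 1 / fX (fstPart (W i ω)) *
        kernelWeight (fun k t => |G k t|) w h (W i ω) := by
      intro ω
      rw [hφ]
      simp only
      rw [abs_mul, abs_kernelWeight G w hh,
        abs_of_nonneg (one_div_nonneg.2 (hfX_nonneg (fstPart (W i ω))))]
    simp_rw [h2]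
    rw [h1]
    have h3 := abs_kernelMean_le hK hreg (G := fun k t => |G k t|) (c := c)
      (fun k t => by rw [abs_abs]; exact hGc k t) (fun k => (hh k).le) hhτ
    rw [hcard] at h3
    exact (le_abs_self _).trans h3
  -- a bounded density makes the second moment of order `1 / P` rather than `1 / P ^ 2`
  have hsq : ∀ i, ∫ ω, φ (W i ω) ^ 2 ∂μ ≤ b₀ / P * mb := by
    intro i
    have hi : Integrable (fun ω => |φ (W i ω)|) μ :=
      Integrable.of_bound ((hφm.comp (hW i)).abs).aestronglyMeasurable (b₀ / P)
        (Eventually.of_forall fun ω => by rw [Real.norm_eq_abs, abs_abs]; exact hφb _)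
    calc ∫ ω, φ (W i ω) ^ 2 ∂μ ≤ ∫ ω, b₀ / P * |φ (W i ω)| ∂μ := by
          refine integral_mono_of_nonneg (Eventually.of_forall fun _ => sq_nonneg _)
            (hi.const_mul _) (Eventually.of_forall fun ω => ?_)
          change φ (W i ω) ^ 2 ≤ b₀ / P * |φ (W i ω)|
          rw [← sq_abs, sq]
          exact mul_le_mul_of_nonneg_right (hφb _) (abs_nonneg _)
      _ = b₀ / P * ∫ ω, |φ (W i ω)| ∂μ := integral_const_mul _ _
      _ ≤ _ := mul_le_mul_of_nonneg_left (habs i) (by positivity)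
  -- with this tilt, `s (b₀ / P) ≤ 1` is the assumption `hP`, and the variance term is a multiple
  -- of `ℓ`, of smaller order than `ℓ ^ ((a + 1) / 2)`
  set s := Real.sqrt θ / b₀ * Real.sqrt (P * ℓ / n) with hs
  have hs2 : s ^ 2 = θ / b₀ ^ 2 * (P * ℓ / n) := by
    rw [hs, mul_pow, div_pow, Real.sq_sqrt hθ.le, Real.sq_sqrt (by positivity)]
  have hsb : s * (b₀ / P) ≤ 1 := by
    have h0 : 0 ≤ s * (b₀ / P) := by positivity
    rw [← abs_of_nonneg h0, ← sq_le_one_iff_abs_le_one, mul_pow, hs2]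
    have : θ / b₀ ^ 2 * (P * ℓ / n) * (b₀ / P) ^ 2 = θ * (ℓ / n) / P := by field_simp
    rw [this, div_le_one hP0]
    exact hP
  have key := measure_abs_mean_sub_ge_le (μ := μ) (ξ := fun i ω => φ (W i ω))
    (hindep.comp (fun _ => φ) fun _ => hφm) (fun i => hφm.comp (hW i))
    (fun i ω => hφb _) hmean hsq (by positivity) hsb hn (ε * Real.sqrt (ℓ ^ a / (n * P)))
  refine key.trans (le_of_eq ?_)
  congr 4
  · rw [hs]
    have h1 : Real.sqrt (P * ℓ / n) * (n * Real.sqrt (ℓ ^ a / (n * P))) = ℓ ^ ((a + 1) / 2) := by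
      have e : (n : ℝ) = Real.sqrt ((n : ℝ) ^ 2) := (Real.sqrt_sq hn'.le).symm
      have hla : 0 < ℓ ^ a := Real.rpow_pos_of_pos hℓ a
      conv_lhs => enter [2, 1]; rw [e]
      rw [← Real.sqrt_mul (by positivity), ← Real.sqrt_mul (by positivity)]
      have : P * ℓ / n * ((n : ℝ) ^ 2 * (ℓ ^ a / (n * P))) = ℓ ^ (a + 1) := by
        rw [Real.rpow_add_one hℓ.ne']
        field_simp
      rw [this, Real.sqrt_eq_rpow, ← Real.rpow_mul hℓ.le]
      congr 1; ring
    rw [← h1]; ring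
  · rw [hs2]; field_simp

end Deviation

/-- Replacing the density of `X` by an estimator with relative error at most `κ` changes the
weighted estimator by at most `κ` times the oracle estimator with the absolute kernels. -/
theorem abs_kernelEstWith_sub_le {d₁ d₂ : ℕ} {K : ℝ → ℝ} {p : ℕ} (hK : IsKernelOfOrder K p)
    {G : Fin d₁ ⊕ Fin d₂ → ℝ → ℝ} (hGK : ∀ k, ∀ t ∉ tsupport K, G k t = 0) (n : ℕ)
    {fX g : (Fin d₁ → ℝ) → ℝ} (W : ℕ → Fin d₁ ⊕ Fin d₂ → ℝ) {w h : Fin d₁ ⊕ Fin d₂ → ℝ}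
    {τ κ : ℝ} (hτ : 0 < τ) (hh : ∀ k, 0 < h k) (hhτ : ∀ k, h k ≤ τ)
    (hfX : ∀ x ∈ nbhd K (fun _ => τ) (fstPart w), 0 < fX x)
    (hg : ∀ x ∈ nbhd K (fun _ => τ) (fstPart w), 0 < g x)
    (hκ : ∀ x ∈ nbhd K (fun _ => τ) (fstPart w), |(fX x - g x) / g x| ≤ κ) :
    |kernelEstWith G n g W w h - kernelEstWith G n fX W w h| ≤
      κ * kernelEstWith (fun k t => |G k t|) n fX W w h := by
  unfold kernelEstWith
  rw [← mul_sub, ← Finset.sum_sub_distrib, abs_mul, abs_of_nonneg (by positivity), mul_left_comm]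
  refine mul_le_mul_of_nonneg_left ?_ (by positivity)
  rw [Finset.mul_sum]
  refine (Finset.abs_sum_le_sum_abs _ _).trans (Finset.sum_le_sum fun i _ => ?_)
  rw [← abs_kernelWeight G w hh]
  by_cases hu : kernelWeight G w h (W i) = 0
  · simp [hu]
  · have hx := fstPart_mem_nbhd (mem_nbhd_of_kernelWeight_ne_zero hK hGK hτ hh hhτ hu)
    have h1 := hfX _ hx
    have h2 := hg _ hx
    have h3 := hκ _ hx
    set A := fX (fstPart (W i))
    set Bg := g (fstPart (W i))
    have : 1 / Bg * kernelWeight G w h (W i) - 1 / A * kernelWeight G w h (W i) =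
        (A - Bg) / Bg * (1 / A * kernelWeight G w h (W i)) := by
      field_simp
    rw [this, abs_mul, abs_mul, abs_of_pos (one_div_pos.2 h1)]
    exact mul_le_mul_of_nonneg_right h3 (by positivity)

/-! ### Uniform concentration over the bandwidth grid -/

/-- The bandwidths that the algorithm can reach: powers of `β` times the initial bandwidth, whose
product is at least `θ log n / n`. -/
structure InGrid {ι : Type*} [Fintype ι] (β θ : ℝ) (n : ℕ) (h : ι → ℝ) : Prop where
  exists_pow : ∃ k : ι → ℕ, ∀ j, h j = β ^ k j * (1 / Real.log n)
  le_prod : θ * (Real.log n / n) ≤ ∏ j, h j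

theorem tendsto_log_nat : Tendsto (fun n : ℕ => Real.log n) atTop atTop :=
  Real.tendsto_log_atTop.comp tendsto_natCast_atTop_atTop

theorem eventually_mul_log_le (C : ℝ) {c b : ℝ} (hc : 0 < c) (hb : 1 < b) :
    ∀ᶠ n : ℕ in atTop, C * Real.log n ≤ c * Real.log n ^ b := by
  have h1 : Tendsto (fun n : ℕ => Real.log n ^ (b - 1)) atTop atTop :=
    (tendsto_rpow_atTop (by linarith)).comp tendsto_log_nat
  filter_upwards [h1.eventually_ge_atTop (C / c), tendsto_log_nat.eventually_gt_atTop 0]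
    with n hn hL
  rw [div_le_iff₀ hc] at hn
  have : Real.log n ^ b = Real.log n ^ (b - 1) * Real.log n := by
    rw [← Real.rpow_add_one hL.ne']; congr 1; ring
  rw [this]
  nlinarith

section Grid

variable {ι : Type*} [Fintype ι] {β θ : ℝ} {n : ℕ} {h : ι → ℝ}

theorem InGrid.pos (hh : InGrid β θ n h) (hβ₀ : 0 < β) (hL : 0 < Real.log n) (j : ι) :
    0 < h j := by
  obtain ⟨k, hk⟩ := hh.exists_pow
  rw [hk j]; positivity

theorem InGrid.le_init (hh : InGrid β θ n h) (hβ₀ : 0 < β) (hβ₁ : β < 1) (hL : 0 < Real.log n)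
    (j : ι) : h j ≤ 1 / Real.log n := by
  obtain ⟨k, hk⟩ := hh.exists_pow
  rw [hk j]
  exact mul_le_of_le_one_left (by positivity) (pow_le_one₀ hβ₀.le hβ₁.le)

theorem InGrid.prod_le (hh : InGrid β θ n h) (hβ₀ : 0 < β) (hβ₁ : β < 1) (hL : 0 < Real.log n) :
    ∏ j, h j ≤ (1 / Real.log n) ^ Fintype.card ι := by
  calc ∏ j, h j ≤ ∏ _j : ι, 1 / Real.log n :=
        Finset.prod_le_prod (fun j _ => (hh.pos hβ₀ hL j).le) fun j _ => hh.le_init hβ₀ hβ₁ hL j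
    _ = _ := by simp

/-- The grid has at most polynomially many points: a component shrunk more than `n` times would
violate the lower bound on the product. -/
theorem eventually_exists_fin (ι : Type*) [Fintype ι] [DecidableEq ι] {β θ : ℝ} (hβ₀ : 0 < β)
    (hβ₁ : β < 1) (hθ : 0 < θ) :
    ∀ᶠ n : ℕ in atTop, ∀ h : ι → ℝ, InGrid β θ n h →
      ∃ k : ι → Fin (n + 1), h = fun j => β ^ (k j : ℕ) * (1 / Real.log n) := by
  have h1 : ∀ᶠ n : ℕ in atTop, (n : ℝ) * β ^ n < θ :=
    (tendsto_self_mul_const_pow_of_lt_one hβ₀.le hβ₁).eventually (gt_mem_nhds hθ)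
  filter_upwards [h1, tendsto_log_nat.eventually_ge_atTop 1, eventually_gt_atTop 0]
    with n hn hL hn0 h hh
  obtain ⟨k, hk⟩ := hh.exists_pow
  have hn' : (0 : ℝ) < n := by exact_mod_cast hn0
  have hL0 : 0 < Real.log n := by linarith
  have hle : ∀ j, k j ≤ n := by
    intro j
    by_contra! hlt
    have h2 : ∏ i, h i ≤ h j := by
      rw [← Finset.mul_prod_erase Finset.univ _ (Finset.mem_univ j)]
      refine mul_le_of_le_one_right (hh.pos hβ₀ hL0 j).le
        (Finset.prod_le_one (fun i _ => (hh.pos hβ₀ hL0 i).le) fun i _ => ?_)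
      exact (hh.le_init hβ₀ hβ₁ hL0 i).trans (by rw [div_le_one hL0]; exact hL)
    have h3 : h j ≤ β ^ n := by
      rw [hk j]
      calc β ^ k j * (1 / Real.log n) ≤ β ^ n * 1 := by
            gcongr ?_ * ?_
            · exact pow_le_pow_of_le_one hβ₀.le hβ₁.le hlt.le
            · rw [div_le_one hL0]; exact hL
        _ = β ^ n := mul_one _
    have h4 : θ / n ≤ θ * (Real.log n / n) := by
      rw [div_eq_mul_one_div]; gcongr
    have h5 : θ / n ≤ β ^ n := h4.trans (hh.le_prod.trans (h2.trans h3))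
    rw [div_le_iff₀ hn'] at h5
    linarith
  refine ⟨fun j => ⟨k j, Nat.lt_succ_of_le (hle j)⟩, ?_⟩
  funext j
  exact hk j

end Grid

section Uniform

variable {Ω : Type*} [MeasurableSpace Ω] {d₁ d₂ : ℕ} {μ : Measure Ω} [IsProbabilityMeasure μ]
    {W : ℕ → Ω → Fin d₁ ⊕ Fin d₂ → ℝ} {fX : (Fin d₁ → ℝ) → ℝ} {f : (Fin d₁ ⊕ Fin d₂ → ℝ) → ℝ}
    {K : ℝ → ℝ} {p : ℕ} {w : Fin d₁ ⊕ Fin d₂ → ℝ} {R : Finset (Fin d₁ ⊕ Fin d₂)} {ρ B η : ℝ}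

/-- Uniform control of the oracle estimators, for finitely many kernels, over the grid. -/
theorem eventually_exists_bad_set_oracle (hW : ∀ i, Measurable (W i)) (hindep : iIndepFun W μ)
    (hfX_meas : Measurable fX) (hfX_nonneg : ∀ u, 0 ≤ fX u)
    (hf_meas : Measurable f) (hf_nonneg : ∀ u, 0 ≤ f u)
    (hdens : ∀ i, HasCondDensity μ (W i) fX f) (hK : IsKernelOfOrder K p)
    (hreg : ∀ᶠ n : ℕ in atTop, IsRegularNear K p f w R (1 / Real.log n) ρ B η)
    {δ : ℝ} (hδ : 0 < δ)
    (hfδ : ∀ᶠ n : ℕ in atTop, ∀ x ∈ nbhd K (fun _ => 1 / Real.log n) (fstPart w), δ ≤ fX x)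
    {T : Type*} [Fintype T] {G : T → Fin d₁ ⊕ Fin d₂ → ℝ → ℝ} (hG : ∀ i k, Measurable (G i k))
    {c : ℝ} (hc : 0 < c) (hGc : ∀ i k t, |G i k t| ≤ c)
    (hGK : ∀ i k, ∀ t ∉ tsupport K, G i k t = 0)
    {β θ a ε : ℝ} (hβ₀ : 0 < β) (hβ₁ : β < 1) (hθ : 0 < θ) (ha : 1 < a) (hε : 0 < ε) (D : ℝ) :
    ∀ᶠ n : ℕ in atTop, ∃ bad : Set Ω, μ bad ≤ ENNReal.ofReal ((n : ℝ) ^ (-D)) ∧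
      ∀ ω ∉ bad, ∀ h, InGrid β θ n h → ∀ i,
        |kernelEstWith (G i) n fX (fun i => W i ω) w h - kernelMean K (G i) f w h| ≤
          ε * Real.sqrt (Real.log n ^ a / (n * ∏ k, h k)) := by
  classical
  set d := d₁ + d₂ with hd
  have hcard : Fintype.card (Fin d₁ ⊕ Fin d₂) = d := by simp [hd]
  set c₁ := Real.sqrt θ / (c ^ (d₁ + d₂) / δ) * ε with hc₁
  have hc₁pos : 0 < c₁ := by positivity
  set A := θ * (c ^ (d₁ + d₂) * B * boxVolume (Fin d₁ ⊕ Fin d₂) K) / (c ^ (d₁ + d₂) / δ) with hA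
  have hmany : ∀ᶠ n : ℕ in atTop, 2 * (Fintype.card T : ℝ) ≤ n :=
    tendsto_natCast_atTop_atTop.eventually_ge_atTop _
  filter_upwards [hreg, hfδ, eventually_exists_fin (Fin d₁ ⊕ Fin d₂) hβ₀ hβ₁ hθ, hmany,
    eventually_mul_log_le (2 * d + 1 + A + D) hc₁pos (b := (a + 1) / 2) (by linarith),
    tendsto_log_nat.eventually_gt_atTop 0, eventually_ge_atTop 2]
    with n hregn hfδn hfin hJ hexp hL hn2
  have hn0 : 0 < n := by omega
  have hn' : (0 : ℝ) < n := by exact_mod_cast hn0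
  set H : (Fin d₁ ⊕ Fin d₂ → Fin (n + 1)) → Fin d₁ ⊕ Fin d₂ → ℝ :=
    fun k j => β ^ (k j : ℕ) * (1 / Real.log n) with hH
  set E : (Fin d₁ ⊕ Fin d₂ → Fin (n + 1)) × T → Set Ω := fun q =>
    if InGrid β θ n (H q.1) then
      {ω | ε * Real.sqrt (Real.log n ^ a / (n * ∏ k, H q.1 k)) ≤
        |kernelEstWith (G q.2) n fX (fun i => W i ω) w (H q.1) -
          kernelMean K (G q.2) f w (H q.1)|}
    else ∅ with hE
  have hEle : ∀ q, μ (E q) ≤ ENNReal.ofReal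
      (2 * Real.exp (-(c₁ * Real.log n ^ ((a + 1) / 2)) + A * Real.log n)) := by
    intro q
    simp only [hE]
    split_ifs with hq
    · exact measure_kernelEstWith_sub_ge_le hW hindep hfX_meas hfX_nonneg hf_meas hf_nonneg hdens
        hK hregn (by positivity) hδ hfδn (hG q.2) hc (hGc q.2) (hGK q.2)
        (fun k => hq.pos hβ₀ hL k) (fun k => hq.le_init hβ₀ hβ₁ hL k) hn0 hθ hL hq.le_prod
    · simp
  refine ⟨⋃ q, E q, ?_, ?_⟩
  · calc μ (⋃ q, E q) ≤ ∑ q, μ (E q) := measure_iUnion_fintype_le μ E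
      _ ≤ ∑ _q : (Fin d₁ ⊕ Fin d₂ → Fin (n + 1)) × T, ENNReal.ofReal
          (2 * Real.exp (-(c₁ * Real.log n ^ ((a + 1) / 2)) + A * Real.log n)) :=
          Finset.sum_le_sum fun q _ => hEle q
      _ = ENNReal.ofReal ((((n : ℝ) + 1) ^ d * Fintype.card T) *
          (2 * Real.exp (-(c₁ * Real.log n ^ ((a + 1) / 2)) + A * Real.log n))) := by
          rw [Finset.sum_const, Finset.card_univ, Fintype.card_prod, Fintype.card_fun, hcard,
            Fintype.card_fin, nsmul_eq_mul, ENNReal.ofReal_mul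
              (show 0 ≤ ((n : ℝ) + 1) ^ d * (Fintype.card T : ℝ) by positivity)]
          congr 1
          rw [← ENNReal.ofReal_natCast]
          push_cast
          rfl
      _ ≤ _ := by
          refine ENNReal.ofReal_le_ofReal ?_
          have hnexp : (n : ℝ) = Real.exp (Real.log n) := (Real.exp_log hn').symm
          have h1 : (n : ℝ) + 1 ≤ Real.exp (2 * Real.log n) := by
            rw [two_mul, Real.exp_add, ← hnexp]
            have : (2 : ℝ) ≤ n := by exact_mod_cast hn2
            nlinarith
          have h2 : ((n : ℝ) + 1) ^ d ≤ Real.exp (2 * d * Real.log n) := by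
            calc ((n : ℝ) + 1) ^ d ≤ Real.exp (2 * Real.log n) ^ d := by gcongr
              _ = _ := by rw [← Real.exp_nat_mul]; congr 1; ring
          calc ((n : ℝ) + 1) ^ d * Fintype.card T *
                (2 * Real.exp (-(c₁ * Real.log n ^ ((a + 1) / 2)) + A * Real.log n))
              = ((n : ℝ) + 1) ^ d * (2 * Fintype.card T) *
                Real.exp (-(c₁ * Real.log n ^ ((a + 1) / 2)) + A * Real.log n) := by ring
            _ ≤ Real.exp (2 * d * Real.log n) * Real.exp (Real.log n) *
                Real.exp (-(c₁ * Real.log n ^ ((a + 1) / 2)) + A * Real.log n) := by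
                rw [← hnexp]; gcongr
            _ = Real.exp (2 * d * Real.log n + Real.log n +
                (-(c₁ * Real.log n ^ ((a + 1) / 2)) + A * Real.log n)) := by
                rw [← Real.exp_add, ← Real.exp_add]
            _ ≤ Real.exp (-D * Real.log n) := by
                rw [Real.exp_le_exp]; linarith
            _ = (n : ℝ) ^ (-D) := by
                rw [Real.rpow_def_of_pos hn', mul_comm]
  · intro ω hω h hh i
    obtain ⟨k, rfl⟩ := hfin h hh
    by_contra! hlt
    refine hω (Set.mem_iUnion.2 ⟨(k, i), ?_⟩)
    have : InGrid β θ n (H k) := hh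
    simp only [hE, this, if_true]
    exact hlt.le

/-- The kernels of `f̂_h` (for `none`) and of the statistics `Z_{hj}` (for `some j`). -/
noncomputable def kernelFamily {ι : Type*} [DecidableEq ι] (K : ℝ → ℝ) : Option ι → ι → ℝ → ℝ
  | none => fun _ => K
  | some j => kernelsJ K j

theorem kernelFamily_continuous {ι : Type*} [DecidableEq ι] (hK : IsKernelOfOrder K p)
    (i : Option ι) (k : ι) : Continuous (kernelFamily K i k) := by
  cases i with
  | none => exact hK.continuous
  | some j => exact kernelsJ_continuous hK j k

theorem kernelFamily_eq_zero {ι : Type*} [DecidableEq ι] (i : Option ι) (k : ι) (t : ℝ)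
    (ht : t ∉ tsupport K) : kernelFamily K i k t = 0 := by
  cases i with
  | none => exact image_eq_zero_of_notMem_tsupport ht
  | some j =>
    by_cases hk : k = j
    · subst hk; simpa [kernelFamily, kernelsJ] using IsKernelOfOrder.J_eq_zero ht
    · simpa [kernelFamily, kernelsJ, Function.update_of_ne hk] using
        image_eq_zero_of_notMem_tsupport ht

theorem exists_kernelFamily_bound (ι : Type*) [DecidableEq ι] (hK : IsKernelOfOrder K p) :
    ∃ c : ℝ, 1 ≤ c ∧ ∀ (i : Option ι) k t, |kernelFamily K i k t| ≤ c := by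
  obtain ⟨c₁, h₁⟩ := hK.hasCompactSupport.exists_bound_of_continuous hK.continuous
  obtain ⟨c₂, h₂⟩ := hK.hasCompactSupport_J.exists_bound_of_continuous hK.continuous_J
  refine ⟨max 1 (max c₁ c₂), le_max_left _ _, fun i k t => ?_⟩
  have hK' : |K t| ≤ max 1 (max c₁ c₂) :=
    (h₁ t).trans ((le_max_left _ _).trans (le_max_right _ _))
  have hJ' : |J K t| ≤ max 1 (max c₁ c₂) :=
    (h₂ t).trans ((le_max_right _ _).trans (le_max_right _ _))
  cases i with
  | none => exact hK'
  | some j =>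
    by_cases hk : k = j
    · subst hk; simpa [kernelFamily, kernelsJ] using hJ'
    · simpa [kernelFamily, kernelsJ, Function.update_of_ne hk] using hK'

/-- Uniform control of the estimators with estimated weights. Outside an event whose probability
is smaller than any power of `1 / n`, the deviations are negligible with respect to the
thresholds. -/
theorem eventually_exists_bad_set (hW : ∀ i, Measurable (W i)) (hindep : iIndepFun W μ)
    (hfX_meas : Measurable fX) (hfX_nonneg : ∀ u, 0 ≤ fX u)
    (hf_meas : Measurable f) (hf_nonneg : ∀ u, 0 ≤ f u)
    (hdens : ∀ i, HasCondDensity μ (W i) fX f) (hK : IsKernelOfOrder K p)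
    (hreg : ∀ᶠ n : ℕ in atTop, IsRegularNear K p f w R (1 / Real.log n) ρ B η)
    {δ : ℝ} (hδ : 0 < δ)
    (hfδ : ∀ᶠ n : ℕ in atTop, ∀ x ∈ nbhd K (fun _ => 1 / Real.log n) (fstPart w), δ ≤ fX x)
    {ftX : ℕ → Ω → (Fin d₁ → ℝ) → ℝ} {κ M : ℝ} (hM : 0 < M)
    (hftX_lower : ∀ᶠ n : ℕ in atTop, ∀ᵐ ω ∂μ, ∀ u ∈ nbhdN K n (fstPart w),
      (n : ℝ) ^ (-κ) ≤ ftX n ω u)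
    (hftX_conc : ∀ᶠ n : ℕ in atTop,
      μ {ω | ∃ u ∈ nbhdN K n (fstPart w),
          M * (Real.log n ^ (((d₁ + d₂ : ℕ) : ℝ) / 2) / (n : ℝ) ^ (1 / 2 : ℝ)) <
            |(fX u - ftX n ω u) / ftX n ω u|} ≤
        ENNReal.ofReal (Real.exp (-(Real.log n ^ (5 / 4 : ℝ)))))
    {β θ a ε : ℝ} (hβ₀ : 0 < β) (hβ₁ : β < 1) (hθ : 0 < θ) (ha : 1 < a) (hε : 0 < ε) (D : ℝ) :
    ∀ᶠ n : ℕ in atTop, ∃ bad : Set Ω, MeasurableSet bad ∧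
      μ bad ≤ ENNReal.ofReal ((n : ℝ) ^ (-D)) ∧
      ∀ ω ∉ bad, ∀ h, InGrid β θ n h → ∀ i : Option (Fin d₁ ⊕ Fin d₂),
        |kernelEstWith (kernelFamily K i) n (ftX n ω) (fun i => W i ω) w h -
          kernelMean K (kernelFamily K i) f w h| ≤
          ε * Real.sqrt (Real.log n ^ a / (n * ∏ k, h k)) := by
  set d := d₁ + d₂ with hd
  have hcard : Fintype.card (Fin d₁ ⊕ Fin d₂) = d := by simp [hd]
  obtain ⟨c, hc1, hc⟩ := exists_kernelFamily_bound (Fin d₁ ⊕ Fin d₂) hK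
  have hc0 : 0 < c := by linarith
  have hor := eventually_exists_bad_set_oracle hW hindep hfX_meas hfX_nonneg hf_meas hf_nonneg
    hdens hK hreg hδ hfδ (T := Option (Fin d₁ ⊕ Fin d₂)) (G := kernelFamily K)
    (fun i k => (kernelFamily_continuous hK i k).measurable) hc0 hc
    (fun i k t ht => kernelFamily_eq_zero i k t ht) hβ₀ hβ₁ hθ ha
    (show 0 < ε / 3 by positivity) (D + 2)
  have hor' := eventually_exists_bad_set_oracle hW hindep hfX_meas hfX_nonneg hf_meas hf_nonneg
    hdens hK hreg hδ hfδ (T := Option (Fin d₁ ⊕ Fin d₂))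
    (G := fun i k t => |kernelFamily K i k t|)
    (fun i k => (kernelFamily_continuous hK i k).abs.measurable) hc0
    (fun i k t => by rw [abs_abs]; exact hc i k t)
    (fun i k t ht => by rw [kernelFamily_eq_zero i k t ht, abs_zero]) hβ₀ hβ₁ hθ ha
    (show 0 < ε / 3 by positivity) (D + 2)
  set mb := c ^ d * B * boxVolume (Fin d₁ ⊕ Fin d₂) K with hmb
  have hLa : ∀ᶠ n : ℕ in atTop, M * mb / (ε / 3) ≤ Real.log n ^ (a / 2) :=
    ((tendsto_rpow_atTop (by linarith)).comp tendsto_log_nat).eventually_ge_atTop _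
  have hκ : ∀ᶠ n : ℕ in atTop,
      M * (Real.log n ^ ((d : ℝ) / 2) / (n : ℝ) ^ (1 / 2 : ℝ)) ≤ 1 := by
    have h1 : Tendsto (fun n : ℕ => M * (Real.log n ^ ((d : ℝ) / 2) / (n : ℝ) ^ (1 / 2 : ℝ)))
        atTop (𝓝 (M * 0)) := by
      have h2 := ((isLittleO_log_rpow_rpow_atTop ((d : ℝ) / 2)
        (show (0 : ℝ) < 1 / 2 by norm_num)).tendsto_div_nhds_zero).comp
          tendsto_natCast_atTop_atTop (α := ℕ)
      exact h2.const_mul M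
    rw [mul_zero] at h1
    exact (h1.eventually (gt_mem_nhds one_pos)).mono fun n hn => hn.le
  filter_upwards [hor, hor', hLa, hκ, hreg, hfδ, hftX_lower, hftX_conc,
    eventually_mul_log_le (D + 2) one_pos (show (1 : ℝ) < 5 / 4 by norm_num),
    tendsto_log_nat.eventually_gt_atTop 0, eventually_ge_atTop 4]
    with n ⟨bad₁, hb₁, hg₁⟩ ⟨bad₂, hb₂, hg₂⟩ hLan hκn hregn hfδn hlow hconc hexp hL hn4
  have hn0 : 0 < n := by omega
  have hn' : (0 : ℝ) < n := by exact_mod_cast hn0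
  set κn := M * (Real.log n ^ ((d : ℝ) / 2) / (n : ℝ) ^ (1 / 2 : ℝ)) with hκn_def
  have hκ0 : 0 ≤ κn := by positivity
  -- the first two events concern the oracle estimators with the kernels and with their absolute
  -- values, the last two the estimator of `f_X`
  set bad₃ := {ω | ∃ u ∈ nbhdN K n (fstPart w), κn < |(fX u - ftX n ω u) / ftX n ω u|} with hbad₃
  set bad₄ := {ω | ¬ ∀ u ∈ nbhdN K n (fstPart w), (n : ℝ) ^ (-κ) ≤ ftX n ω u} with hbad₄
  have hb₃ : μ bad₃ ≤ ENNReal.ofReal ((n : ℝ) ^ (-(D + 2))) := by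
    refine hconc.trans (ENNReal.ofReal_le_ofReal ?_)
    rw [Real.rpow_def_of_pos hn', Real.exp_le_exp]
    linarith
  have hb₄ : μ bad₄ = 0 := ae_iff.1 hlow
  refine ⟨toMeasurable μ (bad₁ ∪ bad₂ ∪ bad₃ ∪ bad₄), measurableSet_toMeasurable _ _, ?_, ?_⟩
  · rw [measure_toMeasurable]
    calc μ (bad₁ ∪ bad₂ ∪ bad₃ ∪ bad₄) ≤ μ bad₁ + μ bad₂ + μ bad₃ + μ bad₄ :=
          (measure_union_le _ _).trans (add_le_add ((measure_union_le _ _).trans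
            (add_le_add (measure_union_le _ _) le_rfl)) le_rfl)
      _ ≤ ENNReal.ofReal ((n : ℝ) ^ (-(D + 2))) + ENNReal.ofReal ((n : ℝ) ^ (-(D + 2))) +
          ENNReal.ofReal ((n : ℝ) ^ (-(D + 2))) + 0 := by
          rw [hb₄]; gcongr
      _ = ENNReal.ofReal ((n : ℝ) ^ (-(D + 2)) + (n : ℝ) ^ (-(D + 2)) + (n : ℝ) ^ (-(D + 2))) := by
          rw [add_zero, ENNReal.ofReal_add (by positivity) (by positivity),
            ENNReal.ofReal_add (by positivity) (by positivity)]
      _ ≤ _ := by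
          refine ENNReal.ofReal_le_ofReal ?_
          have h1 : (n : ℝ) ^ (-D) = (n : ℝ) ^ (-(D + 2)) * (n : ℝ) ^ (2 : ℝ) := by
            rw [← Real.rpow_add hn']; congr 1; ring
          have h2 : (3 : ℝ) ≤ (n : ℝ) ^ (2 : ℝ) := by
            have : (4 : ℝ) ≤ n := by exact_mod_cast hn4
            norm_num
            nlinarith
          have h3 : 0 ≤ (n : ℝ) ^ (-(D + 2)) := by positivity
          rw [h1]; nlinarith
  · intro ω hω h hh i
    have hω' : ω ∉ bad₁ ∪ bad₂ ∪ bad₃ ∪ bad₄ := fun hc => hω (subset_toMeasurable _ _ hc)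
    simp only [Set.mem_union, not_or] at hω'
    obtain ⟨⟨⟨hω1, hω2⟩, hω3⟩, hω4⟩ := hω'
    have h1 := hg₁ ω hω1 h hh i
    have h2 := hg₂ ω hω2 h hh i
    have hhp : ∀ k, 0 < h k := fun k => hh.pos hβ₀ hL k
    have hhτ : ∀ k, h k ≤ 1 / Real.log n := fun k => hh.le_init hβ₀ hβ₁ hL k
    have hP0 : 0 < ∏ k, h k := Finset.prod_pos fun k _ => hhp k
    simp only [hbad₄, Set.mem_ofPred_eq, not_not] at hω4
    simp only [hbad₃, Set.mem_ofPred_eq, not_exists, not_and, not_lt] at hω3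
    have hτ : 0 < 1 / Real.log n := by positivity
    have h3 := abs_kernelEstWith_sub_le hK (G := kernelFamily K i)
      (fun k t ht => kernelFamily_eq_zero i k t ht) n (fX := fX) (g := ftX n ω)
      (fun i => W i ω) (w := w) (h := h) hτ hhp hhτ (fun x hx => hδ.trans_le (hfδn x hx))
      (fun x hx => (Real.rpow_pos_of_pos hn' _).trans_le (hω4 x hx)) (κ := κn) hω3
    have h4 := abs_kernelMean_le hK hregn (G := fun k t => |kernelFamily K i k t|) (c := c)
      (fun k t => by rw [abs_abs]; exact hc i k t) (fun k => (hhp k).le) hhτ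
    rw [hcard] at h4
    set rho := Real.sqrt (Real.log n ^ a / (n * ∏ k, h k)) with hrho
    have hrho0 : 0 ≤ rho := Real.sqrt_nonneg _
    -- bandwidths are at most `1 / log n`, so `rho` exceeds the error of the estimator of `f_X` by
    -- a factor `(log n) ^ (a / 2)`
    have h5 : κn * mb ≤ ε / 3 * rho := by
      have hlow : Real.log n ^ ((a + d) / 2) / (n : ℝ) ^ (1 / 2 : ℝ) ≤ rho := by
        have hp := hh.prod_le hβ₀ hβ₁ hL
        rw [hcard] at hp
        rw [hrho, ← Real.sqrt_eq_rpow, Real.le_sqrt' (by positivity), div_pow,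
          Real.sq_sqrt hn'.le, ← Real.rpow_natCast, ← Real.rpow_mul hL.le]
        have e : (a + d) / 2 * ((2 : ℕ) : ℝ) = a + d := by push_cast; ring
        rw [e, Real.rpow_add hL, Real.rpow_natCast, div_le_div_iff₀ hn' (by positivity)]
        have : Real.log n ^ d * ∏ k, h k ≤ 1 := by
          calc Real.log n ^ d * ∏ k, h k ≤ Real.log n ^ d * (1 / Real.log n) ^ d := by gcongr
            _ = 1 := by rw [← mul_pow, mul_one_div_cancel hL.ne', one_pow]
        have hLa0 : 0 < Real.log n ^ a := Real.rpow_pos_of_pos hL _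
        calc Real.log n ^ a * Real.log n ^ d * (n * ∏ k, h k) =
              Real.log n ^ a * n * (Real.log n ^ d * ∏ k, h k) := by ring
          _ ≤ Real.log n ^ a * n * 1 := by gcongr
          _ = _ := mul_one _
      rw [div_le_iff₀ (by positivity)] at hLan
      calc κn * mb = (M * mb) * (Real.log n ^ ((d : ℝ) / 2) / (n : ℝ) ^ (1 / 2 : ℝ)) := by
            rw [hκn_def]; ring
        _ ≤ (Real.log n ^ (a / 2) * (ε / 3)) *
            (Real.log n ^ ((d : ℝ) / 2) / (n : ℝ) ^ (1 / 2 : ℝ)) := by gcongr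
        _ = ε / 3 * (Real.log n ^ ((a + d) / 2) / (n : ℝ) ^ (1 / 2 : ℝ)) := by
            rw [show (a + d) / 2 = a / 2 + (d : ℝ) / 2 by ring, Real.rpow_add hL]; ring
        _ ≤ _ := by gcongr
    have h6 : κn * kernelEstWith (fun k t => |kernelFamily K i k t|) n fX (fun i => W i ω) w h ≤
        κn * mb + ε / 3 * rho := by
      have h7 := (abs_le.1 h2).2
      have h8 := (abs_le.1 h4).2
      calc κn * kernelEstWith (fun k t => |kernelFamily K i k t|) n fX (fun i => W i ω) w h
          ≤ κn * (mb + ε / 3 * rho) := by gcongr; linarith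
        _ = κn * mb + κn * (ε / 3 * rho) := by ring
        _ ≤ _ := by
          have : κn * (ε / 3 * rho) ≤ 1 * (ε / 3 * rho) := by gcongr
          linarith
    have h9 := abs_le.1 h3
    have h10 := abs_le.1 h1
    rw [abs_le]
    constructor <;> linarith [h9.1, h9.2, h10.1, h10.2]

end Uniform

/-! ### The bandwidth selection loop -/

section Loop

variable {ι : Type*} [DecidableEq ι] [Fintype ι] {Z lam : (ι → ℝ) → ι → ℝ} {β : ℝ} {n : ℕ}

theorem stateAt_succ (Z lam : (ι → ℝ) → ι → ℝ) (β : ℝ) (n t : ℕ) :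
    stateAt Z lam β n (t + 1) = step Z lam β (stateAt Z lam β n t) :=
  Function.iterate_succ_apply' _ _ _

/-- After `t` iterations, every bandwidth has been shrunk at most `t` times, and the active ones
exactly `t` times. -/
theorem exists_pow_stateAt (Z lam : (ι → ℝ) → ι → ℝ) (β : ℝ) (n t : ℕ) :
    ∃ k : ι → ℕ, ∀ j, (stateAt Z lam β n t).1 j = β ^ k j * (1 / Real.log n) ∧ k j ≤ t ∧
      (j ∈ (stateAt Z lam β n t).2 → k j = t) := by
  induction t with
  | zero => exact ⟨fun _ => 0, fun j => ⟨by simp [stateAt, initBandwidth], le_rfl, fun _ => rfl⟩⟩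
  | succ t ih =>
    obtain ⟨k, hk⟩ := ih
    rw [stateAt_succ]
    set s := stateAt Z lam β n t
    refine ⟨fun j => if j ∈ s.2 ∧ lam s.1 j ≤ |Z s.1 j| then k j + 1 else k j, fun j => ?_⟩
    obtain ⟨h1, h2, h3⟩ := hk j
    by_cases hj : j ∈ s.2 ∧ lam s.1 j ≤ |Z s.1 j|
    · simp only [step, hj, and_self, if_true]
      exact ⟨by rw [h1, pow_succ]; ring, by omega, fun _ => by rw [h3 hj.1]⟩
    · simp only [step, hj, if_false]
      exact ⟨h1, by omega, fun hm => absurd (Finset.mem_filter.1 hm) hj⟩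

theorem exists_not_loopCond (Z lam : (ι → ℝ) → ι → ℝ) (hβ₀ : 0 < β) (hβ₁ : β < 1)
    (hL : 0 < Real.log n) : ∃ t, ¬ loopCond n (stateAt Z lam β n t) := by
  by_contra! hc
  have hn : (0 : ℝ) < n := by
    rcases Nat.eq_zero_or_pos n with h | h
    · simp [h] at hL
    · exact_mod_cast h
  have hle : ∀ t, Real.log n / n ≤ β ^ t * (1 / Real.log n) ^ Fintype.card ι := by
    intro t
    obtain ⟨⟨j, hj⟩, hP⟩ := hc t
    obtain ⟨k, hk⟩ := exists_pow_stateAt Z lam β n t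
    refine hP.trans ?_
    calc ∏ i, (stateAt Z lam β n t).1 i = (∏ i, β ^ k i) * (1 / Real.log n) ^ Fintype.card ι := by
          rw [Finset.prod_congr rfl fun i _ => (hk i).1, Finset.prod_mul_distrib]
          simp
      _ ≤ _ := by
          gcongr
          rw [← Finset.mul_prod_erase Finset.univ _ (Finset.mem_univ j), (hk j).2.2 hj]
          exact mul_le_of_le_one_right (by positivity) (Finset.prod_le_one
            (fun i _ => by positivity) fun i _ => pow_le_one₀ hβ₀.le hβ₁.le)
  have hlim := (tendsto_pow_atTop_nhds_zero_of_lt_one hβ₀.le hβ₁).mul_const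
    ((1 / Real.log n) ^ Fintype.card ι)
  rw [zero_mul] at hlim
  have := ge_of_tendsto' hlim hle
  have : 0 < Real.log n / n := by positivity
  linarith

/-- The time at which the loop stops. -/
noncomputable def stopTime (Z lam : (ι → ℝ) → ι → ℝ) (β : ℝ) (n : ℕ) : ℕ :=
  sInf {t : ℕ | ¬ loopCond n (stateAt Z lam β n t)}

theorem loopOutput_eq (Z lam : (ι → ℝ) → ι → ℝ) (β : ℝ) (n : ℕ) :
    loopOutput Z lam β n = (stateAt Z lam β n (stopTime Z lam β n)).1 := rfl

theorem not_loopCond_stopTime (Z lam : (ι → ℝ) → ι → ℝ) (hβ₀ : 0 < β) (hβ₁ : β < 1)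
    (hL : 0 < Real.log n) : ¬ loopCond n (stateAt Z lam β n (stopTime Z lam β n)) :=
  Nat.sInf_mem (s := {t : ℕ | ¬ loopCond n (stateAt Z lam β n t)})
    (exists_not_loopCond Z lam hβ₀ hβ₁ hL)

theorem loopCond_of_lt_stopTime {t : ℕ} (ht : t < stopTime Z lam β n) :
    loopCond n (stateAt Z lam β n t) := by
  by_contra hc
  exact Nat.notMem_of_lt_sInf ht hc

theorem inGrid_of_loopCond (hβ₀ : 0 < β) (hβ₁ : β < 1) (hL : 0 < Real.log n) {t : ℕ}
    (ht : loopCond n (stateAt Z lam β n t)) :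
    InGrid β (β ^ Fintype.card ι) n (stateAt Z lam β n t).1 := by
  obtain ⟨k, hk⟩ := exists_pow_stateAt Z lam β n t
  exact ⟨⟨k, fun j => (hk j).1⟩,
    (mul_le_of_le_one_left (by positivity) (pow_le_one₀ hβ₀.le hβ₁.le)).trans ht.2⟩

theorem mul_le_step {ι : Type*} [DecidableEq ι] {Z lam : (ι → ℝ) → ι → ℝ} {β : ℝ}
    (hβ₁ : β < 1) {s : (ι → ℝ) × Finset ι} {j : ι} (hs : 0 ≤ s.1 j) :
    β * s.1 j ≤ (step Z lam β s).1 j := by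
  simp only [step]
  split_ifs
  · exact le_rfl
  · exact mul_le_of_le_one_left hs hβ₁.le

/-- The selected bandwidth may violate the lower bound on the product in the loop condition, but
by no more than the factor lost in the last iteration. -/
theorem inGrid_loopOutput (Z lam : (ι → ℝ) → ι → ℝ) (hβ₀ : 0 < β) (hβ₁ : β < 1)
    (hL : 0 < Real.log n) (hinit : Real.log n / n ≤ (1 / Real.log n) ^ Fintype.card ι) :
    InGrid β (β ^ Fintype.card ι) n (loopOutput Z lam β n) := by
  rw [loopOutput_eq]
  obtain ⟨k, hk⟩ := exists_pow_stateAt Z lam β n (stopTime Z lam β n)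
  refine ⟨⟨k, fun j => (hk j).1⟩, ?_⟩
  rcases Nat.eq_zero_or_pos (stopTime Z lam β n) with h0 | h0
  · rw [h0]
    calc β ^ Fintype.card ι * (Real.log n / n) ≤ 1 * (Real.log n / n) := by
          gcongr
          exact pow_le_one₀ hβ₀.le hβ₁.le
      _ ≤ (1 / Real.log n) ^ Fintype.card ι := by rwa [one_mul]
      _ = _ := by simp [stateAt, initBandwidth]
  · obtain ⟨s, hs⟩ : ∃ s, stopTime Z lam β n = s + 1 := ⟨_, (Nat.succ_pred_eq_of_pos h0).symm⟩
    have hc := loopCond_of_lt_stopTime (Z := Z) (lam := lam) (β := β) (n := n)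
      (show s < stopTime Z lam β n by omega)
    obtain ⟨k', hk'⟩ := exists_pow_stateAt Z lam β n s
    have hpos : ∀ j, 0 < (stateAt Z lam β n s).1 j := fun j => by
      rw [(hk' j).1]; positivity
    rw [hs, stateAt_succ]
    calc β ^ Fintype.card ι * (Real.log n / n)
        ≤ β ^ Fintype.card ι * ∏ j, (stateAt Z lam β n s).1 j := by
          gcongr; exact hc.2
      _ = ∏ j, β * (stateAt Z lam β n s).1 j := by
          rw [Finset.prod_mul_distrib]; simp
      _ ≤ _ := Finset.prod_le_prod (fun j _ => (mul_pos hβ₀ (hpos j)).le)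
          fun j _ => mul_le_step hβ₁ (hpos j).le

/-- What is known about a state `s` of the loop after `t` iterations if every test made so far has
been correct, in the sense of the hypotheses of `LoopInvariant.step`. The active components share
the smallest bandwidth, `c₂ * x` bounds the final bandwidths of the relevant ones from above, and
`prod_ge` says that the variance has not outgrown the squared bias. -/
structure LoopInvariant (β : ℝ) (n p : ℕ) (R : Finset ι) (c₁ c₂ x : ℝ) (t : ℕ)
    (s : (ι → ℝ) × Finset ι) : Prop where
  off : ∀ k ∉ R, s.1 k = 1 / Real.log n
  ge : ∀ k, β ^ t * (1 / Real.log n) ≤ s.1 k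
  active : ∀ k ∈ s.2, s.1 k = β ^ t * (1 / Real.log n)
  inactive : ∀ k ∈ R, k ∉ s.2 → s.1 k ^ (2 * p + R.card) ≤ c₂ * x
  prod_ge : β ^ (R.card * (2 * p + R.card)) * (c₁ * x) ^ R.card ≤
    (∏ k ∈ R, s.1 k) ^ (2 * p + R.card)

variable {p : ℕ} {R : Finset ι} {c₁ c₂ x : ℝ} {t : ℕ} {s : (ι → ℝ) × Finset ι}

theorem LoopInvariant.pos {ι : Type*} {β : ℝ} {n p : ℕ} {R : Finset ι} {c₁ c₂ x : ℝ} {t : ℕ}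
    {s : (ι → ℝ) × Finset ι} (h : LoopInvariant β n p R c₁ c₂ x t s) (hβ₀ : 0 < β)
    (hL : 0 < Real.log n) (k : ι) : 0 < s.1 k :=
  lt_of_lt_of_le (by positivity) (h.ge k)

theorem LoopInvariant.prod_eq (h : LoopInvariant β n p R c₁ c₂ x t s) :
    ∏ k, s.1 k = (1 / Real.log n) ^ (Fintype.card ι - R.card) * ∏ k ∈ R, s.1 k := by
  rw [← Finset.prod_compl_mul_prod R, Finset.prod_congr rfl fun k hk =>
    h.off k (Finset.mem_compl.1 hk), Finset.prod_const, Finset.card_compl]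

theorem LoopInvariant.active_pow_le {ι : Type*} {β : ℝ} {n p : ℕ} {R : Finset ι}
    {c₁ c₂ x : ℝ} {t : ℕ} {s : (ι → ℝ) × Finset ι} (h : LoopInvariant β n p R c₁ c₂ x t s)
    (hβ₀ : 0 < β)
    (hL : 0 < Real.log n) {j : ι} (hj : j ∈ s.2) : s.1 j ^ R.card ≤ ∏ k ∈ R, s.1 k := by
  rw [← Finset.prod_const]
  exact Finset.prod_le_prod (fun _ _ => (h.pos hβ₀ hL j).le) fun k _ => by
    rw [h.active j hj]; exact h.ge k

theorem LoopInvariant.div_prod_eq {a : ℝ} (h : LoopInvariant β n p R c₁ c₂ x t s)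
    (hx : x = Real.log n ^ a * Real.log n ^ (Fintype.card ι - R.card) / n)
    (hβ₀ : 0 < β) (hL : 0 < Real.log n) :
    Real.log n ^ a / (n * ∏ k, s.1 k) = x / ∏ k ∈ R, s.1 k := by
  have hR : 0 < ∏ k ∈ R, s.1 k := Finset.prod_pos fun k _ => h.pos hβ₀ hL k
  rw [h.prod_eq, hx, one_div, inv_pow]
  field_simp

/-- The invariant is preserved when the tests at the state `s` are correct: irrelevant components
fail the test, relevant ones pass it only if the squared bias dominates the variance, and fail it
only if the variance dominates the squared bias, up to constants. -/
theorem LoopInvariant.step {a : ℝ} (h : LoopInvariant β n p R c₁ c₂ x t s)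
    (hx : x = Real.log n ^ a * Real.log n ^ (Fintype.card ι - R.card) / n)
    (hβ₀ : 0 < β) (hβ₁ : β < 1) (hL : 0 < Real.log n) (hn : 0 < n) (hc₁ : 0 < c₁)
    (hoff : ∀ j ∉ R, |Z s.1 j| < lam s.1 j)
    (hpass : ∀ j ∈ R, lam s.1 j ≤ |Z s.1 j| →
      c₁ * (Real.log n ^ a / (n * ∏ k, s.1 k)) ≤ s.1 j ^ (2 * p))
    (hfail : ∀ j ∈ R, |Z s.1 j| < lam s.1 j →
      s.1 j ^ (2 * p) ≤ c₂ * (Real.log n ^ a / (n * ∏ k, s.1 k))) :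
    LoopInvariant β n p R c₁ c₂ x (t + 1) (step Z lam β s) := by
  have hn' : (0 : ℝ) < n := by exact_mod_cast hn
  have hpos := h.pos hβ₀ hL
  have hR : 0 < ∏ k ∈ R, s.1 k := Finset.prod_pos fun k _ => hpos k
  have hx0 : 0 < x := by rw [hx]; positivity
  rw [h.div_prod_eq hx hβ₀ hL] at hpass hfail
  refine ⟨fun k hk => ?_, fun k => ?_, fun k hk => ?_, fun k hk hk' => ?_, ?_⟩
  · simp only [CDRodeo.step, (hoff k hk).not_ge, and_false, if_false]
    exact h.off k hk
  · refine le_trans ?_ (mul_le_step hβ₁ (hpos k).le)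
    rw [pow_succ, mul_comm (β ^ t) β, mul_assoc]
    exact mul_le_mul_of_nonneg_left (h.ge k) hβ₀.le
  · have hk2 := Finset.mem_filter.1 hk
    simp only [CDRodeo.step, hk2, and_self, if_true]
    rw [h.active k hk2.1, pow_succ]; ring
  · have hnot : ¬ (k ∈ s.2 ∧ lam s.1 k ≤ |Z s.1 k|) := fun hc => hk' (Finset.mem_filter.2 hc)
    simp only [CDRodeo.step, hnot, if_false]
    by_cases hks : k ∈ s.2
    · -- `k` fails at this very step, when its bandwidth is still the smallest one
      have hf := hfail k hk (not_le.1 fun hc => hnot ⟨hks, hc⟩)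
      calc s.1 k ^ (2 * p + R.card) = s.1 k ^ (2 * p) * s.1 k ^ R.card := pow_add _ _ _
        _ ≤ (c₂ * (x / ∏ k ∈ R, s.1 k)) * ∏ k ∈ R, s.1 k := by
            have := hpos k
            exact mul_le_mul hf (h.active_pow_le hβ₀ hL hks) (by positivity)
              ((by positivity : 0 ≤ s.1 k ^ (2 * p)).trans hf)
        _ = c₂ * x := by field_simp
    · exact h.inactive k hk hks
  · by_cases hex : ∃ j, j ∈ s.2 ∧ lam s.1 j ≤ |Z s.1 j|
    · obtain ⟨j, hj, hjp⟩ := hex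
      have hjR : j ∈ R := by
        by_contra hc
        exact absurd hjp (hoff j hc).not_ge
      have h1 := hpass j hjR hjp
      have hsj := hpos j
      -- one passed test bounds the whole product, because `j` has the smallest bandwidth
      have h2 : c₁ * x ≤ s.1 j ^ (2 * p) * ∏ k ∈ R, s.1 k := by
        rw [← mul_div_assoc, div_le_iff₀ hR] at h1; exact h1
      have h3 : (c₁ * x) ^ R.card ≤ (∏ k ∈ R, s.1 k) ^ (2 * p + R.card) := by
        calc (c₁ * x) ^ R.card ≤ (s.1 j ^ (2 * p) * ∏ k ∈ R, s.1 k) ^ R.card := by gcongr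
          _ = (s.1 j ^ R.card) ^ (2 * p) * (∏ k ∈ R, s.1 k) ^ R.card := by
              rw [mul_pow, ← pow_mul, ← pow_mul, mul_comm (2 * p)]
          _ ≤ (∏ k ∈ R, s.1 k) ^ (2 * p) * (∏ k ∈ R, s.1 k) ^ R.card := by
              gcongr; exact h.active_pow_le hβ₀ hL hj
          _ = _ := (pow_add _ _ _).symm
      have h4 : β ^ R.card * ∏ k ∈ R, s.1 k ≤ ∏ k ∈ R, (CDRodeo.step Z lam β s).1 k := by
        rw [← Finset.prod_const, ← Finset.prod_mul_distrib]
        exact Finset.prod_le_prod (fun k _ => (mul_pos hβ₀ (hpos k)).le)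
          fun k _ => mul_le_step hβ₁ (hpos k).le
      calc β ^ (R.card * (2 * p + R.card)) * (c₁ * x) ^ R.card
          ≤ β ^ (R.card * (2 * p + R.card)) * (∏ k ∈ R, s.1 k) ^ (2 * p + R.card) := by gcongr
        _ = (β ^ R.card * ∏ k ∈ R, s.1 k) ^ (2 * p + R.card) := by rw [mul_pow, pow_mul]
        _ ≤ _ := by gcongr
    · have : (CDRodeo.step Z lam β s).1 = s.1 := by
        funext k
        simp only [CDRodeo.step]
        rw [if_neg fun hc => hex ⟨k, hc⟩]
      rw [this]
      exact h.prod_ge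

/-- The selected bandwidth when all tests are correct: it is not shrunk in the irrelevant
directions, and in the relevant ones it is neither too large nor, jointly, too small. -/
theorem loopOutput_bounds {a : ℝ}
    (hx : x = Real.log n ^ a * Real.log n ^ (Fintype.card ι - R.card) / n)
    (hβ₀ : 0 < β) (hβ₁ : β < 1) (hL : 1 ≤ Real.log n) (hn : 0 < n) (hc₁ : 0 < c₁)
    (hoff : ∀ h, InGrid β (β ^ Fintype.card ι) n h → ∀ j ∉ R, |Z h j| < lam h j)
    (hpass : ∀ h, InGrid β (β ^ Fintype.card ι) n h → ∀ j ∈ R, lam h j ≤ |Z h j| →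
      c₁ * (Real.log n ^ a / (n * ∏ k, h k)) ≤ h j ^ (2 * p))
    (hfail : ∀ h, InGrid β (β ^ Fintype.card ι) n h → ∀ j ∈ R, |Z h j| < lam h j →
      h j ^ (2 * p) ≤ c₂ * (Real.log n ^ a / (n * ∏ k, h k)))
    (hsmall : Real.log n ≤ c₂ * Real.log n ^ a)
    (hinit : (c₁ * x) ^ R.card ≤ ((1 / Real.log n) ^ R.card) ^ (2 * p + R.card)) :
    (∀ k ∉ R, loopOutput Z lam β n k = 1 / Real.log n) ∧
    (∀ k, 0 < loopOutput Z lam β n k) ∧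
    (∀ k ∈ R, loopOutput Z lam β n k ^ (2 * p + R.card) ≤ c₂ * x) ∧
    β ^ (R.card * (2 * p + R.card)) * (c₁ * x) ^ R.card ≤
      (∏ k ∈ R, loopOutput Z lam β n k) ^ (2 * p + R.card) := by
  have hL0 : 0 < Real.log n := by linarith
  have hn' : (0 : ℝ) < n := by exact_mod_cast hn
  have hx0 : 0 < x := by rw [hx]; positivity
  have hinv : ∀ t ≤ stopTime Z lam β n,
      LoopInvariant β n p R c₁ c₂ x t (stateAt Z lam β n t) := by
    intro t
    induction t with
    | zero =>
      intro _
      refine ⟨fun k _ => rfl, fun k => by simp [stateAt, initBandwidth],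
        fun k _ => by simp [stateAt, initBandwidth],
        fun k _ hk => absurd (Finset.mem_univ k) hk, ?_⟩
      calc β ^ (R.card * (2 * p + R.card)) * (c₁ * x) ^ R.card ≤ 1 * (c₁ * x) ^ R.card := by
            gcongr; exact pow_le_one₀ hβ₀.le hβ₁.le
        _ ≤ _ := by
            rw [one_mul]
            simpa [stateAt, initBandwidth] using hinit
    | succ t ih =>
      intro ht
      have hc := loopCond_of_lt_stopTime (Z := Z) (lam := lam) (β := β) (n := n)
        (show t < stopTime Z lam β n by omega)
      have hg := inGrid_of_loopCond hβ₀ hβ₁ hL0 hc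
      rw [stateAt_succ]
      exact (ih (by omega)).step hx hβ₀ hβ₁ hL0 hn hc₁ (hoff _ hg) (hpass _ hg) (hfail _ hg)
  have hT := hinv _ le_rfl
  have hend := not_loopCond_stopTime Z lam hβ₀ hβ₁ hL0
  rw [loopOutput_eq]
  set s := stateAt Z lam β n (stopTime Z lam β n) with hs
  refine ⟨hT.off, hT.pos hβ₀ hL0, fun k hk => ?_, hT.prod_ge⟩
  by_cases hks : k ∈ s.2
  · -- the loop was stopped by the condition on the product of the bandwidths
    have hP : ∏ i, s.1 i < Real.log n / n := by
      by_contra! hc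
      exact hend ⟨⟨k, hks⟩, hc⟩
    have hpos := hT.pos hβ₀ hL0
    rw [hT.prod_eq] at hP
    have hP' : ∏ i ∈ R, s.1 i ≤ Real.log n ^ (Fintype.card ι - R.card) * (Real.log n / n) := by
      have : ∏ i ∈ R, s.1 i = Real.log n ^ (Fintype.card ι - R.card) *
          ((1 / Real.log n) ^ (Fintype.card ι - R.card) * ∏ i ∈ R, s.1 i) := by
        rw [← mul_assoc, ← mul_pow, mul_one_div_cancel hL0.ne', one_pow, one_mul]
      rw [this]
      gcongr
    have hk1 : s.1 k ≤ 1 := by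
      rw [hT.active k hks]
      exact mul_le_one₀ (pow_le_one₀ hβ₀.le hβ₁.le) (by positivity)
        (by rw [div_le_one hL0]; exact hL)
    calc s.1 k ^ (2 * p + R.card) = s.1 k ^ (2 * p) * s.1 k ^ R.card := pow_add _ _ _
      _ ≤ 1 * ∏ i ∈ R, s.1 i := by
          have := hpos k
          gcongr
          · exact pow_le_one₀ this.le hk1
          · exact hT.active_pow_le hβ₀ hL0 hks
      _ ≤ Real.log n ^ (Fintype.card ι - R.card) * (Real.log n / n) := by rwa [one_mul]
      _ ≤ Real.log n ^ (Fintype.card ι - R.card) * (c₂ * Real.log n ^ a / n) := by gcongr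
      _ = c₂ * x := by rw [hx]; ring
  · exact hT.inactive k hk hks

end Loop

section LoopMeasurable

variable {Ω : Type*} [MeasurableSpace Ω] {ι : Type*} [DecidableEq ι] [Fintype ι]
  {Z : Ω → (ι → ℝ) → ι → ℝ} {lam : (ι → ℝ) → ι → ℝ} {β : ℝ} {n : ℕ}

theorem measurable_stateAt (hZ : ∀ j, Measurable fun q : Ω × (ι → ℝ) => Z q.1 q.2 j)
    (hlam : ∀ j, Measurable fun h => lam h j) (β : ℝ) (n t : ℕ) :
    Measurable (fun ω => (stateAt (Z ω) lam β n t).1) ∧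
      ∀ j, MeasurableSet {ω | j ∈ (stateAt (Z ω) lam β n t).2} := by
  induction t with
  | zero => exact ⟨measurable_const, fun j => by simp [stateAt]⟩
  | succ t ih =>
    obtain ⟨h1, h2⟩ := ih
    have hpass : ∀ j, MeasurableSet {ω | lam (stateAt (Z ω) lam β n t).1 j ≤
        |Z ω (stateAt (Z ω) lam β n t).1 j|} := fun j =>
      measurableSet_le ((hlam j).comp h1) ((hZ j).comp (measurable_id.prodMk h1)).abs
    simp only [stateAt_succ]
    constructor
    · refine measurable_pi_lambda _ fun j => ?_
      simp only [step]
      exact Measurable.ite ((h2 j).inter (hpass j))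
        (((measurable_pi_apply j).comp h1).const_mul β) ((measurable_pi_apply j).comp h1)
    · intro j
      simp only [step, Finset.mem_filter]
      exact (h2 j).inter (hpass j)

theorem measurable_loopOutput (hZ : ∀ j, Measurable fun q : Ω × (ι → ℝ) => Z q.1 q.2 j)
    (hlam : ∀ j, Measurable fun h => lam h j) (hβ₀ : 0 < β) (hβ₁ : β < 1)
    (hL : 0 < Real.log n) : Measurable fun ω => loopOutput (Z ω) lam β n := by
  have hcond : ∀ t, MeasurableSet {ω | loopCond n (stateAt (Z ω) lam β n t)} := by
    intro t
    obtain ⟨h1, h2⟩ := measurable_stateAt hZ hlam β n t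
    refine MeasurableSet.inter (s₁ := {ω | (stateAt (Z ω) lam β n t).2.Nonempty}) ?_ ?_
    · have : {ω | (stateAt (Z ω) lam β n t).2.Nonempty} =
          ⋃ j, {ω | j ∈ (stateAt (Z ω) lam β n t).2} := by
        ext ω; simp [Finset.Nonempty]
      rw [this]
      exact MeasurableSet.iUnion h2
    · exact measurableSet_le measurable_const
        (Finset.measurable_fun_prod _ fun j _ => (measurable_pi_apply j).comp h1)
  have hend : ∀ t, MeasurableSet {ω | stopTime (Z ω) lam β n = t} := by
    intro t
    have : {ω | stopTime (Z ω) lam β n = t} =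
        {ω | loopCond n (stateAt (Z ω) lam β n t)}ᶜ ∩
          ⋂ s : Fin t, {ω | loopCond n (stateAt (Z ω) lam β n s)} := by
      ext ω
      simp only [Set.mem_ofPred_eq, Set.mem_inter_iff, Set.mem_compl_iff, Set.mem_iInter]
      constructor
      · rintro rfl
        exact ⟨not_loopCond_stopTime _ _ hβ₀ hβ₁ hL, fun s => loopCond_of_lt_stopTime s.2⟩
      · rintro ⟨h1, h2⟩
        refine le_antisymm (Nat.sInf_le h1) ?_
        by_contra! hlt
        exact not_loopCond_stopTime (Z ω) lam hβ₀ hβ₁ hL (h2 ⟨_, hlt⟩)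
    rw [this]
    exact (hcond t).compl.inter (MeasurableSet.iInter fun s => hcond s)
  intro S hS
  have : (fun ω => loopOutput (Z ω) lam β n) ⁻¹' S =
      ⋃ t, {ω | stopTime (Z ω) lam β n = t} ∩
        (fun ω => (stateAt (Z ω) lam β n t).1) ⁻¹' S := by
    ext ω
    simp [loopOutput_eq]
  rw [this]
  exact MeasurableSet.iUnion fun t => (hend t).inter ((measurable_stateAt hZ hlam β n t).1 hS)

end LoopMeasurable

/-! ### Local regularity and lower bounds near the point of interest -/

section Local

variable {ι : Type*} [Fintype ι] {K : ℝ → ℝ} {p : ℕ}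

theorem nbhd_mem_nhds (hK : IsKernelOfOrder K p) {τ : ℝ} (hτ : 0 < τ) (w : ι → ℝ) :
    nbhd K (fun _ => τ) w ∈ 𝓝 w := by
  obtain ⟨r, hr, hsub⟩ := Metric.mem_nhds_iff.1 hK.tsupport_mem_nhds
  refine Filter.mem_of_superset (Metric.ball_mem_nhds w (mul_pos hτ hr)) fun u hu => ?_
  rw [Metric.mem_ball, dist_pi_lt_iff (mul_pos hτ hr)] at hu
  refine ⟨fun k => (w k - u k) / τ, fun k => hsub ?_, fun k => by field_simp; ring⟩
  rw [Metric.mem_ball, dist_zero_right, Real.norm_eq_abs, abs_div, abs_of_pos hτ, div_lt_iff₀ hτ,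
    abs_sub_comm, mul_comm]
  exact hu k

theorem self_mem_nbhd {ι : Type*} (hK : IsKernelOfOrder K p) (τ : ℝ) (w : ι → ℝ) :
    w ∈ nbhd K (fun _ => τ) w :=
  ⟨fun _ => 0, fun _ => hK.zero_mem, fun k => by simp⟩

theorem nbhd_mono {ι : Type*} (hK : IsKernelOfOrder K p) {σ τ : ℝ} (hσ : 0 < σ) (hστ : σ ≤ τ)
    (w : ι → ℝ) : nbhd K (fun _ => σ) w ⊆ nbhd K (fun _ => τ) w := by
  rintro u ⟨z, hz, hu⟩
  have := hK.mem_nbhd (w := w) (hσ.trans_le hστ) (fun _ : ι => hσ.le) (fun _ => hστ) hz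
  convert this using 1
  funext k; exact hu k

theorem tendsto_inv_log_nat : Tendsto (fun n : ℕ => 1 / Real.log n) atTop (𝓝 0) := by
  simp only [one_div]
  exact tendsto_log_nat.inv_tendsto_atTop

theorem contDiffAt_of_eventually (hK : IsKernelOfOrder K p) {f : (ι → ℝ) → ℝ} {w : ι → ℝ}
    (hreg : ∀ᶠ n : ℕ in atTop, ContDiffOn ℝ p f (nbhdN K n w)) : ContDiffAt ℝ p f w := by
  obtain ⟨n, hn, hL⟩ := (hreg.and (tendsto_log_nat.eventually_gt_atTop 0)).exists
  exact hn.contDiffAt (nbhd_mem_nhds hK (one_div_pos.2 hL) w)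

theorem eventually_nbhd_of_eventually_nhds (hK : IsKernelOfOrder K p) {w : ι → ℝ}
    {P : (ι → ℝ) → Prop} (hP : ∀ᶠ u in 𝓝 w, P u) :
    ∃ ρ > 0, (∀ u : ι → ℝ, (∀ k, |u k - w k| < ρ) → P u) ∧
      ∀ᶠ n : ℕ in atTop, (∀ t ∈ tsupport K, |1 / Real.log n * t| < ρ) ∧
        ∀ u ∈ nbhdN K n w, P u := by
  obtain ⟨ρ, hρ, hball⟩ := Metric.eventually_nhds_iff.1 hP
  have hball' : ∀ u : ι → ℝ, (∀ k, |u k - w k| < ρ) → P u := fun u hu =>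
    hball ((dist_pi_lt_iff hρ).2 hu)
  obtain ⟨A, hA⟩ := hK.hasCompactSupport.isBounded.exists_norm_le
  have hlim : Tendsto (fun n : ℕ => 1 / Real.log n * A) atTop (𝓝 0) := by
    simpa using tendsto_inv_log_nat.mul_const A
  refine ⟨ρ, hρ, hball', ?_⟩
  filter_upwards [hlim.eventually (gt_mem_nhds hρ), tendsto_log_nat.eventually_gt_atTop 0]
    with n hn hL
  have hsmall : ∀ t ∈ tsupport K, |1 / Real.log n * t| < ρ := fun t ht => by
    refine lt_of_le_of_lt ?_ hn
    rw [abs_mul, abs_of_pos (by positivity)]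
    exact mul_le_mul_of_nonneg_left (hA t ht) (by positivity)
  refine ⟨hsmall, fun u hu => hball' u fun k => ?_⟩
  obtain ⟨z, hz, hu⟩ := hu
  rw [hu k, sub_sub_cancel_left, abs_neg]
  exact hsmall _ (hz k)

theorem eventually_isRegularNear [DecidableEq ι] (hK : IsKernelOfOrder K p) {f : (ι → ℝ) → ℝ}
    {w : ι → ℝ} {R : Finset ι}
    (hsparse : ∀ᶠ n : ℕ in atTop, ∀ u ∈ nbhdN K n w, ∀ v ∈ nbhdN K n w,
      (∀ j ∈ R, u j = v j) → f u = f v)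
    (hreg : ∀ᶠ n : ℕ in atTop, ContDiffOn ℝ p f (nbhdN K n w)) {η : ℝ} (hη : 0 < η) :
    ∃ ρ B : ℝ, ∀ᶠ n : ℕ in atTop, IsRegularNear K p f w R (1 / Real.log n) ρ B η := by
  have hcd := contDiffAt_of_eventually hK hreg
  have h1 : ∀ᶠ u in 𝓝 w, ContDiffAt ℝ p f u := hcd.eventually (by simp)
  have h2 : ∀ᶠ u in 𝓝 w, ∀ j ∈ R, |partialD p j f u - partialD p j f w| ≤ η := by
    refine (Finset.eventually_all R).2 fun j _ => ?_
    have := (continuousAt_partialD (j := j) hcd).eventually (Metric.ball_mem_nhds _ hη)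
    exact this.mono fun u hu => (Metric.mem_ball.1 hu).le
  have h3 : ∀ᶠ u in 𝓝 w, |f u| ≤ |f w| + 1 := by
    have := hcd.continuousAt.abs.eventually (gt_mem_nhds (show |f w| < |f w| + 1 by linarith))
    exact this.mono fun u hu => hu.le
  obtain ⟨ρ, -, hball, hev⟩ := eventually_nbhd_of_eventually_nhds hK (h1.and (h2.and h3))
  refine ⟨ρ, |f w| + 1, ?_⟩
  filter_upwards [hev, hsparse] with n hn hs
  exact ⟨fun u hu => (hball u hu).1, fun u hu => (hball u hu).2.1, fun u hu => (hball u hu).2.2,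
    hn.1, hs⟩

end Local

theorem eventually_le_density {d : ℕ} {K : ℝ → ℝ} {p : ℕ} (hK : IsKernelOfOrder K p)
    {fX : (Fin d → ℝ) → ℝ} (hfX : ∀ u, 0 ≤ fX u) {x : Fin d → ℝ}
    (hδ : ∀ᶠ n : ℕ in atTop, 0 < infDensity K n fX x) :
    ∃ δ > 0, ∀ᶠ n : ℕ in atTop, ∀ u ∈ nbhd K (fun _ => 1 / Real.log n) x, δ ≤ fX u := by
  obtain ⟨m, hm, hL⟩ := (hδ.and (tendsto_log_nat.eventually_gt_atTop 0)).exists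
  refine ⟨_, hm, ?_⟩
  filter_upwards [tendsto_log_nat.eventually_ge_atTop (Real.log m)] with n hn u hu
  refine csInf_le ⟨0, ?_⟩ ⟨u, ?_, rfl⟩
  · rintro _ ⟨v, -, rfl⟩; exact hfX v
  · exact nbhd_mono hK (by have := hL.trans_le hn; positivity)
      (one_div_le_one_div_of_le hL hn) x hu

/-! ### The error of the selected estimator when all deviations are small -/

section GoodEvent

variable {d₁ d₂ : ℕ} {K : ℝ → ℝ} {p : ℕ} {f : (Fin d₁ ⊕ Fin d₂ → ℝ) → ℝ}
  {w : Fin d₁ ⊕ Fin d₂ → ℝ} {R : Finset (Fin d₁ ⊕ Fin d₂)} {ρ B η : ℝ}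

theorem threshold_eq (K : ℝ → ℝ) (a : ℝ) (n : ℕ) {h : Fin d₁ ⊕ Fin d₂ → ℝ}
    {j : Fin d₁ ⊕ Fin d₂} (hj : 0 < h j) :
    threshold K a n h j = 1 / h j *
      (constLambda K (d₁ + d₂) * Real.sqrt (Real.log n ^ a / (n * ∏ k, h k))) := by
  unfold threshold
  have : Real.log n ^ a / ((n : ℝ) * h j ^ 2 * ∏ k, h k) =
      (1 / h j) ^ 2 * (Real.log n ^ a / (n * ∏ k, h k)) := by
    field_simp
  rw [this, Real.sqrt_mul (by positivity), Real.sqrt_sq (by positivity)]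
  ring

theorem threshold_le_abs_statZ_iff (K : ℝ → ℝ) (a : ℝ) (n : ℕ) (g : (Fin d₁ → ℝ) → ℝ)
    (W : ℕ → Fin d₁ ⊕ Fin d₂ → ℝ) (w : Fin d₁ ⊕ Fin d₂ → ℝ) {h : Fin d₁ ⊕ Fin d₂ → ℝ}
    {j : Fin d₁ ⊕ Fin d₂} (hj : 0 < h j) :
    threshold K a n h j ≤ |statZ K n g W w h j| ↔
      constLambda K (d₁ + d₂) * Real.sqrt (Real.log n ^ a / (n * ∏ k, h k)) ≤
        |kernelEstWith (kernelsJ K j) n g W w h| := by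
  rw [threshold_eq K a n hj, statZ_eq K n g W w h j hj.ne', abs_mul, abs_neg,
    abs_of_pos (one_div_pos.2 hj)]
  exact mul_le_mul_iff_right₀ (one_div_pos.2 hj)

/-- The constant in the leading term of the mean of `h_j Z_{hj}`. -/
noncomputable def signal (K : ℝ → ℝ) (p : ℕ) (f : (Fin d₁ ⊕ Fin d₂ → ℝ) → ℝ)
    (w : Fin d₁ ⊕ Fin d₂ → ℝ) (j : Fin d₁ ⊕ Fin d₂) : ℝ :=
  |partialD p j f w| * |∫ t, t ^ p * K t| / ((p - 1).factorial : ℝ)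

/-- The factor by which the other coordinates enlarge the remainder of an expansion in one
coordinate. -/
noncomputable def absMassPow (K : ℝ → ℝ) (d : ℕ) : ℝ := (∫ t in tsupport K, |K t|) ^ (d - 1)

theorem prod_erase_absMass (K : ℝ → ℝ) (j : Fin d₁ ⊕ Fin d₂) :
    ∏ _k ∈ Finset.univ.erase j, ∫ t in tsupport K, |K t| = absMassPow K (d₁ + d₂) := by
  rw [Finset.prod_const, Finset.card_erase_of_mem (Finset.mem_univ j), Finset.card_univ]
  simp [absMassPow]

/-- In a relevant coordinate, the mean of `h_j Z_{hj}` is of exact order `h_j ^ p`. -/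
theorem abs_kernelMean_kernelsJ_bounds (hK : IsKernelOfOrder K p)
    {τ : ℝ} (hreg : IsRegularNear K p f w R τ ρ B η) (hp : 1 ≤ p) (hf : Measurable f)
    {j : Fin d₁ ⊕ Fin d₂} (hj : j ∈ R) {h : Fin d₁ ⊕ Fin d₂ → ℝ} (hh : ∀ k, 0 ≤ h k)
    (hhτ : ∀ k, h k ≤ τ) {b : ℝ} (hb : b ≤ signal K p f w j)
    (hη : η * ((∫ t, |t ^ p * J K t|) / (p.factorial : ℝ) * absMassPow K (d₁ + d₂)) ≤ b / 4) :
    3 / 4 * signal K p f w j * h j ^ p ≤ |kernelMean K (kernelsJ K j) f w h| ∧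
      |kernelMean K (kernelsJ K j) f w h| ≤ 5 / 4 * signal K p f w j * h j ^ p := by
  have h1 := abs_kernelMean_kernelsJ_sub_le hK hreg hp hf hj hh hhτ
  rw [prod_erase_absMass] at h1
  have h2 : |partialD p j f w * (-h j) ^ p / (p.factorial : ℝ) * ∫ t, t ^ p * J K t| =
      signal K p f w j * h j ^ p := by
    rw [hK.integral_pow_mul_J, abs_mul, abs_div, abs_mul, abs_mul, abs_pow, abs_neg, abs_neg,
      abs_of_nonneg (hh j), Nat.abs_cast, Nat.abs_cast, signal]
    have : (p.factorial : ℝ) = p * ((p - 1).factorial : ℝ) := by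
      rw [← Nat.mul_factorial_pred (by omega : p ≠ 0)]; push_cast; ring
    have hp0 : (p : ℝ) ≠ 0 := by positivity
    rw [this]
    field_simp
  have h3 : η * h j ^ p / (p.factorial : ℝ) * (∫ t, |t ^ p * J K t|) * absMassPow K (d₁ + d₂) ≤
      signal K p f w j / 4 * h j ^ p := by
    calc _ = η * ((∫ t, |t ^ p * J K t|) / (p.factorial : ℝ) * absMassPow K (d₁ + d₂)) *
          h j ^ p := by ring
      _ ≤ b / 4 * h j ^ p := by have := hh j; gcongr
      _ ≤ _ := by have := hh j; gcongr
  have h4 := abs_sub_abs_le_abs_sub (kernelMean K (kernelsJ K j) f w h)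
    (partialD p j f w * (-h j) ^ p / (p.factorial : ℝ) * ∫ t, t ^ p * J K t)
  have h5 := abs_sub_abs_le_abs_sub
    (partialD p j f w * (-h j) ^ p / (p.factorial : ℝ) * ∫ t, t ^ p * J K t)
    (kernelMean K (kernelsJ K j) f w h)
  rw [abs_sub_comm] at h5
  rw [h2] at h4 h5
  constructor <;> linarith

/-- The bias `h ^ p` when `h ^ (2 p + r) ≤ y`. -/
theorem pow_le_rpow_of_pow_le {h y : ℝ} (hh : 0 ≤ h) {p r : ℕ} (hp : 1 ≤ p)
    (hy : h ^ (2 * p + r) ≤ y) : h ^ p ≤ y ^ ((p : ℝ) / (2 * p + r)) := by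
  have hpr : (0 : ℝ) < 2 * p + r := by positivity
  calc h ^ p = (h ^ (2 * p + r)) ^ ((p : ℝ) / (2 * p + r)) := by
        rw [← Real.rpow_natCast h (2 * p + r), ← Real.rpow_mul hh, ← Real.rpow_natCast]
        congr 1
        push_cast
        field_simp
    _ ≤ _ := by gcongr

/-- The standard deviation `√(x / Π)` when `Π ^ (2 p + r)` is at least of order `x ^ r`. -/
theorem sqrt_div_le {x Q c : ℝ} (hx : 0 < x) (hQ : 0 < Q) (hc : 0 < c) {p r : ℕ} (hp : 1 ≤ p)
    (h : c * x ^ r ≤ Q ^ (2 * p + r)) :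
    Real.sqrt (x / Q) ≤ c ^ (-(1 / (2 * (2 * p + r) : ℝ))) * x ^ ((p : ℝ) / (2 * p + r)) := by
  have hpr : (0 : ℝ) < 2 * p + r := by positivity
  have hexp : (0 : ℝ) ≤ 1 / (2 * p + r) := by positivity
  have h1 : (c * x ^ r) ^ (1 / (2 * p + r) : ℝ) ≤ Q := by
    calc (c * x ^ r) ^ (1 / (2 * p + r) : ℝ) ≤ (Q ^ (2 * p + r)) ^ (1 / (2 * p + r) : ℝ) := by
          gcongr
      _ = Q := by
          rw [← Real.rpow_natCast, ← Real.rpow_mul hQ.le]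
          push_cast
          rw [mul_one_div_cancel hpr.ne', Real.rpow_one]
  have h2 : x / Q ≤ x / (c * x ^ r) ^ (1 / (2 * p + r) : ℝ) := by gcongr
  refine (Real.sqrt_le_sqrt h2).trans (le_of_eq ?_)
  rw [Real.mul_rpow hc.le (by positivity), ← Real.rpow_natCast, ← Real.rpow_mul hx.le,
    Real.sqrt_eq_rpow, div_eq_mul_inv, mul_inv, ← Real.rpow_neg hc.le, ← Real.rpow_neg hx.le,
    mul_left_comm, ← Real.rpow_one_add' hx.le, Real.mul_rpow (by positivity) (by positivity),
    ← Real.rpow_mul hc.le, ← Real.rpow_mul hx.le]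
  · congr 2
    · field_simp
    · field_simp; ring
  · have : 1 + -((r : ℝ) * (1 / (2 * p + r))) = 2 * p / (2 * p + r) := by field_simp; ring
    rw [this]
    positivity

/-- On the event that all estimators on the grid are within `ε √((log n)^a / (n ∏ h))` of their
means, every test of the loop is correct, and the selected bandwidth balances bias and deviation
at the order `x ^ (p / (2 p + r))`. The first term is the bias, the second one the deviation. -/
theorem abs_cdRodeo_sub_le (hK : IsKernelOfOrder K p) (hp : 1 ≤ p) (hf : Measurable f)
    {n : ℕ} (hn : 0 < n) (hL : 1 ≤ Real.log n)
    (hreg : IsRegularNear K p f w R (1 / Real.log n) ρ B η)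
    {β a : ℝ} (hβ₀ : 0 < β) (hβ₁ : β < 1) {g : (Fin d₁ → ℝ) → ℝ}
    {W : ℕ → Fin d₁ ⊕ Fin d₂ → ℝ} {ε : ℝ}
    (hε₁ : ε ≤ constLambda K (d₁ + d₂) / 4)
    (hgood : ∀ h, InGrid β (β ^ (d₁ + d₂)) n h → ∀ i : Option (Fin d₁ ⊕ Fin d₂),
      |kernelEstWith (kernelFamily K i) n g W w h - kernelMean K (kernelFamily K i) f w h| ≤
        ε * Real.sqrt (Real.log n ^ a / (n * ∏ k, h k)))
    {b b' : ℝ} (hb : 0 < b) (hb' : 0 < b') (hbR : ∀ j ∈ R, b ≤ signal K p f w j)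
    (hbR' : ∀ j ∈ R, signal K p f w j ≤ b')
    (hη : η * ((∫ t, |t ^ p * J K t|) / (p.factorial : ℝ) * absMassPow K (d₁ + d₂)) ≤ b / 4)
    {c₁ c₂ x : ℝ} (hc₁ : c₁ = (3 * constLambda K (d₁ + d₂) / (5 * b')) ^ 2)
    (hc₂ : (4 * constLambda K (d₁ + d₂) / b) ^ 2 ≤ c₂)
    (hx : x = Real.log n ^ a * Real.log n ^ (d₁ + d₂ - R.card) / n)
    (hsmall : Real.log n ≤ c₂ * Real.log n ^ a)
    (hinit : Real.log n / n ≤ (1 / Real.log n) ^ (d₁ + d₂))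
    (hinit' : (c₁ * x) ^ R.card ≤ ((1 / Real.log n) ^ R.card) ^ (2 * p + R.card)) :
    |cdRodeo K a β n g W w - f w| ≤
      (∑ j ∈ R, (|partialD p j f w| / (p.factorial : ℝ) * |∫ t, t ^ p * K t| +
        η * ((∫ t, |t ^ p * K t|) / (p.factorial : ℝ) * absMassPow K (d₁ + d₂)))) *
        (c₂ * x) ^ ((p : ℝ) / (2 * p + R.card)) +
      ε * ((β ^ (R.card * (2 * p + R.card)) * c₁ ^ R.card) ^
        (-(1 / (2 * (2 * p + R.card) : ℝ))) * x ^ ((p : ℝ) / (2 * p + R.card))) := by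
  have hL0 : 0 < Real.log n := by linarith
  have hn' : (0 : ℝ) < n := by exact_mod_cast hn
  have hcard : Fintype.card (Fin d₁ ⊕ Fin d₂) = d₁ + d₂ := by simp
  set Cl := constLambda K (d₁ + d₂) with hCl
  have hCl0 : 0 < Cl := hK.constLambda_pos hp _
  have hx0 : 0 < x := by rw [hx]; positivity
  have hc₁0 : 0 < c₁ := by rw [hc₁]; positivity
  have hc₂0 : 0 < c₂ := lt_of_lt_of_le (by positivity) hc₂
  have hτ : 0 < 1 / Real.log n := by positivity
  have hgrid : ∀ h : Fin d₁ ⊕ Fin d₂ → ℝ, InGrid β (β ^ (d₁ + d₂)) n h →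
      (∀ k, 0 < h k) ∧ (∀ k, h k ≤ 1 / Real.log n) ∧
      0 < Real.sqrt (Real.log n ^ a / (n * ∏ k, h k)) := fun h hh => by
    have h0 : 0 < ∏ k, h k := Finset.prod_pos fun k _ => hh.pos hβ₀ hL0 k
    exact ⟨hh.pos hβ₀ hL0, hh.le_init hβ₀ hβ₁ hL0, Real.sqrt_pos.2 (by positivity)⟩
  have hbounds := loopOutput_bounds (Z := statZ K n g W w) (lam := threshold K a n) (β := β)
    (n := n) (p := p) (R := R) (c₁ := c₁) (c₂ := c₂) (x := x) (a := a) (by rwa [hcard])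
    hβ₀ hβ₁ hL hn hc₁0
    (fun h hh j hj => by
      rw [hcard] at hh
      obtain ⟨h1, h2, h3⟩ := hgrid h hh
      rw [← not_le, threshold_le_abs_statZ_iff K a n g W w (h1 j), not_le]
      have h4 := hgood h hh (some j)
      simp only [kernelFamily] at h4
      rw [kernelMean_kernelsJ_of_notMem hK hreg hτ hf hj (fun k => (h1 k).le) h2, sub_zero] at h4
      nlinarith)
    (fun h hh j hj hpass => by
      rw [hcard] at hh
      obtain ⟨h1, h2, h3⟩ := hgrid h hh
      rw [threshold_le_abs_statZ_iff K a n g W w (h1 j)] at hpass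
      have h4 := hgood h hh (some j)
      simp only [kernelFamily] at h4
      have h5 := (abs_kernelMean_kernelsJ_bounds hK hreg hp hf hj (fun k => (h1 k).le) h2
        (hbR j hj) hη).2
      have h6 := abs_sub_abs_le_abs_sub (kernelEstWith (kernelsJ K j) n g W w h)
        (kernelMean K (kernelsJ K j) f w h)
      have hpow : 0 < h j ^ p := pow_pos (h1 j) p
      have h7 : 3 * Cl / (5 * b') * Real.sqrt (Real.log n ^ a / (n * ∏ k, h k)) ≤ h j ^ p := by
        rw [div_mul_eq_mul_div, div_le_iff₀ (by positivity)]
        have h8 := mul_le_mul_of_nonneg_right (hbR' j hj) hpow.le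
        nlinarith
      have h0 : 0 ≤ Real.log n ^ a / (n * ∏ k, h k) := (Real.sqrt_pos.1 h3).le
      calc c₁ * (Real.log n ^ a / (n * ∏ k, h k)) =
            (3 * Cl / (5 * b') * Real.sqrt (Real.log n ^ a / (n * ∏ k, h k))) ^ 2 := by
            rw [mul_pow, Real.sq_sqrt h0, hc₁]
        _ ≤ (h j ^ p) ^ 2 := by gcongr
        _ = _ := by rw [← pow_mul, mul_comm])
    (fun h hh j hj hfail => by
      rw [hcard] at hh
      obtain ⟨h1, h2, h3⟩ := hgrid h hh
      rw [← not_le, threshold_le_abs_statZ_iff K a n g W w (h1 j), not_le] at hfail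
      have h4 := hgood h hh (some j)
      simp only [kernelFamily] at h4
      have h5 := (abs_kernelMean_kernelsJ_bounds hK hreg hp hf hj (fun k => (h1 k).le) h2
        (hbR j hj) hη).1
      have h6 := abs_sub_abs_le_abs_sub (kernelMean K (kernelsJ K j) f w h)
        (kernelEstWith (kernelsJ K j) n g W w h)
      rw [abs_sub_comm] at h6
      have hpow : 0 < h j ^ p := pow_pos (h1 j) p
      have h7 : h j ^ p ≤ 4 * Cl / b * Real.sqrt (Real.log n ^ a / (n * ∏ k, h k)) := by
        rw [div_mul_eq_mul_div, le_div_iff₀ (by positivity)]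
        have h8 := mul_le_mul_of_nonneg_right (hbR j hj) hpow.le
        nlinarith
      have h0 : 0 ≤ Real.log n ^ a / (n * ∏ k, h k) := (Real.sqrt_pos.1 h3).le
      calc h j ^ (2 * p) = (h j ^ p) ^ 2 := by rw [← pow_mul, mul_comm]
        _ ≤ (4 * Cl / b * Real.sqrt (Real.log n ^ a / (n * ∏ k, h k))) ^ 2 := by gcongr
        _ = (4 * Cl / b) ^ 2 * (Real.log n ^ a / (n * ∏ k, h k)) := by
            rw [mul_pow, Real.sq_sqrt h0]
        _ ≤ _ := by gcongr)
    hsmall hinit'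
  obtain ⟨hoff, hpos, hB, hC⟩ := hbounds
  have hout := inGrid_loopOutput (statZ K n g W w) (threshold K a n) hβ₀ hβ₁ hL0
    (by rwa [hcard])
  rw [hcard] at hout
  change |kernelEst K n g W w (loopOutput (statZ K n g W w) (threshold K a n) β n) - f w| ≤ _
  set h := loopOutput (statZ K n g W w) (threshold K a n) β n with hh
  obtain ⟨h1, h2, h3⟩ := hgrid h hout
  have hdev := hgood h hout none
  simp only [kernelFamily] at hdev
  have hbias := abs_kernelMean_sub_le hK hreg hp hτ hf (fun k => (h1 k).le) h2
  have hQ : 0 < ∏ k ∈ R, h k := Finset.prod_pos fun k _ => h1 k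
  have hprod : ∏ k, h k = (1 / Real.log n) ^ (d₁ + d₂ - R.card) * ∏ k ∈ R, h k := by
    rw [← Finset.prod_compl_mul_prod R, Finset.prod_congr rfl fun k hk =>
      hoff k (Finset.mem_compl.1 hk), Finset.prod_const, Finset.card_compl, hcard]
  have hvar : Real.log n ^ a / (n * ∏ k, h k) = x / ∏ k ∈ R, h k := by
    rw [hprod, hx, one_div, inv_pow]
    field_simp
  rw [hvar] at hdev
  have hsd := sqrt_div_le (p := p) (r := R.card) hx0 hQ
    (show 0 < β ^ (R.card * (2 * p + R.card)) * c₁ ^ R.card by positivity) hp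
    (by rw [mul_assoc, ← mul_pow]; exact hC)
  have hbias' : ∑ j ∈ R, (|partialD p j f w| * h j ^ p / (p.factorial : ℝ) * |∫ t, t ^ p * K t| +
        η * h j ^ p / (p.factorial : ℝ) * (∫ t, |t ^ p * K t|) *
          ∏ _k ∈ Finset.univ.erase j, ∫ t in tsupport K, |K t|) ≤
      (∑ j ∈ R, (|partialD p j f w| / (p.factorial : ℝ) * |∫ t, t ^ p * K t| +
        η * ((∫ t, |t ^ p * K t|) / (p.factorial : ℝ) * absMassPow K (d₁ + d₂)))) *
        (c₂ * x) ^ ((p : ℝ) / (2 * p + R.card)) := by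
    rw [Finset.sum_mul]
    refine Finset.sum_le_sum fun j hj => ?_
    rw [prod_erase_absMass]
    have hη0 : 0 ≤ η := (abs_nonneg _).trans (hreg.partialD w
      (fun k => by simpa using hreg.dist_lt le_rfl hτ.le hK.zero_mem) j hj)
    have hmass : 0 ≤ absMassPow K (d₁ + d₂) :=
      pow_nonneg (integral_nonneg fun _ => abs_nonneg _) _
    have hI : 0 ≤ ∫ t, |t ^ p * K t| := integral_nonneg fun _ => abs_nonneg _
    calc _ = (|partialD p j f w| / (p.factorial : ℝ) * |∫ t, t ^ p * K t| +
        η * ((∫ t, |t ^ p * K t|) / (p.factorial : ℝ) * absMassPow K (d₁ + d₂))) * h j ^ p := by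
          ring
      _ ≤ _ := by
          gcongr
          exact pow_le_rpow_of_pow_le (h1 j).le hp (hB j hj)
  have hε₂ : 0 ≤ ε := by
    by_contra! hneg
    have hs := Real.sqrt_pos.2 (show 0 < x / ∏ k ∈ R, h k by positivity)
    have := (abs_nonneg _).trans hdev
    nlinarith
  have hdev' := hdev.trans (mul_le_mul_of_nonneg_left hsd hε₂)
  rw [kernelEst_eq]
  calc _ ≤ |kernelEstWith (fun _ => K) n g W w h - kernelMean K (fun _ => K) f w h| +
        |kernelMean K (fun _ => K) f w h - f w| := abs_sub_le _ _ _
    _ ≤ _ := by linarith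

end GoodEvent

/-! ### Measurability and crude bounds for the selected estimator -/

section Measurability

variable {Ω : Type*} [MeasurableSpace Ω] {d₁ d₂ : ℕ} {W : ℕ → Ω → Fin d₁ ⊕ Fin d₂ → ℝ}
  {K : ℝ → ℝ} {p : ℕ} {g : Ω → (Fin d₁ → ℝ) → ℝ}

theorem measurable_cdRodeo (hW : ∀ i, Measurable (W i)) (hK : IsKernelOfOrder K p)
    (hg : Measurable fun z : Ω × (Fin d₁ → ℝ) => g z.1 z.2) (a : ℝ) {β : ℝ} (hβ₀ : 0 < β)
    (hβ₁ : β < 1) {n : ℕ} (hL : 0 < Real.log n) (w : Fin d₁ ⊕ Fin d₂ → ℝ) :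
    Measurable fun ω => cdRodeo K a β n (g ω) (fun i => W i ω) w := by
  have hKm : Measurable K := hK.continuous.measurable
  have hJm : Measurable (J K) := hK.continuous_J.measurable
  have hgW : ∀ i, Measurable fun q : Ω × (Fin d₁ ⊕ Fin d₂ → ℝ) => g q.1 (fstPart (W i q.1)) :=
    fun i => (hg.comp (measurable_id.prodMk (measurable_fstPart.comp (hW i)))).comp measurable_fst
  have hh : ∀ k, Measurable fun q : Ω × (Fin d₁ ⊕ Fin d₂ → ℝ) => q.2 k := fun k =>
    (measurable_pi_apply k).comp measurable_snd
  have harg : ∀ i k, Measurable fun q : Ω × (Fin d₁ ⊕ Fin d₂ → ℝ) =>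
      (w k - W i q.1 k) / q.2 k := fun i k =>
    (measurable_const.sub (((measurable_pi_apply k).comp (hW i)).comp measurable_fst)).div (hh k)
  have hZ : ∀ j, Measurable fun q : Ω × (Fin d₁ ⊕ Fin d₂ → ℝ) =>
      statZ K n (g q.1) (fun i => W i q.1) w q.2 j := by
    intro j
    unfold statZ
    refine (measurable_const.div (((hh j).pow_const 2).const_mul _)).mul
      (Finset.measurable_fun_sum _ fun i _ => ?_)
    refine ((measurable_const.div (hgW i)).mul (hJm.comp (harg i j))).mul
      (Finset.measurable_fun_prod _ fun k _ => ?_)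
    exact (hh k).inv.mul (hKm.comp (harg i k))
  have hlam : ∀ j, Measurable fun h : Fin d₁ ⊕ Fin d₂ → ℝ => threshold K a n h j := by
    intro j
    unfold threshold
    have : Measurable fun h : Fin d₁ ⊕ Fin d₂ → ℝ => ∏ k, h k :=
      Finset.measurable_fun_prod _ fun k _ => measurable_pi_apply k
    fun_prop
  have hE : Measurable fun q : Ω × (Fin d₁ ⊕ Fin d₂ → ℝ) =>
      kernelEst K n (g q.1) (fun i => W i q.1) w q.2 := by
    unfold kernelEst
    refine measurable_const.mul (Finset.measurable_fun_sum _ fun i _ => ?_)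
    refine (measurable_const.div (hgW i)).mul (Finset.measurable_fun_prod _ fun k _ => ?_)
    exact (hh k).inv.mul (hKm.comp (harg i k))
  exact hE.comp (measurable_id.prodMk
    (measurable_loopOutput (Z := fun ω => statZ K n (g ω) (fun i => W i ω) w) hZ hlam hβ₀ hβ₁ hL))

end Measurability

theorem abs_kernelEstWith_le {d₁ d₂ : ℕ} {K : ℝ → ℝ} {p : ℕ} (hK : IsKernelOfOrder K p)
    {G : Fin d₁ ⊕ Fin d₂ → ℝ → ℝ} (hGK : ∀ k, ∀ t ∉ tsupport K, G k t = 0) {c : ℝ} (hc : 0 ≤ c)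
    (hGc : ∀ k t, |G k t| ≤ c) {n : ℕ} (hn : 0 < n) {g : (Fin d₁ → ℝ) → ℝ}
    (W : ℕ → Fin d₁ ⊕ Fin d₂ → ℝ) {w h : Fin d₁ ⊕ Fin d₂ → ℝ} {τ m : ℝ} (hτ : 0 < τ) (hm : 0 < m)
    (hh : ∀ k, 0 < h k) (hhτ : ∀ k, h k ≤ τ)
    (hg : ∀ x ∈ nbhd K (fun _ => τ) (fstPart w), m ≤ g x) :
    |kernelEstWith G n g W w h| ≤ 1 / m * (c ^ (d₁ + d₂) / ∏ k, h k) := by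
  have hn' : (0 : ℝ) < n := by exact_mod_cast hn
  have hP : 0 < ∏ k, h k := Finset.prod_pos fun k _ => hh k
  unfold kernelEstWith
  rw [abs_mul, abs_of_pos (by positivity), one_div_mul_eq_div, div_le_iff₀ hn']
  refine (Finset.abs_sum_le_sum_abs _ _).trans ?_
  calc ∑ i ∈ Finset.range n, |1 / g (fstPart (W i)) * kernelWeight G w h (W i)|
      ≤ ∑ _i ∈ Finset.range n, 1 / m * (c ^ (d₁ + d₂) / ∏ k, h k) := by
        refine Finset.sum_le_sum fun i _ => ?_
        by_cases hu : kernelWeight G w h (W i) = 0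
        · rw [hu, mul_zero, abs_zero]; positivity
        · have h1 := hg _ (fstPart_mem_nbhd
            (mem_nbhd_of_kernelWeight_ne_zero hK hGK hτ hh hhτ hu))
          have h2 := abs_kernelWeight_le hGc w hh (W i)
          simp only [Fintype.card_sum, Fintype.card_fin] at h2
          rw [abs_mul, abs_of_pos (one_div_pos.2 (hm.trans_le h1))]
          gcongr
    _ = _ := by simp [mul_comm]

/-! ### The constant of the risk bound -/

section Constants

variable {d₁ d₂ : ℕ} {K : ℝ → ℝ} {p : ℕ} {f : (Fin d₁ ⊕ Fin d₂ → ℝ) → ℝ}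
  {fX : (Fin d₁ → ℝ) → ℝ} {w : Fin d₁ ⊕ Fin d₂ → ℝ} {R : Finset (Fin d₁ ⊕ Fin d₂)}

theorem le_supNorm {ι : Type*} {g : (ι → ℝ) → ℝ} {U : Set (ι → ℝ)} {B : ℝ}
    (hB : ∀ u ∈ U, |g u| ≤ B) {u : ι → ℝ} (hu : u ∈ U) : |g u| ≤ supNorm g U :=
  le_csSup ⟨B, by rintro _ ⟨v, hv, rfl⟩; exact hB v hv⟩ ⟨u, hu, rfl⟩

theorem supNorm_nonneg {ι : Type*} (g : (ι → ℝ) → ℝ) (U : Set (ι → ℝ)) : 0 ≤ supNorm g U :=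
  Real.sSup_nonneg (by rintro _ ⟨v, -, rfl⟩; exact abs_nonneg _)

theorem infDensity_nonneg {d : ℕ} (K : ℝ → ℝ) (n : ℕ) {fX : (Fin d → ℝ) → ℝ}
    (hfX : ∀ u, 0 ≤ fX u) (x : Fin d → ℝ) : 0 ≤ infDensity K n fX x :=
  Real.sInf_nonneg (by rintro _ ⟨v, -, rfl⟩; exact hfX v)

theorem constC_second_nonneg (n : ℕ) (hfX : ∀ u, 0 ≤ fX u) :
    0 ≤ 4 * l2norm K ^ (d₁ + d₂) * supNorm f (nbhdN K n w) ^ (1 / 2 : ℝ) *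
      infDensity K n fX (fstPart w) ^ (-(1 / 2) : ℝ) *
      constT p f R w ^ (-(R.card : ℝ) / (2 * (2 * p + 1))) *
      constTau K p f R w ^ (-(R.card : ℝ) / (2 * (2 * p + R.card))) := by
  have h1 := supNorm_nonneg f (nbhdN K n w)
  have h2 := infDensity_nonneg K n hfX (fstPart w)
  have h3 : 0 ≤ l2norm K := Real.sqrt_nonneg _
  have h4 : 0 ≤ constT p f R w := sq_nonneg _
  have h5 : 0 ≤ constTau K p f R w := sq_nonneg _
  positivity

theorem constC_nonneg (n : ℕ) (hfX : ∀ u, 0 ≤ fX u) : 0 ≤ constC K p n fX f R w := by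
  have h5 : 0 ≤ constTau K p f R w := sq_nonneg _
  have h6 : 0 ≤ ∫ t, |t ^ p / (p.factorial : ℝ) * K t| := integral_nonneg fun _ => abs_nonneg _
  have h7 : 0 ≤ ⨆ k : R, supNorm (partialD p k.1 f) (nbhdN K n w) :=
    Real.iSup_nonneg fun _ => supNorm_nonneg _ _
  exact add_nonneg (by positivity) (constC_second_nonneg n hfX)

/-- The smallest signal of a relevant component is the one appearing in `C_τ`. -/
theorem exists_signal_bounds (hK : IsKernelOfOrder K p) (hp : 1 ≤ p)
    (hderiv : ∀ j ∈ R, partialD p j f w ≠ 0) :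
    ∃ b b' c₂ : ℝ, 0 < b ∧ 0 < b' ∧ 0 < c₂ ∧ (∀ j ∈ R, b ≤ signal K p f w j) ∧
      (∀ j ∈ R, signal K p f w j ≤ b') ∧ (4 * constLambda K (d₁ + d₂) / b) ^ 2 ≤ c₂ ∧
      (R.Nonempty → c₂ = constTau K p f R w) := by
  have hm : 0 < |∫ t, t ^ p * K t| := abs_pos.2 hK.moment_ne_zero
  have hfac : (0 : ℝ) < ((p - 1).factorial : ℝ) := by positivity
  have hs0 : ∀ j, 0 ≤ signal K p f w j := fun j => by unfold signal; positivity
  have hb' : ∀ j ∈ R, signal K p f w j ≤ 1 + ∑ j ∈ R, signal K p f w j := fun j hj => by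
    have := Finset.single_le_sum (fun i _ => hs0 i) hj
    linarith
  have hb'0 : 0 < 1 + ∑ j ∈ R, signal K p f w j := by
    have := Finset.sum_nonneg fun i (_ : i ∈ R) => hs0 i
    linarith
  rcases R.eq_empty_or_nonempty with rfl | hR
  · exact ⟨1, _, (4 * constLambda K (d₁ + d₂) / 1) ^ 2 + 1, one_pos, hb'0, by positivity, by simp,
      hb', by linarith, fun h => absurd h (by simp)⟩
  · have : Nonempty R := hR.to_subtype
    obtain ⟨j₀, hj₀⟩ := exists_eq_ciInf_of_finite (f := fun j : R => |partialD p j.1 f w|)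
    set Dm := ⨅ j : R, |partialD p j.1 f w| with hDm
    have hDm0 : 0 < Dm := by rw [← hj₀]; exact abs_pos.2 (hderiv _ j₀.2)
    have heq : (4 * constLambda K (d₁ + d₂) /
        (Dm * |∫ t, t ^ p * K t| / ((p - 1).factorial : ℝ))) ^ 2 = constTau K p f R w := by
      unfold constTau
      rw [← hDm, ← sq_abs (4 * ((p - 1).factorial : ℝ) * constLambda K (d₁ + d₂) /
        (Dm * ∫ t, t ^ p * K t)), abs_div, abs_mul Dm, abs_of_pos hDm0,
        ← sq_abs (4 * constLambda K (d₁ + d₂) / _), abs_div, abs_mul, abs_mul, abs_mul, abs_div,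
        abs_mul Dm, abs_of_pos hDm0, abs_abs, abs_of_pos hfac]
      congr 1
      field_simp
    refine ⟨Dm * |∫ t, t ^ p * K t| / ((p - 1).factorial : ℝ), _, constTau K p f R w,
      by positivity, hb'0, ?_, fun j hj => ?_, hb', heq.le, fun _ => rfl⟩
    · rw [← heq]
      have := hK.constLambda_pos hp (d₁ + d₂)
      positivity
    · unfold signal
      gcongr
      exact ciInf_le (Set.finite_range _).bddBelow (⟨j, hj⟩ : R)

/-- The constant `C` of the risk bound leaves room for the remainder of the bias expansion and for
the stochastic error. -/
theorem exists_gap (hK : IsKernelOfOrder K p) (hcd : ContDiffAt ℝ p f w)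
    (hderiv : ∀ j ∈ R, partialD p j f w ≠ 0) (hnd : R.Nonempty ∨ f w ≠ 0)
    (hfX : ∀ u, 0 ≤ fX u) (hδ : ∀ᶠ n : ℕ in atTop, 0 < infDensity K n fX (fstPart w))
    {c₂ e Q : ℝ} (hc₂ : 0 < c₂) (hc₂R : R.Nonempty → c₂ = constTau K p f R w) (hQ : 0 ≤ Q)
    (he : e = (p : ℝ) / (2 * p + R.card)) :
    ∃ γ > 0, ∃ η > 0, ∀ᶠ n : ℕ in atTop,
      (∑ j ∈ R, (|partialD p j f w| / (p.factorial : ℝ) * |∫ t, t ^ p * K t| + η * Q)) * c₂ ^ e +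
        γ ≤ constC K p n fX f R w := by
  have hm : 0 < |∫ t, t ^ p * K t| := abs_pos.2 hK.moment_ne_zero
  rcases R.eq_empty_or_nonempty with rfl | hR
  · have hfw : 0 < |f w| := abs_pos.2 (hnd.resolve_left (by simp))
    obtain ⟨t, ht⟩ : ∃ t, K t ≠ 0 := by
      by_contra! h
      exact hK.moment_ne_zero (by simp [h])
    have hl := IsKernelOfOrder.l2norm_pos hK.continuous hK.hasCompactSupport ht
    have hinf : ∀ n, infDensity K n fX (fstPart w) ≤ fX (fstPart w) := fun n =>
      csInf_le ⟨0, by rintro _ ⟨v, -, rfl⟩; exact hfX v⟩ ⟨_, self_mem_nbhd hK _ _, rfl⟩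
    have hfx : 0 < fX (fstPart w) := by
      obtain ⟨n, hn⟩ := hδ.exists
      exact hn.trans_le (hinf n)
    have h3 : ∀ᶠ u in 𝓝 w, |f u| ≤ |f w| + 1 := by
      have := hcd.continuousAt.abs.eventually (gt_mem_nhds (show |f w| < |f w| + 1 by linarith))
      exact this.mono fun u hu => hu.le
    obtain ⟨ρ, -, -, hev⟩ := eventually_nbhd_of_eventually_nhds hK h3
    -- without relevant coordinates there is no bias, and the second summand of `C` is the room
    refine ⟨4 * l2norm K ^ (d₁ + d₂) * |f w| ^ (1 / 2 : ℝ) * fX (fstPart w) ^ (-(1 / 2) : ℝ),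
      by positivity, 1, one_pos, ?_⟩
    filter_upwards [hev, hδ] with n hn hδn
    have h4 := le_supNorm hn.2 (self_mem_nbhd hK _ w)
    have h5 := hinf n
    simp only [constC, Finset.sum_empty, zero_mul, zero_add, Finset.card_empty, Nat.cast_zero,
      mul_zero, neg_zero, zero_div, Real.rpow_zero, mul_one]
    have h6 : fX (fstPart w) ^ (-(1 / 2) : ℝ) ≤
        infDensity K n fX (fstPart w) ^ (-(1 / 2) : ℝ) :=
      Real.rpow_le_rpow_of_nonpos hδn h5 (by norm_num)
    have h7 := supNorm_nonneg f (nbhdN K n w)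
    gcongr
  · have : Nonempty R := hR.to_subtype
    have hr : (0 : ℝ) < R.card := by exact_mod_cast hR.card_pos
    set Dmax := ⨆ j : R, |partialD p j.1 f w| with hDmax
    have hDle : ∀ j ∈ R, |partialD p j f w| ≤ Dmax := fun j hj =>
      le_ciSup (f := fun j : R => |partialD p j.1 f w|) (Set.finite_range _).bddAbove ⟨j, hj⟩
    have hD0 : 0 < Dmax := by
      obtain ⟨j, hj⟩ := hR
      exact (abs_pos.2 (hderiv j hj)).trans_le (hDle j hj)
    set I := ∫ t, |t ^ p / (p.factorial : ℝ) * K t| with hI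
    have hmI : |∫ t, t ^ p * K t| / (p.factorial : ℝ) ≤ I := by
      have h1 : ∫ t, t ^ p / (p.factorial : ℝ) * K t =
          (∫ t, t ^ p * K t) / (p.factorial : ℝ) := by
        rw [← integral_div]
        congr 1; funext t; ring
      have h2 := abs_integral_le_integral_abs (μ := (volume : Measure ℝ))
        (f := fun t : ℝ => t ^ p / (p.factorial : ℝ) * K t)
      rwa [h1, abs_div, Nat.abs_cast] at h2
    have hI0 : 0 < I := lt_of_lt_of_le (by positivity) hmI
    have hce : 0 < c₂ ^ e := Real.rpow_pos_of_pos hc₂ e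
    have hbd : ∀ᶠ u in 𝓝 w, ∀ j ∈ R, |partialD p j f u| ≤ |partialD p j f w| + 1 := by
      refine (Finset.eventually_all R).2 fun j _ => ?_
      have := (continuousAt_partialD (j := j) hcd).abs.eventually
        (gt_mem_nhds (show |partialD p j f w| < |partialD p j f w| + 1 by linarith))
      exact this.mono fun u hu => hu.le
    obtain ⟨ρ, -, -, hev⟩ := eventually_nbhd_of_eventually_nhds hK hbd
    -- the factor `2` in the first summand of `C` is what leaves room
    refine ⟨(1 / 2) * (R.card * c₂ ^ e * I * Dmax), by positivity, I * Dmax / (4 * (Q + 1)),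
      by positivity, ?_⟩
    filter_upwards [hev] with n hn
    have hsup : Dmax ≤ ⨆ k : R, supNorm (partialD p k.1 f) (nbhdN K n w) := by
      refine ciSup_mono (Set.finite_range _).bddAbove fun j => ?_
      exact le_supNorm (fun u hu => hn.2 u hu j.1 j.2) (self_mem_nbhd hK _ w)
    have hsecond := constC_second_nonneg (f := f) (K := K) (p := p) (R := R) (w := w) n hfX
    have hηQ : I * Dmax / (4 * (Q + 1)) * Q ≤ I * Dmax / 4 := by
      rw [div_mul_eq_mul_div, div_le_div_iff₀ (by positivity) (by norm_num)]
      have : 0 < I * Dmax := by positivity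
      nlinarith
    have hsum : ∑ j ∈ R, (|partialD p j f w| / (p.factorial : ℝ) * |∫ t, t ^ p * K t| +
        I * Dmax / (4 * (Q + 1)) * Q) ≤ R.card * (5 / 4 * (I * Dmax)) := by
      rw [← nsmul_eq_mul]
      refine Finset.sum_le_card_nsmul _ _ _ fun j hj => ?_
      have h1 : |partialD p j f w| / (p.factorial : ℝ) * |∫ t, t ^ p * K t| ≤ I * Dmax := by
        calc _ = |∫ t, t ^ p * K t| / (p.factorial : ℝ) * |partialD p j f w| := by ring
          _ ≤ I * Dmax := by
              have := hDle j hj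
              gcongr
      linarith
    have hfirst : 2 * (R.card : ℝ) * c₂ ^ e * I * Dmax ≤ 2 * (R.card : ℝ) * c₂ ^ e * I *
        ⨆ k : R, supNorm (partialD p k.1 f) (nbhdN K n w) := by gcongr
    unfold constC
    rw [← hc₂R hR, ← he] at *
    have h8 := mul_le_mul_of_nonneg_right hsum hce.le
    have h9 : 0 < (R.card : ℝ) * c₂ ^ e * I * Dmax := by positivity
    nlinarith

end Constants

/-! ### From high probability to the `L^q` risk -/

/-- A bound `A` outside an event and a crude bound `D` on it control the `L^q` norm. -/
theorem integral_rpow_le_of_bad_set {Ω : Type*} [MeasurableSpace Ω] {μ : Measure Ω}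
    [IsProbabilityMeasure μ] {F : Ω → ℝ} (hF : Measurable F) {q : ℝ} (hq : 1 ≤ q) {A D : ℝ}
    (hA : 0 ≤ A) (hD : 0 ≤ D) {bad : Set Ω} (hbad : MeasurableSet bad)
    (hgood : ∀ ω ∉ bad, |F ω| ≤ A) (hall : ∀ᵐ ω ∂μ, |F ω| ≤ D) :
    Integrable (fun ω => |F ω| ^ q) μ ∧
      (∫ ω, |F ω| ^ q ∂μ) ^ (1 / q) ≤ A + D * μ.real bad ^ (1 / q) := by
  have hq0 : 0 < q := by linarith
  have hint : Integrable (fun ω => |F ω| ^ q) μ := by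
    refine Integrable.of_bound (C := D ^ q) (hF.abs.pow_const q).aestronglyMeasurable ?_
    filter_upwards [hall] with ω hω
    rw [Real.norm_eq_abs, abs_of_nonneg (by positivity)]
    gcongr
  refine ⟨hint, ?_⟩
  have hle : ∫ ω, |F ω| ^ q ∂μ ≤ A ^ q + D ^ q * μ.real bad := by
    calc ∫ ω, |F ω| ^ q ∂μ ≤ ∫ ω, A ^ q + bad.indicator (fun _ => D ^ q) ω ∂μ := by
          refine integral_mono_ae hint
            ((integrable_const _).add ((integrable_const _).indicator hbad)) ?_
          filter_upwards [hall] with ω hω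
          by_cases hb : ω ∈ bad
          · simp only [Set.indicator_of_mem hb]
            have : |F ω| ^ q ≤ D ^ q := by gcongr
            have : 0 ≤ A ^ q := by positivity
            linarith
          · simp only [Set.indicator_of_notMem hb, add_zero]
            have := hgood ω hb
            gcongr
      _ = _ := by
          rw [integral_add (integrable_const _) ((integrable_const _).indicator hbad),
            integral_indicator_const _ hbad]
          simp [mul_comm]
  have h0 : 0 ≤ ∫ ω, |F ω| ^ q ∂μ := integral_nonneg fun ω => by positivity
  calc (∫ ω, |F ω| ^ q ∂μ) ^ (1 / q) ≤ (A ^ q + D ^ q * μ.real bad) ^ (1 / q) := by gcongr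
    _ ≤ (A ^ q) ^ (1 / q) + (D ^ q * μ.real bad) ^ (1 / q) :=
        Real.rpow_add_le_add_rpow (by positivity) (by positivity) (by positivity)
          (by rw [div_le_one hq0]; exact hq)
    _ = _ := by
        rw [Real.mul_rpow (by positivity) (by positivity), ← Real.rpow_mul hA,
          ← Real.rpow_mul hD, mul_one_div_cancel hq0.ne', Real.rpow_one, Real.rpow_one]

theorem eventually_mul_log_rpow_le (C s : ℝ) :
    ∀ᶠ n : ℕ in atTop, C * Real.log n ^ s ≤ n := by
  have h1 := ((isLittleO_log_rpow_rpow_atTop s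
    (show (0 : ℝ) < 1 by norm_num)).tendsto_div_nhds_zero).comp
      (tendsto_natCast_atTop_atTop (R := ℝ))
  have h2 := h1.const_mul C
  rw [mul_zero] at h2
  filter_upwards [h2.eventually (gt_mem_nhds one_pos), eventually_gt_atTop 0] with n hn hn0
  have hn' : (0 : ℝ) < n := by exact_mod_cast hn0
  simp only [Function.comp, Real.rpow_one] at hn
  rw [← mul_div_assoc, div_lt_one hn'] at hn
  exact hn.le

/-! ### The orders of magnitude -/

theorem eventually_log_div_le_pow (m : ℕ) :
    ∀ᶠ n : ℕ in atTop, Real.log n / n ≤ (1 / Real.log n) ^ m := by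
  filter_upwards [eventually_mul_log_rpow_le 1 ((m + 1 : ℕ) : ℝ),
    tendsto_log_nat.eventually_gt_atTop 0, eventually_gt_atTop 0] with n hn hL hn0
  have hn' : (0 : ℝ) < n := by exact_mod_cast hn0
  rw [Real.rpow_natCast, one_mul, pow_succ'] at hn
  rw [one_div_pow, div_le_div_iff₀ hn' (by positivity), one_mul]
  exact hn

theorem eventually_rate_pow_le (c a : ℝ) (s m r : ℕ) (hc : 0 ≤ c) :
    ∀ᶠ n : ℕ in atTop, (c * (Real.log n ^ a * Real.log n ^ s / n)) ^ r ≤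
      ((1 / Real.log n) ^ r) ^ m := by
  filter_upwards [eventually_mul_log_rpow_le c (a + s + m),
    tendsto_log_nat.eventually_gt_atTop 0, eventually_gt_atTop 0] with n hn hL hn0
  have hn' : (0 : ℝ) < n := by exact_mod_cast hn0
  rw [Real.rpow_add hL, Real.rpow_add hL, Real.rpow_natCast, Real.rpow_natCast] at hn
  rw [← pow_mul, mul_comm r m, pow_mul]
  refine pow_le_pow_left₀ (by positivity) ?_ r
  rw [one_div_pow, ← mul_div_assoc, div_le_div_iff₀ hn' (by positivity), one_mul]
  linarith

theorem rate_rpow_eq {L n a e : ℝ} (hL : 0 < L) (hn : 0 < n) {d r : ℕ} (hr : r ≤ d) :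
    (L ^ a * L ^ (d - r) / n) ^ e = L ^ (e * ((d : ℝ) - r + a)) * n ^ (-e) := by
  rw [Real.div_rpow (by positivity) hn.le, ← Real.rpow_natCast, ← Real.rpow_add hL,
    ← Real.rpow_mul hL.le, Nat.cast_sub hr, Real.rpow_neg hn.le, div_eq_mul_inv]
  congr 2
  ring

section Risk

variable {Ω : Type*} [MeasurableSpace Ω] {μ : Measure Ω} {d₁ d₂ : ℕ}
  {W : ℕ → Ω → Fin d₁ ⊕ Fin d₂ → ℝ} {fX : (Fin d₁ → ℝ) → ℝ} {f : (Fin d₁ ⊕ Fin d₂ → ℝ) → ℝ}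
  {w : Fin d₁ ⊕ Fin d₂ → ℝ} {p : ℕ} {K : ℝ → ℝ} {β a : ℝ} {R : Finset (Fin d₁ ⊕ Fin d₂)}
  {ftX : ℕ → Ω → (Fin d₁ → ℝ) → ℝ}

theorem inGrid_selectedBandwidth {n : ℕ} (hβ₀ : 0 < β) (hβ₁ : β < 1) (hL : 0 < Real.log n)
    (hinit : Real.log n / n ≤ (1 / Real.log n) ^ (d₁ + d₂)) (g : (Fin d₁ → ℝ) → ℝ)
    (V : ℕ → Fin d₁ ⊕ Fin d₂ → ℝ) :
    InGrid β (β ^ (d₁ + d₂)) n (selectedBandwidth K a β n g V w) := by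
  have hcard : Fintype.card (Fin d₁ ⊕ Fin d₂) = d₁ + d₂ := by simp
  have := inGrid_loopOutput (statZ K n g V w) (threshold K a n) hβ₀ hβ₁ hL (by rwa [hcard])
  rwa [hcard] at this

/-- The selected bandwidth and the estimator of `f_X` are at least polynomially small, so the
error is at most polynomially large. -/
theorem eventually_ae_abs_cdRodeo_sub_le (hK : IsKernelOfOrder K p) (hβ₀ : 0 < β) (hβ₁ : β < 1)
    {κ : ℝ} (hftX_lower : ∀ᶠ n : ℕ in atTop, ∀ᵐ ω ∂μ, ∀ u ∈ nbhdN K n (fstPart w),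
      (n : ℝ) ^ (-κ) ≤ ftX n ω u) :
    ∀ᶠ n : ℕ in atTop, ∀ᵐ ω ∂μ,
      |cdRodeo K a β n (ftX n ω) (fun i => W i ω) w - f w| ≤ (n : ℝ) ^ (|κ| + 3) := by
  obtain ⟨c, hc1, hc⟩ := exists_kernelFamily_bound (Fin d₁ ⊕ Fin d₂) hK
  have hc0 : 0 < c := by linarith
  have hlarge : ∀ C : ℝ, ∀ᶠ n : ℕ in atTop, C ≤ n := fun C =>
    tendsto_natCast_atTop_atTop.eventually_ge_atTop _
  filter_upwards [hftX_lower, eventually_log_div_le_pow (d₁ + d₂), hlarge |f w|,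
    hlarge (c ^ (d₁ + d₂) / β ^ (d₁ + d₂)), tendsto_log_nat.eventually_ge_atTop 1,
    eventually_ge_atTop 2] with n hlow hinit hfn hcn hL1 hn2
  have hL : 0 < Real.log n := by linarith
  have hn2' : (2 : ℝ) ≤ n := by exact_mod_cast hn2
  have hn' : (0 : ℝ) < n := by linarith
  have hn1 : (1 : ℝ) ≤ n := by linarith
  filter_upwards [hlow] with ω hω
  set h := selectedBandwidth K a β n (ftX n ω) (fun i => W i ω) w with hh
  have hgrid : InGrid β (β ^ (d₁ + d₂)) n h := inGrid_selectedBandwidth hβ₀ hβ₁ hL hinit _ _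
  have h1 := abs_kernelEstWith_le hK (G := fun _ => K)
    (fun _ t ht => image_eq_zero_of_notMem_tsupport ht) hc0.le (fun k t => hc none k t)
    (by omega : 0 < n) (g := ftX n ω) (fun i => W i ω) (one_div_pos.2 hL)
    (Real.rpow_pos_of_pos hn' (-κ)) (hgrid.pos hβ₀ hL) (hgrid.le_init hβ₀ hβ₁ hL) hω
  have h2 : c ^ (d₁ + d₂) / ∏ k, h k ≤ (n : ℝ) * n := by
    have h3 : β ^ (d₁ + d₂) / n ≤ ∏ k, h k := by
      refine le_trans ?_ hgrid.le_prod
      rw [mul_div_assoc']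
      gcongr
      exact le_mul_of_one_le_right (by positivity) hL1
    calc c ^ (d₁ + d₂) / ∏ k, h k ≤ c ^ (d₁ + d₂) / (β ^ (d₁ + d₂) / n) := by gcongr
      _ = c ^ (d₁ + d₂) / β ^ (d₁ + d₂) * n := by field_simp
      _ ≤ n * n := by gcongr
  have h4 : 1 / (n : ℝ) ^ (-κ) ≤ (n : ℝ) ^ |κ| := by
    rw [Real.rpow_neg hn'.le, one_div, inv_inv]
    exact Real.rpow_le_rpow_of_exponent_le hn1 (le_abs_self κ)
  have h5 : (1 : ℝ) ≤ (n : ℝ) ^ |κ| := Real.one_le_rpow hn1 (abs_nonneg κ)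
  have h6 : 0 ≤ c ^ (d₁ + d₂) / ∏ k, h k := by
    have := Finset.prod_nonneg fun k (_ : k ∈ Finset.univ) => (hgrid.pos hβ₀ hL k).le
    positivity
  have h7 : |cdRodeo K a β n (ftX n ω) (fun i => W i ω) w| ≤ (n : ℝ) ^ |κ| * (n * n) :=
    h1.trans (mul_le_mul h4 h2 h6 (by positivity))
  have h8 : (n : ℝ) ^ (|κ| + 3) = (n : ℝ) ^ |κ| * (n * n * n) := by
    rw [Real.rpow_add hn', show (3 : ℝ) = ((3 : ℕ) : ℝ) by norm_num, Real.rpow_natCast]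
    ring
  rw [h8]
  refine (abs_sub _ _).trans ?_
  have h9 : |f w| ≤ (n : ℝ) ^ |κ| * (n * n) := by
    refine hfn.trans ?_
    have : (n : ℝ) ≤ n * n := by nlinarith
    nlinarith
  have h10 : 2 * ((n : ℝ) ^ |κ| * (n * n)) ≤ n * ((n : ℝ) ^ |κ| * (n * n)) := by gcongr
  linarith

variable [IsProbabilityMeasure μ]

/-- If `f` vanishes near `w`, so does the estimator. -/
theorem eventually_ae_cdRodeo_eq_zero (hW : ∀ i, Measurable (W i))
    (hfX_meas : Measurable fX) (hfX_nonneg : ∀ u, 0 ≤ fX u) (hf_meas : Measurable f)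
    (hdens : ∀ i, HasCondDensity μ (W i) fX f) (hK : IsKernelOfOrder K p) (hβ₀ : 0 < β)
    (hβ₁ : β < 1) (hzero : ∀ᶠ n : ℕ in atTop, ∀ u ∈ nbhdN K n w, f u = 0) :
    ∀ᶠ n : ℕ in atTop, ∀ᵐ ω ∂μ, cdRodeo K a β n (ftX n ω) (fun i => W i ω) w = 0 := by
  filter_upwards [hzero, eventually_log_div_le_pow (d₁ + d₂),
    tendsto_log_nat.eventually_gt_atTop 0] with n hz hinit hL
  have hae : ∀ᵐ ω ∂μ, ∀ i, W i ω ∉ nbhdN K n w := ae_all_iff.2 fun i =>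
    (hdens i).ae_notMem (hW i) hfX_meas hfX_nonneg hf_meas hz
  filter_upwards [hae] with ω hω
  have hgrid := inGrid_selectedBandwidth (K := K) (a := a) (w := w) hβ₀ hβ₁ hL hinit (ftX n ω)
    (fun i => W i ω)
  unfold cdRodeo
  rw [kernelEst_eq, kernelEstWith, Finset.sum_eq_zero, mul_zero]
  intro i _
  have : kernelWeight (fun _ => K) w
      (selectedBandwidth K a β n (ftX n ω) (fun i => W i ω) w) (W i ω) = 0 := by
    by_contra hne
    exact hω i (mem_nbhd_of_kernelWeight_ne_zero hK
      (fun _ t ht => image_eq_zero_of_notMem_tsupport ht) (one_div_pos.2 hL)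
      (hgrid.pos hβ₀ hL) (hgrid.le_init hβ₀ hβ₁ hL) hne)
  rw [this, mul_zero]

/-- Outside an event whose probability decays faster than any given power of `n`, the error is at
most the leading term of the risk bound. -/
theorem eventually_exists_bad_set_cdRodeo (hW : ∀ i, Measurable (W i)) (hindep : iIndepFun W μ)
    (hfX_meas : Measurable fX) (hfX_nonneg : ∀ u, 0 ≤ fX u)
    (hf_meas : Measurable f) (hf_nonneg : ∀ u, 0 ≤ f u)
    (hdens : ∀ i, HasCondDensity μ (W i) fX f) (hp : 1 ≤ p) (hK : IsKernelOfOrder K p)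
    (hβ₀ : 0 < β) (hβ₁ : β < 1) (ha : 1 < a)
    (hδ : ∀ᶠ n : ℕ in atTop, 0 < infDensity K n fX (fstPart w))
    (hsparse : ∀ᶠ n : ℕ in atTop, ∀ u ∈ nbhdN K n w, ∀ v ∈ nbhdN K n w,
      (∀ j ∈ R, u j = v j) → f u = f v)
    (hreg : ∀ᶠ n : ℕ in atTop, ContDiffOn ℝ p f (nbhdN K n w))
    (hderiv : ∀ j ∈ R, partialD p j f w ≠ 0) (hnd : R.Nonempty ∨ f w ≠ 0) {κ M : ℝ}
    (hM : 0 < M)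
    (hftX_lower : ∀ᶠ n : ℕ in atTop, ∀ᵐ ω ∂μ, ∀ u ∈ nbhdN K n (fstPart w),
      (n : ℝ) ^ (-κ) ≤ ftX n ω u)
    (hftX_conc : ∀ᶠ n : ℕ in atTop,
      μ {ω | ∃ u ∈ nbhdN K n (fstPart w),
          M * (Real.log n ^ (((d₁ + d₂ : ℕ) : ℝ) / 2) / (n : ℝ) ^ (1 / 2 : ℝ)) <
            |(fX u - ftX n ω u) / ftX n ω u|} ≤
        ENNReal.ofReal (Real.exp (-(Real.log n ^ (5 / 4 : ℝ))))) (D : ℝ) :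
    ∀ᶠ n : ℕ in atTop, ∃ bad : Set Ω, MeasurableSet bad ∧
      μ bad ≤ ENNReal.ofReal ((n : ℝ) ^ (-D)) ∧
      ∀ ω ∉ bad, |cdRodeo K a β n (ftX n ω) (fun i => W i ω) w - f w| ≤
        constC K p n fX f R w *
          (Real.log n ^ a * Real.log n ^ (d₁ + d₂ - R.card) / n) ^
            ((p : ℝ) / (2 * p + R.card)) := by
  set e : ℝ := (p : ℝ) / (2 * p + R.card) with he
  set Cl := constLambda K (d₁ + d₂) with hCl
  have hCl0 : 0 < Cl := hK.constLambda_pos hp _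
  have hcd := contDiffAt_of_eventually hK hreg
  obtain ⟨b, b', c₂, hb, hb', hc₂, hbR, hbR', hc₂b, hc₂R⟩ :=
    exists_signal_bounds (d₁ := d₁) (d₂ := d₂) (R := R) hK hp hderiv
  have hmass : 0 ≤ absMassPow K (d₁ + d₂) :=
    pow_nonneg (integral_nonneg fun _ => abs_nonneg _) _
  set Q := (∫ t, |t ^ p * K t|) / (p.factorial : ℝ) * absMassPow K (d₁ + d₂) with hQ
  have hQ0 : 0 ≤ Q :=
    mul_nonneg (div_nonneg (integral_nonneg fun _ => abs_nonneg _) (by positivity)) hmass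
  set QJ := (∫ t, |t ^ p * J K t|) / (p.factorial : ℝ) * absMassPow K (d₁ + d₂) with hQJ
  have hQJ0 : 0 ≤ QJ :=
    mul_nonneg (div_nonneg (integral_nonneg fun _ => abs_nonneg _) (by positivity)) hmass
  obtain ⟨γ, hγ, η₀, hη₀, hgap⟩ :=
    exists_gap hK hcd hderiv hnd hfX_nonneg hδ hc₂ hc₂R hQ0 he
  -- the precision of the expansions
  set η := min η₀ (b / 4 / (QJ + 1)) with hη
  have hη0 : 0 < η := by positivity
  have hηQJ : η * QJ ≤ b / 4 := by
    calc η * QJ ≤ b / 4 / (QJ + 1) * (QJ + 1) := by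
          gcongr
          · exact min_le_right _ _
          · linarith
      _ = b / 4 := by field_simp
  obtain ⟨ρ, B, hregn⟩ := eventually_isRegularNear hK hsparse hreg hη0
  obtain ⟨δ, hδ0, hδn⟩ := eventually_le_density hK hfX_nonneg hδ
  set c₁ := (3 * Cl / (5 * b')) ^ 2 with hc₁
  have hc₁0 : 0 < c₁ := by positivity
  set c₆ := (β ^ (R.card * (2 * p + R.card)) * c₁ ^ R.card) ^
    (-(1 / (2 * (2 * p + R.card) : ℝ))) with hc₆
  have hc₆0 : 0 < c₆ := by positivity
  -- the precision of the stochastic approximation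
  set ε := min (Cl / 4) (γ / c₆) with hε
  have hε0 : 0 < ε := by positivity
  have hεγ : ε * c₆ ≤ γ := by
    rw [← le_div_iff₀ hc₆0]; exact min_le_right _ _
  filter_upwards [eventually_exists_bad_set (a := a) hW hindep hfX_meas hfX_nonneg hf_meas
      hf_nonneg hdens hK hregn hδ0 hδn hM hftX_lower hftX_conc hβ₀ hβ₁
      (show 0 < β ^ (d₁ + d₂) by positivity) ha hε0 D, hregn, hgap,
    eventually_mul_log_le 1 hc₂ ha, eventually_log_div_le_pow (d₁ + d₂),
    eventually_rate_pow_le c₁ a (d₁ + d₂ - R.card) (2 * p + R.card) R.card hc₁0.le,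
    tendsto_log_nat.eventually_ge_atTop 1, eventually_gt_atTop 0]
    with n ⟨bad, hbad, hμbad, hgood⟩ hrn hgapn hsmall hinit hinit' hL hn
  have hn' : (0 : ℝ) < n := by exact_mod_cast hn
  have hL0 : 0 < Real.log n := by linarith
  refine ⟨bad, hbad, hμbad, fun ω hω => ?_⟩
  set x := Real.log n ^ a * Real.log n ^ (d₁ + d₂ - R.card) / n with hx
  have hx0 : 0 < x := by positivity
  have hmain : |cdRodeo K a β n (ftX n ω) (fun i => W i ω) w - f w| ≤
      (∑ j ∈ R, (|partialD p j f w| / (p.factorial : ℝ) * |∫ t, t ^ p * K t| + η * Q)) *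
        (c₂ * x) ^ e + ε * (c₆ * x ^ e) :=
    abs_cdRodeo_sub_le hK hp hf_meas hn hL hrn hβ₀ hβ₁ (min_le_left _ _) (hgood ω hω) hb
      hb' hbR hbR' hηQJ hc₁ hc₂b hx (by linarith) hinit hinit'
  refine hmain.trans ?_
  rw [Real.mul_rpow hc₂.le hx0.le, ← mul_assoc _ (c₂ ^ e) (x ^ e), ← mul_assoc ε c₆, ← add_mul]
  refine mul_le_mul_of_nonneg_right (le_trans (add_le_add ?_ hεγ) hgapn) (by positivity)
  have : η ≤ η₀ := min_le_left _ _
  gcongr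

end Risk

end CDRodeo

theorem corollary1 {Ω : Type*} [MeasurableSpace Ω] (μ : Measure Ω) [IsProbabilityMeasure μ]
    -- the sample `W_i = (X_i, Y_i)`, its densities, and the point of interest
    (d₁ d₂ : ℕ) (W : ℕ → Ω → Fin d₁ ⊕ Fin d₂ → ℝ)
    (fX : (Fin d₁ → ℝ) → ℝ) (f : (Fin d₁ ⊕ Fin d₂ → ℝ) → ℝ) (w : Fin d₁ ⊕ Fin d₂ → ℝ)
    (hW : ∀ i, Measurable (W i)) (hindep : iIndepFun W μ)
    (hfX_meas : Measurable fX) (hfX_nonneg : ∀ u, 0 ≤ fX u)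
    (hf_meas : Measurable f) (hf_nonneg : ∀ u, 0 ≤ f u)
    (hdens : ∀ i, HasCondDensity μ (W i) fX f)
    -- the tuning parameters of the procedure
    (p : ℕ) (hp : 1 ≤ p) (K : ℝ → ℝ) (hK : IsKernelOfOrder K p)
    (β : ℝ) (hβ₀ : 0 < β) (hβ₁ : β < 1) (a : ℝ) (ha : 1 < a)
    -- `f_X` is bounded away from `0` on `𝒰_n(x)`
    (hδ : ∀ᶠ n : ℕ in atTop, 0 < infDensity K n fX (fstPart w))
    -- sparsity: on `𝒰_n(w)`, `f` depends only on the components in `R`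
    (R : Finset (Fin d₁ ⊕ Fin d₂))
    (hsparse : ∀ᶠ n : ℕ in atTop, ∀ u ∈ nbhdN K n w, ∀ v ∈ nbhdN K n w,
      (∀ j ∈ R, u j = v j) → f u = f v)
    -- regularity of `f`
    (hreg : ∀ᶠ n : ℕ in atTop, ContDiffOn ℝ p f (nbhdN K n w))
    (hderiv : ∀ j ∈ R, partialD p j f w ≠ 0)
    -- the estimator of `f_X`: lower bound and concentration
    (ftX : ℕ → Ω → (Fin d₁ → ℝ) → ℝ)
    (hftX_meas : ∀ n, Measurable (fun z : Ω × (Fin d₁ → ℝ) => ftX n z.1 z.2))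
    (κ : ℝ)
    (hftX_lower : ∀ᶠ n : ℕ in atTop, ∀ᵐ ω ∂μ, ∀ u ∈ nbhdN K n (fstPart w),
      (n : ℝ) ^ (-κ) ≤ ftX n ω u)
    (M : ℝ) (hM : 0 < M)
    (hftX_conc : ∀ᶠ n : ℕ in atTop,
      μ {ω | ∃ u ∈ nbhdN K n (fstPart w),
          M * (Real.log n ^ (((d₁ + d₂ : ℕ) : ℝ) / 2) / (n : ℝ) ^ (1 / 2 : ℝ)) <
            |(fX u - ftX n ω u) / ftX n ω u|} ≤
        ENNReal.ofReal (Real.exp (-(Real.log n ^ (5 / 4 : ℝ)))))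
    (q : ℝ) (hq : 1 ≤ q) :
    ∃ ε : ℕ → ℝ, ε =o[atTop] (fun n : ℕ => ((n : ℝ))⁻¹) ∧
      ∀ᶠ n : ℕ in atTop,
        Integrable (fun ω => |cdRodeo K a β n (ftX n ω) (fun i => W i ω) w - f w| ^ q) μ ∧
        (∫ ω, |cdRodeo K a β n (ftX n ω) (fun i => W i ω) w - f w| ^ q ∂μ) ^ (1 / q) ≤
          constC K p n fX f R w *
              Real.log n ^ ((p : ℝ) / (2 * p + R.card) * (((d₁ + d₂ : ℕ) : ℝ) - R.card + a)) *
              (n : ℝ) ^ (-((p : ℝ) / (2 * p + R.card))) +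
            ε n := by
  have hq0 : q ≠ 0 := by positivity
  refine ⟨fun n => (n : ℝ) ^ (-2 : ℝ), ?_, ?_⟩
  · have h1 : (fun n : ℕ => ((n : ℝ))⁻¹ * (n : ℝ)⁻¹) =o[atTop] fun n : ℕ => 1 * ((n : ℝ))⁻¹ :=
      ((Asymptotics.isLittleO_one_iff ℝ).2 tendsto_inv_atTop_nhds_zero_nat).mul_isBigO
        (Asymptotics.isBigO_refl _ _)
    refine (h1.congr_right fun n => one_mul _).congr_left fun n => ?_
    rw [Real.rpow_neg (Nat.cast_nonneg n), Real.rpow_two, sq, mul_inv]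
  have hr : R.card ≤ d₁ + d₂ := by simpa using Finset.card_le_univ R
  by_cases hnd : R.Nonempty ∨ f w ≠ 0
  · -- the power `D` turns the crude polynomial bound into `n⁻²`
    filter_upwards [eventually_exists_bad_set_cdRodeo hW hindep hfX_meas hfX_nonneg hf_meas
        hf_nonneg hdens hp hK hβ₀ hβ₁ ha hδ hsparse hreg hderiv hnd hM hftX_lower hftX_conc
        ((|κ| + 5) * q),
      eventually_ae_abs_cdRodeo_sub_le (a := a) (W := W) (f := f) hK hβ₀ hβ₁ hftX_lower,
      tendsto_log_nat.eventually_gt_atTop 0, eventually_gt_atTop 0]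
      with n ⟨bad, hbad, hμbad, hgood⟩ hall hL hn
    have hn' : (0 : ℝ) < n := by exact_mod_cast hn
    have hC := constC_nonneg (K := K) (p := p) (f := f) (w := w) (R := R) n hfX_nonneg
    obtain ⟨hint, hle⟩ := integral_rpow_le_of_bad_set
      ((measurable_cdRodeo hW hK (hftX_meas n) a hβ₀ hβ₁ hL w).sub_const (f w)) hq
      (by positivity) (by positivity) hbad hgood hall
    refine ⟨hint, hle.trans (add_le_add (le_of_eq ?_) ?_)⟩
    · rw [rate_rpow_eq hL hn' hr, mul_assoc]
    · have hreal : μ.real bad ≤ (n : ℝ) ^ (-((|κ| + 5) * q)) :=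
        ENNReal.toReal_le_of_le_ofReal (by positivity) hμbad
      calc (n : ℝ) ^ (|κ| + 3) * μ.real bad ^ (1 / q)
          ≤ (n : ℝ) ^ (|κ| + 3) * ((n : ℝ) ^ (-((|κ| + 5) * q))) ^ (1 / q) := by gcongr
        _ = (n : ℝ) ^ (-2 : ℝ) := by
            rw [← Real.rpow_mul hn'.le, ← Real.rpow_add hn']
            congr 1
            field_simp
            ring
  · -- here `f` vanishes near `w`, and so does its estimator
    push Not at hnd
    obtain ⟨rfl, hfw⟩ := hnd
    have hzero : ∀ᶠ n : ℕ in atTop, ∀ u ∈ nbhdN K n w, f u = 0 := hsparse.mono fun n hn u hu =>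
      (hn u hu w (self_mem_nbhd hK _ w) (by simp)).trans hfw
    filter_upwards [eventually_ae_cdRodeo_eq_zero (a := a) (ftX := ftX) hW hfX_meas hfX_nonneg
      hf_meas hdens hK hβ₀ hβ₁ hzero, tendsto_log_nat.eventually_gt_atTop 0] with n hn hL
    have hae : (fun ω => |cdRodeo K a β n (ftX n ω) (fun i => W i ω) w - f w| ^ q)
        =ᵐ[μ] fun _ => 0 := by
      filter_upwards [hn] with ω hω
      rw [hω, hfw, sub_zero, abs_zero, Real.zero_rpow hq0]
    refine ⟨(integrable_zero Ω ℝ μ).congr hae.symm, ?_⟩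
    rw [integral_congr_ae hae, integral_zero, Real.zero_rpow (by positivity)]
    have hC := constC_nonneg (K := K) (p := p) (f := f) (w := w) (R := ∅) n hfX_nonneg
    positivity
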